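/- **Setting.** Let $d\ge 2$, let $\Omega\subset\mathbb R^d$ be a bounded open set with $C^1$ boundary, outward unit normal $n(x)$ and surface measure $\pi$ on $\partial\Omega$. Let $m$ be a nonnegative ($\sigma$-finite) Borel measure on $\mathbb R^d$, invariant under all orthogonal maps, with support $V$, such that $0\in V$, $m(\{0\})=0$ and $m(V\cap B(0,r))>0$ for all $r>0$. For $s\in\mathbb N=\{0,1,\dots\}$ put $$X_s=L^1\big(\Omega\times V,\ \max(1,|v|^{-s})\,dx\otimes m(dv)\big)$$ with its usual norm. Put $\Gamma_\pm=\{(x,v)\in\partial\Omega\times V:\ \pm v\cdot n(x)>0\}$, $d\mu_\pm=|v\cdot n(x)|\,\pi(dx)\otimes m(dv)$ on $\Gamma_\pm$, $L^1_\pm=L^1(\Gamma_\pm,\mu_\pm)$, $Y^-_s=L^1(\Gamma_-,\max(1,|v|^{-s})\,d\mu_-)$, and $t_-(x,v)=\inf\{s>0:\ x-sv\notin\Omega\}$ for $(x,v)\in\overline\Omega\times V$. Let $H:L^1_+\to L^1_-$ be the diffuse boundary operator $$H\psi(x,v)=\int_{v'\cdot n(x)>0}\kappa(x,v,v')\,\psi(x,v')\,|v'\cdot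 n(x)|\,m(dv'),\qquad (x,v)\in\Gamma_-,$$ where $\kappa\ge 0$ is measurable and $\int_{v\cdot n(x)<0}\kappa(x,v,v')|v\cdot n(x)|\,m(dv)=1$ for $\mu_+$-almost all $(x,v')\in\Gamma_+$. Assume that the set of all $k\in\mathbb N$ with $H\in\mathscr B(L^1_+,Y^-_{k+1})$ is non-empty and bounded, and let $N_H$ be its maximum. Let $U_n(t)$ $(n\in\mathbb N,\ t\ge 0)$ be the Dyson–Phillips iterates: $[U_0(t)f](x,v)=f(x-tv,v)\mathbf 1_{\{t<t_-(x,v)\}}$ and $$[U_{n+1}(t)f](x,v)=\mathbf 1_{\{s<t\}}\,\big[H\,B^+U_n(t-s)f\big](x-sv,v)\Big|_{s=t_-(x,v)},$$ where $B^+\psi$ is the trace on $\Gamma_+$, taken along characteristics: $B^+\psi(y,w)=\lim_{h\to0^+}\frac1h\int_0^h\psi(y-sw,w)\,ds$. **Statement.** For all $n\in\mathbb N$ and $t\ge0$ this defines a bounded linear operator $U_n(t)$ on $X_0$, and the following hold. 1. For every $k\in\mathbb N$ there is a constant $C_k>0$ (independent of $f$, $n$ and $t$) such that, for all $f\in X_k$,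 all $n\in\mathbb N$ and all $t>0$, $$\|U_n(t)f\|_{X_0}\le C_k\left((2^n-1)\Big(\frac{n+1}{t}\Big)^{N_H+1}+\Big(\frac{n+1}{t}\Big)^{k}\right)\|f\|_{X_k}.$$ 2. For every $n\in\mathbb N$ there is a constant $C_n>0$ (independent of $f$ and $t$) such that, for all $f\in X_{N_H+1}$ and all $t>0$, $$\Big\|\sum_{k=0}^{n}U_k(t)f\Big\|_{X_0}\le C_n\,t^{-(N_H+1)}\,\|f\|_{X_{N_H+1}}.$$ -/

import Mathlib

open MeasureTheory Filter Topology
open scoped ENNReal NNReal InnerProductSpace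

noncomputable section

namespace DiffuseTransport

/-- The space `ℝ^d` with its Euclidean structure (positions and velocities). -/
abbrev Space (d : ℕ) : Type := EuclideanSpace ℝ (Fin d)

variable {d : ℕ}

/-! ### The domain: `C¹` boundary, outward normal, surface measure -/

/-- In the ball `B(x₀, r)`, the set `Ω` is the region below the graph, over the hyperplane
orthogonal to the unit vector `e`, of a `C¹` function (only the values of `φ` on this hyperplane
are used). -/
structure IsBoundaryChart (Ω : Set (Space d)) (x₀ e : Space d) (φ : Space d → ℝ) (r : ℝ) :
    Prop where
  unit : ‖e‖ = 1
  smooth : ContDiff ℝ 1 φ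
  pos : 0 < r
  below : ∀ x ∈ Metric.ball x₀ r, x ∈ Ω ↔ ⟪x, e⟫_ℝ < φ (x - ⟪x, e⟫_ℝ • e)

/-- `Ω` has a `C¹` boundary: it is locally, on one side, the subgraph of a `C¹` function. -/
def HasC1Boundary (Ω : Set (Space d)) : Prop :=
  ∀ x₀ ∈ frontier Ω, ∃ e φ r, IsBoundaryChart Ω x₀ e φ r

/-- `ν` is the outward unit normal of `Ω` at the boundary point `x`: the normalized gradient of the
local defining function `y ↦ ⟪y, e⟫ - φ (y - ⟪y, e⟫ e)`, which is negative exactly in `Ω`. -/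
def IsOutwardNormal (Ω : Set (Space d)) (x ν : Space d) : Prop :=
  x ∈ frontier Ω ∧ ∃ e φ r, IsBoundaryChart Ω x e φ r ∧ ‖ν‖ = 1 ∧
    ∃ c : ℝ, 0 < c ∧ ν = c • gradient (fun y => ⟪y, e⟫_ℝ - φ (y - ⟪y, e⟫_ℝ • e)) x

open Classical in
/-- The outward unit normal `n(x)` at `x ∈ ∂Ω` (and `0` away from the boundary). -/
def normal (Ω : Set (Space d)) (x : Space d) : Space d :=
  if h : ∃ ν, IsOutwardNormal Ω x ν then h.choose else 0

/-- The Lebesgue surface measure `π` on `∂Ω`: the `(d-1)`-dimensional Hausdorff measure, normalized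
to agree with Lebesgue measure on hyperplanes. -/
def surfaceMeasure (Ω : Set (Space d)) : Measure (Space d) :=
  (Measure.euclideanHausdorffMeasure (d - 1)).restrict (frontier Ω)

/-! ### Phase space -/

/-- The standing assumptions on the phase space `Ω × V`, where `V` is the support of `m`. -/
structure IsPhaseSpace (Ω : Set (Space d)) (m : Measure (Space d)) : Prop where
  two_le : 2 ≤ d
  isOpen : IsOpen Ω
  isBounded : Bornology.IsBounded Ω
  boundary : HasC1Boundary Ω
  invariant : ∀ L : Space d ≃ₗᵢ[ℝ] Space d, m.map L = m
  zero_mem : (0 : Space d) ∈ m.support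
  zero_null : m {0} = 0
  small_pos : ∀ r : ℝ, 0 < r → 0 < m (m.support ∩ Metric.ball 0 r)

/-- The measure `dx ⊗ m(dv)` on `Ω × V`. -/
def phaseMeasure (Ω : Set (Space d)) (m : Measure (Space d)) : Measure (Space d × Space d) :=
  (volume.restrict Ω).prod (m.restrict m.support)

/-- `Γ₊`: outgoing boundary points. -/
def outgoing (Ω : Set (Space d)) (m : Measure (Space d)) : Set (Space d × Space d) :=
  {p | p.1 ∈ frontier Ω ∧ p.2 ∈ m.support ∧ 0 < ⟪p.2, normal Ω p.1⟫_ℝ}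

/-- `Γ₋`: incoming boundary points. -/
def incoming (Ω : Set (Space d)) (m : Measure (Space d)) : Set (Space d × Space d) :=
  {p | p.1 ∈ frontier Ω ∧ p.2 ∈ m.support ∧ ⟪p.2, normal Ω p.1⟫_ℝ < 0}

/-- The measure `|v · n(x)| π(dx) ⊗ m(dv)`. -/
def fluxMeasure (Ω : Set (Space d)) (m : Measure (Space d)) : Measure (Space d × Space d) :=
  ((surfaceMeasure Ω).prod m).withDensity
    (fun p => ENNReal.ofReal |⟪p.2, normal Ω p.1⟫_ℝ|)

/-- `μ₊` on `Γ₊`. -/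
def fluxOut (Ω : Set (Space d)) (m : Measure (Space d)) : Measure (Space d × Space d) :=
  (fluxMeasure Ω m).restrict (outgoing Ω m)

/-- `μ₋` on `Γ₋`. -/
def fluxIn (Ω : Set (Space d)) (m : Measure (Space d)) : Measure (Space d × Space d) :=
  (fluxMeasure Ω m).restrict (incoming Ω m)

/-- The weight `max(1, |v|^{-s})`. -/
def weight (s : ℕ) (v : Space d) : ℝ := max 1 (‖v‖⁻¹ ^ s)

/-- The backward travel time `t₋(x, v) = inf {s > 0 ; x - s v ∉ Ω}`. For bounded `Ω` and `v ≠ 0` the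
set is non-empty; the velocity `v = 0` is negligible for `m`. -/
def backTime (Ω : Set (Space d)) (x v : Space d) : ℝ :=
  sInf {s : ℝ | 0 < s ∧ x - s • v ∉ Ω}

/-! ### The diffuse boundary operator -/

variable {𝕜 : Type*} [RCLike 𝕜]

/-- The boundary operator
`(Hψ)(x, v) = ∫_{v'·n(x) > 0} κ(x, v, v') ψ(x, v') |v'·n(x)| m(dv')`. -/
def boundaryOp (Ω : Set (Space d)) (m : Measure (Space d)) (κ : Space d → Space d → Space d → ℝ)
    (ψ : Space d × Space d → 𝕜) (p : Space d × Space d) : 𝕜 :=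
  ∫ w in {w | w ∈ m.support ∧ 0 < ⟪w, normal Ω p.1⟫_ℝ},
    (κ p.1 p.2 w * |⟪w, normal Ω p.1⟫_ℝ|) • ψ (p.1, w) ∂m

/-- `κ` is the kernel of a stochastic diffuse boundary operator: it is measurable, nonnegative, and
`∫_{v·n(x) < 0} κ(x, v, v') |v·n(x)| m(dv) = 1` for almost all `(x, v') ∈ Γ₊`. -/
structure IsDiffuseKernel (Ω : Set (Space d)) (m : Measure (Space d))
    (κ : Space d → Space d → Space d → ℝ) : Prop where
  measurable : Measurable (fun q : Space d × Space d × Space d => κ q.1 q.2.1 q.2.2)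
  nonneg : ∀ x v w, (x, v) ∈ incoming Ω m → (x, w) ∈ outgoing Ω m → 0 ≤ κ x v w
  normalized : ∀ᵐ p ∂(fluxOut Ω m),
    ∫⁻ v in {v | v ∈ m.support ∧ ⟪v, normal Ω p.1⟫_ℝ < 0},
      ENNReal.ofReal (κ p.1 v p.2 * |⟪v, normal Ω p.1⟫_ℝ|) ∂m = 1

variable (𝕜) in
/-- `H` is bounded from `L¹(Γ₊, μ₊)` to `L¹(Γ₋, max(1, |v|^{-s}) μ₋)`. -/
def BoundedInto (Ω : Set (Space d)) (m : Measure (Space d))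
    (κ : Space d → Space d → Space d → ℝ) (s : ℕ) : Prop :=
  ∃ C : ℝ≥0, ∀ ψ : Space d × Space d → 𝕜, Integrable ψ (fluxOut Ω m) →
    ∫⁻ p, ENNReal.ofReal (weight s p.2) * ‖boundaryOp Ω m κ ψ p‖ₑ ∂(fluxIn Ω m)
      ≤ C * ∫⁻ p, ‖ψ p‖ₑ ∂(fluxOut Ω m)

variable (𝕜) in
/-- The set of all `k` such that `H` is bounded from `L¹₊` to the weighted space of index `k + 1`. -/
def gainSet (Ω : Set (Space d)) (m : Measure (Space d))
    (κ : Space d → Space d → Space d → ℝ) : Set ℕ :=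
  {k | BoundedInto 𝕜 Ω m κ (k + 1)}

variable (𝕜) in
/-- `N_H`, the supremum of `gainSet`; meaningful when that set is non-empty and bounded. -/
def gainIndex (Ω : Set (Space d)) (m : Measure (Space d))
    (κ : Space d → Space d → Space d → ℝ) : ℕ :=
  sSup (gainSet 𝕜 Ω m κ)

/-! ### Traces and Dyson–Phillips iterates -/

/-- The trace on `Γ₊`: the limit, along the characteristic that leaves `Ω` at `(y, w)`, of the means
of `ψ` over short segments ending at `y`. It is unaffected, up to null sets, by changing `ψ` on a
null set; if `ψ` is absolutely continuous along characteristics, it is the limit of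
`ψ(y - s w, w)` as `s → 0⁺`. -/
def traceOut (ψ : Space d × Space d → 𝕜) (p : Space d × Space d) : 𝕜 :=
  limUnder (𝓝[>] (0 : ℝ)) (fun h : ℝ => (h⁻¹ : ℝ) • ∫ s in (0 : ℝ)..h, ψ (p.1 - s • p.2, p.2))

open Classical in
/-- The Dyson–Phillips iterates:
`[U₀(t)f](x, v) = f(x - t v, v)` if `t < t₋(x, v)`, and `0` otherwise;
`[Uₙ₊₁(t)f](x, v) = [H B⁺ Uₙ(t - s)f](x - s v, v)` with `s = t₋(x, v)` if `t₋(x, v) < t`, and `0`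
otherwise. -/
def iterate (Ω : Set (Space d)) (m : Measure (Space d)) (κ : Space d → Space d → Space d → ℝ)
    (f : Space d × Space d → 𝕜) : ℕ → ℝ → Space d × Space d → 𝕜
  | 0, t, p => if t < backTime Ω p.1 p.2 then f (p.1 - t • p.2, p.2) else 0
  | n + 1, t, p =>
      if backTime Ω p.1 p.2 < t then
        boundaryOp Ω m κ (traceOut (iterate Ω m κ f n (t - backTime Ω p.1 p.2)))
          (p.1 - backTime Ω p.1 p.2 • p.2, p.2)
      else 0

/-! ### The function spaces on the phase space -/

variable (𝕜) in
/-- `X₀ = L¹(Ω × V, dx ⊗ m(dv))`. -/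
abbrev X₀ (Ω : Set (Space d)) (m : Measure (Space d)) : Type _ := Lp 𝕜 1 (phaseMeasure Ω m)

/-- `f ∈ X_s = L¹(Ω × V, max(1, |v|^{-s}) dx ⊗ m(dv))`, for `f ∈ X₀`. -/
def MemX {Ω : Set (Space d)} {m : Measure (Space d)} (s : ℕ) (f : X₀ 𝕜 Ω m) : Prop :=
  Integrable (fun p => weight s p.2 * ‖f p‖) (phaseMeasure Ω m)

/-- The norm of `X_s`. -/
def normX {Ω : Set (Space d)} {m : Measure (Space d)} (s : ℕ) (f : X₀ 𝕜 Ω m) : ℝ :=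
  ∫ p, weight s p.2 * ‖f p‖ ∂(phaseMeasure Ω m)

/-- `U n t`, for `t ≥ 0`, is the bounded operator on `X₀` given by the `n`-th Dyson–Phillips
iterate. -/
def IsDysonPhillips (Ω : Set (Space d)) (m : Measure (Space d))
    (κ : Space d → Space d → Space d → ℝ) (U : ℕ → ℝ → (X₀ 𝕜 Ω m →L[𝕜] X₀ 𝕜 Ω m)) : Prop :=
  ∀ (n : ℕ) (t : ℝ), 0 ≤ t → ∀ (f : Space d × Space d → 𝕜) (hf : Integrable f (phaseMeasure Ω m)),
    U n t (hf.toL1 f) =ᵐ[phaseMeasure Ω m] iterate Ω m κ f n t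

end DiffuseTransport

end

/-! The mechanism is that a long time of flight forces a small velocity. A chord of `Ω` has length
at most `D = diam Ω`, so a flight of duration at least `τ` has `|v| ≤ D / τ`, and the mass of such
particles is at most `(D / τ) ^ s` times a norm with weight `max(1, |v|^{-s})`. A particle counted
in `U_n(t)` has met the boundary exactly `n` times, so its trajectory, continued to its next exit,
consists of `n + 1` flights of total duration more than `t`; at least one of them lasts `t / (n +
1)` or longer. If it is the initial flight, the weight is supplied by `f ∈ X_k`. If it is one of the
`n` flights that follow an emission, the weight is supplied by the gain of `H`, with exponent `s =
N_H + 1`. This gives `‖U_n(t) f‖ ≤ n C (D (n + 1) / t)^s ‖f‖ + (D (n + 1) / t)^k ‖f‖_{X_k}`, and `n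
≤ 2^n - 1` gives the first claim. The second is the sum of these bounds for `k = s`.

The argument is carried out in exit coordinates: a point of `Ω × V` is written as `(y - s v, v)`
with `(y, v) ∈ Γ₊` and `s` the time left before exit. In these coordinates `dx ⊗ m` is `μ₊ ⊗ ds`
(`measurePreserving_flow`), and passing from the exit point of a chord to its entry point carries
`μ₊` to `μ₋` (`measurePreserving_entry`). Free transport is then a translation in time, and the
`n`-th iterate is encoded by one function on `Γ₊ × (0, ∞)`, `exitDensity`, obtained from `f` by
alternating transport with the contraction `H`. The mass at time `t` is at most the mass that exits
after `t` (`tailMass`). The dichotomy on the last flight is `tailMass_succ_le`, and its iteration is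
`tailMass_mul_le`.

Two further points need care. The change of variables rests on the area formula for `C¹` graphs and
on a Jacobian computation in boundary charts, tangential exits being negligible by Sard's theorem.
Moreover, the iterates are defined pointwise through limits of averages, at each fixed time, whereas
the densities are controlled only almost everywhere in exit point and time. Right Lebesgue points
(`ae_tendsto_average`) identify the traces with the densities, and the quasi-measure-preserving maps
at fixed time transfer this to every `t ≥ 0` (`iterate_ae_eq`). -/

noncomputable section

namespace DiffuseTransport

/-! ### Local comparison of measures -/

/-- A comparison of measures that holds locally holds globally. -/
theorem measure_le_mul_of_locally {X : Type*} [TopologicalSpace X] [SecondCountableTopology X]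
    [MeasurableSpace X] [OpensMeasurableSpace X] {μ ν : Measure X} {c : ℝ≥0∞}
    (h : ∀ x, ∃ W ∈ 𝓝 x, ∀ A ⊆ W, MeasurableSet A → μ A ≤ c * ν A)
    {A : Set X} (hA : MeasurableSet A) : μ A ≤ c * ν A := by
  choose W hW hle using h
  obtain ⟨s, hs, hsW⟩ := TopologicalSpace.countable_cover_nhds
    (fun x => interior_mem_nhds.2 (hW x))
  rcases s.eq_empty_or_nonempty with rfl | hne
  · have : A = ∅ := by
      apply Set.eq_empty_of_forall_notMem
      intro x _
      have : x ∈ (Set.univ : Set X) := trivial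
      rw [← hsW] at this
      simp at this
    simp [this]
  obtain ⟨g, rfl⟩ := hs.exists_eq_range hne
  set B : ℕ → Set X := disjointed fun i => interior (W (g i)) with hB
  have hBm : ∀ i, MeasurableSet (B i) :=
    MeasurableSet.disjointed fun i => isOpen_interior.measurableSet
  have hU : ⋃ i, B i = Set.univ := by
    rw [hB, iUnion_disjointed, ← hsW]
    simp
  have hdec : ∀ ξ : Measure X, ξ A = ∑' i, ξ (A ∩ B i) := fun ξ => by
    rw [← measure_iUnion, ← Set.inter_iUnion, hU, Set.inter_univ]
    · intro i j hij
      exact ((disjoint_disjointed _) hij).mono Set.inter_subset_right Set.inter_subset_right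
    · exact fun i => hA.inter (hBm i)
  rw [hdec μ, hdec ν, ← ENNReal.tsum_mul_left]
  refine ENNReal.tsum_le_tsum fun i => hle (g i) _ ?_ (hA.inter (hBm i))
  exact (Set.inter_subset_right.trans (disjointed_subset _ _)).trans interior_subset

/-- Lets the distortion constant of a local comparison tend to `1`. -/
theorem le_of_forall_one_lt_le_mul {a b : ℝ≥0∞} (h : ∀ c : ℝ≥0, 1 < c → a ≤ c * b) : a ≤ b := by
  have ht : Tendsto (fun c : ℝ≥0 => (c : ℝ≥0∞) * b) (𝓝[>] 1) (𝓝 (((1 : ℝ≥0) : ℝ≥0∞) * b)) :=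
    ENNReal.Tendsto.mul_const
      ((ENNReal.tendsto_coe.2 tendsto_id).mono_left nhdsWithin_le_nhds) (Or.inl (by simp))
  simp only [ENNReal.coe_one, one_mul] at ht
  exact ge_of_tendsto ht (eventually_nhdsWithin_of_forall fun c hc => h c hc)

/-! ### Area formula for graphs -/

section Graph

variable {E : Type*} [NormedAddCommGroup E] [InnerProductSpace ℝ E]

/-- The linear graph map `u ↦ u + a(u) e` over a subspace. -/
def linGraph (K : Submodule ℝ E) (e : E) (a : K →L[ℝ] ℝ) : K →L[ℝ] E :=
  K.subtypeL + a.smulRight e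

@[simp] theorem linGraph_apply (K : Submodule ℝ E) (e : E) (a : K →L[ℝ] ℝ) (u : K) :
    linGraph K e a u = u + a u • e := by
  simp [linGraph]

/-- With `b` the Riesz representative of `a`, the composition of the adjoint with the graph map is
`u ↦ u + a(u) b`, a rank-one perturbation of the identity with determinant `1 + a(b) = 1 + ‖a‖²`. -/
theorem normDet_linGraph [FiniteDimensional ℝ E] {e : E} (he : ‖e‖ = 1) (a : (ℝ ∙ e)ᗮ →L[ℝ] ℝ) :
    (linGraph _ e a).toLinearMap.normDet = √(1 + ‖a‖ ^ 2) := by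
  set b := (InnerProductSpace.toDual ℝ (ℝ ∙ e)ᗮ).symm a with hb
  have hab : ∀ u, a u = ⟪b, u⟫_ℝ := fun u => by simp [hb]
  have hnb : ‖b‖ = ‖a‖ := by simp [hb]
  have hue : ∀ u : (ℝ ∙ e)ᗮ, ⟪(u : E), e⟫_ℝ = 0 := fun u => by
    rw [real_inner_comm]; exact Submodule.mem_orthogonal_singleton_iff_inner_right.1 u.2
  have hsq := (linGraph (ℝ ∙ e)ᗮ e a).toLinearMap.normDet_sq
  have hcomp : ((linGraph (ℝ ∙ e)ᗮ e a).toLinearMap.adjoint ∘ₗ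
      (linGraph (ℝ ∙ e)ᗮ e a).toLinearMap) = LinearMap.transvection a.toLinearMap b := by
    ext1 u
    apply ext_inner_left ℝ
    intro w
    have h1 : ⟪e, (u : E)⟫_ℝ = 0 := by rw [real_inner_comm]; exact hue u
    rw [LinearMap.comp_apply, LinearMap.adjoint_inner_right]
    simp only [ContinuousLinearMap.coe_coe, linGraph_apply, LinearMap.transvection.apply,
      inner_add_left, inner_add_right, real_inner_smul_left, real_inner_smul_right, hue, h1,
      real_inner_self_eq_norm_sq, he, Submodule.coe_inner]
    have hwb : ⟪(w : E), (b : E)⟫_ℝ = a w := by rw [hab, real_inner_comm]; rfl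
    rw [Submodule.coe_smul, real_inner_smul_right, hwb]
    ring
  rw [hcomp, LinearMap.transvection.det] at hsq
  have h2 : a.toLinearMap b = ‖a‖ ^ 2 := by
    rw [ContinuousLinearMap.coe_coe, hab, real_inner_self_eq_norm_sq, hnb]
  rw [h2] at hsq
  rw [← Real.sqrt_sq (LinearMap.normDet_nonneg _)]
  congr 1

theorem norm_le_norm_linGraph {e : E} (a : (ℝ ∙ e)ᗮ →L[ℝ] ℝ) (u : (ℝ ∙ e)ᗮ) :
    ‖u‖ ≤ ‖linGraph _ e a u‖ := by
  have hue : ⟪(u : E), a u • e⟫_ℝ = 0 := by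
    rw [real_inner_smul_right, real_inner_comm,
      Submodule.mem_orthogonal_singleton_iff_inner_right.1 u.2, mul_zero]
  have h := norm_add_sq_eq_norm_sq_add_norm_sq_real hue
  rw [linGraph_apply]
  have h1 : ‖u‖ = ‖(u : E)‖ := rfl
  rw [h1]
  nlinarith [norm_nonneg ((u : E) + a u • e), norm_nonneg (u : E), mul_self_nonneg ‖a u • e‖]

/-- The graph map of a function on the hyperplane orthogonal to `e`. -/
def graphMap (e : E) (φ : (ℝ ∙ e)ᗮ → ℝ) (u : (ℝ ∙ e)ᗮ) : E := u + φ u • e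

theorem orthogonalProjectionOnto_add_smul [FiniteDimensional ℝ E] {e : E} (u : (ℝ ∙ e)ᗮ) (c : ℝ) :
    (ℝ ∙ e)ᗮ.orthogonalProjectionOnto ((u : E) + c • e) = u := by
  rw [map_add, Submodule.orthogonalProjectionOnto_mem_subspace_eq_self, map_smul]
  have : (ℝ ∙ e)ᗮ.orthogonalProjectionOnto e = 0 := by
    rw [Submodule.orthogonalProjectionOnto_eq_zero_iff, Submodule.orthogonal_orthogonal]
    exact Submodule.mem_span_singleton_self e
  simp [this]

theorem leftInverse_graphMap [FiniteDimensional ℝ E] (e : E) (φ : (ℝ ∙ e)ᗮ → ℝ) :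
    Function.LeftInverse (ℝ ∙ e)ᗮ.orthogonalProjectionOnto (graphMap e φ) :=
  fun u => orthogonalProjectionOnto_add_smul u _

theorem continuous_graphMap {e : E} {φ : (ℝ ∙ e)ᗮ → ℝ} (hφ : Continuous φ) :
    Continuous (graphMap e φ) := by
  unfold graphMap
  fun_prop

/-- Strict differentiability makes the difference between the graph and its tangent plane Lipschitz
with a small constant, while the tangent graph map does not shrink distances. Hence the
correspondence between the two is Lipschitz in both directions with constant close to `1`. -/
theorem exists_nhds_lipschitz_graphMap [FiniteDimensional ℝ E] {e : E} (he : ‖e‖ = 1) {φ : (ℝ ∙ e)ᗮ → ℝ} (hφ : ContDiff ℝ 1 φ)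
    (u₀ : (ℝ ∙ e)ᗮ) {L : ℝ≥0} (hL : 1 < L) : ∃ W ∈ 𝓝 u₀,
      LipschitzOnWith L (graphMap e φ ∘ (ℝ ∙ e)ᗮ.orthogonalProjectionOnto)
        (linGraph _ e (fderiv ℝ φ u₀) '' W) ∧
      LipschitzOnWith L (linGraph _ e (fderiv ℝ φ u₀) ∘ (ℝ ∙ e)ᗮ.orthogonalProjectionOnto)
        (graphMap e φ '' W) := by
  set a := fderiv ℝ φ u₀
  have hstrict : HasStrictFDerivAt φ a u₀ := hφ.contDiffAt.hasStrictFDerivAt (by simp)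
  have hLr : (1 : ℝ) < L := by exact_mod_cast hL
  have hL0 : (0 : ℝ) < L := by linarith
  -- Chosen so that `1 - ε = 1 / L`, which gives exactly `L` in the direction from graph to tangent
  -- plane; in the other direction `1 + ε ≤ L`.
  set ε : ℝ := (L - 1) / L with hε
  have hεpos : 0 < ε := div_pos (by linarith) hL0
  obtain ⟨W, hW, happ⟩ := hstrict.approximates_deriv_on_nhds (c := ⟨ε, hεpos.le⟩) (Or.inr hεpos)
  have key : ∀ u ∈ W, ∀ w ∈ W, ‖(graphMap e φ u - graphMap e φ w) -
      (linGraph _ e a u - linGraph _ e a w)‖ ≤ (L - 1) / L * ‖linGraph _ e a u - linGraph _ e a w‖ := by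
    intro u hu w hw
    have h1 : (graphMap e φ u - graphMap e φ w) - (linGraph _ e a u - linGraph _ e a w)
        = (φ u - φ w - a (u - w)) • e := by
      simp only [graphMap, linGraph_apply, map_sub, sub_smul]
      abel
    have h2 : ‖φ u - φ w - a (u - w)‖ ≤ ε * ‖u - w‖ := happ u hu w hw
    rw [h1, norm_smul, he, mul_one, ← map_sub]
    exact h2.trans (mul_le_mul_of_nonneg_left (norm_le_norm_linGraph a _) hεpos.le)
  have hproj : ∀ u, (ℝ ∙ e)ᗮ.orthogonalProjectionOnto (linGraph _ e a u) = u := fun u => by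
    rw [linGraph_apply]; exact orthogonalProjectionOnto_add_smul u _
  have hproj' : ∀ u, (ℝ ∙ e)ᗮ.orthogonalProjectionOnto (graphMap e φ u) = u :=
    leftInverse_graphMap e φ
  refine ⟨W, hW, ?_, ?_⟩
  · apply LipschitzOnWith.of_dist_le_mul
    rintro x ⟨u, hu, rfl⟩ y ⟨w, hw, rfl⟩
    simp only [Function.comp_apply, hproj, dist_eq_norm]
    have h := key u hu w hw
    have h3 := norm_sub_norm_le (graphMap e φ u - graphMap e φ w)
      (linGraph _ e a u - linGraph _ e a w)
    have h4 : ((L : ℝ) - 1) / L ≤ L - 1 := div_le_self (by linarith) hLr.le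
    nlinarith [norm_nonneg (linGraph _ e a u - linGraph _ e a w)]
  · apply LipschitzOnWith.of_dist_le_mul
    rintro x ⟨u, hu, rfl⟩ y ⟨w, hw, rfl⟩
    simp only [Function.comp_apply, hproj', dist_eq_norm]
    have h := key u hu w hw
    have h3 := norm_sub_norm_le (linGraph _ e a u - linGraph _ e a w)
      (graphMap e φ u - graphMap e φ w)
    rw [norm_sub_rev (linGraph _ e a u - linGraph _ e a w)] at h3
    have h4 : ‖linGraph _ e a u - linGraph _ e a w‖ / L ≤ ‖graphMap e φ u - graphMap e φ w‖ := by
      have : ((L : ℝ) - 1) / L = 1 - 1 / L := by field_simp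
      rw [this] at h
      have h5 : ‖linGraph _ e a u - linGraph _ e a w‖ / L =
        1 / L * ‖linGraph _ e a u - linGraph _ e a w‖ := by ring
      rw [h5]; linarith
    rw [div_le_iff₀ hL0] at h4
    linarith

variable [FiniteDimensional ℝ E] [MeasurableSpace E] [BorelSpace E]

theorem measurableEmbedding_graphMap {e : E} {φ : (ℝ ∙ e)ᗮ → ℝ} (hφ : Continuous φ) :
    MeasurableEmbedding (graphMap e φ) :=
  ((leftInverse_graphMap e φ).isClosedEmbedding (by fun_prop)
    (continuous_graphMap hφ)).measurableEmbedding

theorem euclideanHausdorffMeasure_image_le_of_lipschitzOnWith {X Y : Type*} [EMetricSpace X]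
    [MeasurableSpace X] [BorelSpace X] [EMetricSpace Y] [MeasurableSpace Y] [BorelSpace Y]
    {f : X → Y} {s : Set X} {L : ℝ≥0} (h : LipschitzOnWith L f s) (n : ℕ) :
    μHE[n] (f '' s) ≤ (L : ℝ≥0∞) ^ n * μHE[n] s := by
  simp only [Measure.euclideanHausdorffMeasure_def, Measure.smul_apply,
    Measure.nnreal_smul_coe_apply]
  have := h.hausdorffMeasure_image_le (d := n) (by positivity)
  rw [ENNReal.rpow_natCast] at this
  calc _ ≤ _ := mul_le_mul_right this _
    _ = _ := by ring

/-- The area formula for the graph of a `C¹` function on a hyperplane. -/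
theorem euclideanHausdorffMeasure_graphMap_image {e : E} (he : ‖e‖ = 1) {φ : (ℝ ∙ e)ᗮ → ℝ}
    (hφ : ContDiff ℝ 1 φ) {A : Set (ℝ ∙ e)ᗮ} (hA : MeasurableSet A) :
    μHE[Module.finrank ℝ (ℝ ∙ e)ᗮ] (graphMap e φ '' A) =
      ∫⁻ u in A, ENNReal.ofReal √(1 + ‖fderiv ℝ φ u‖ ^ 2) := by
  set n := Module.finrank ℝ (ℝ ∙ e)ᗮ
  set G := graphMap e φ
  have hG : MeasurableEmbedding G := measurableEmbedding_graphMap hφ.continuous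
  set J : (ℝ ∙ e)ᗮ → ℝ := fun u => √(1 + ‖fderiv ℝ φ u‖ ^ 2)
  have hJ : Continuous J :=
    Real.continuous_sqrt.comp
      (continuous_const.add ((hφ.continuous_fderiv (by simp)).norm.pow 2))
  have hJpos : ∀ u, 0 < J u := fun u => Real.sqrt_pos.2 (by positivity)
  set μ₁ : Measure (ℝ ∙ e)ᗮ := Measure.comap G μHE[n]
  set μ₂ : Measure (ℝ ∙ e)ᗮ := volume.withDensity fun u => ENNReal.ofReal (J u)
  have hμ₁ : ∀ A, μ₁ A = μHE[n] (G '' A) := fun A => hG.comap_apply _ _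
  have hμ₂ : ∀ A, MeasurableSet A → μ₂ A = ∫⁻ u in A, ENNReal.ofReal (J u) := fun A hA =>
    withDensity_apply _ hA
  -- Local two-sided comparison suffices: `n` factors `L` come from the Hausdorff measure of a
  -- Lipschitz image, one more from the oscillation of the density `J`.
  suffices h : ∀ L : ℝ≥0, 1 < L → ∀ u₀ : (ℝ ∙ e)ᗮ, ∃ W ∈ 𝓝 u₀, ∀ A ⊆ W, MeasurableSet A →
      μ₁ A ≤ ((L ^ (n + 1) : ℝ≥0) : ℝ≥0∞) * μ₂ A ∧ μ₂ A ≤ ((L ^ (n + 1) : ℝ≥0) : ℝ≥0∞) * μ₁ A by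
    have hroot : ∀ c : ℝ≥0, 1 < c → ∃ L : ℝ≥0, 1 < L ∧ L ^ (n + 1) ≤ c := fun c hc => by
      have ht : Tendsto (fun L : ℝ≥0 => L ^ (n + 1)) (𝓝[>] 1) (𝓝 1) := by
        have : Tendsto (fun L : ℝ≥0 => L ^ (n + 1)) (𝓝 1) (𝓝 (1 ^ (n + 1))) :=
          (continuous_pow _).tendsto _
        rw [one_pow] at this
        exact this.mono_left nhdsWithin_le_nhds
      obtain ⟨L, h1, h2⟩ := ((ht.eventually (ge_mem_nhds hc)).and self_mem_nhdsWithin).exists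
      exact ⟨L, h2, h1⟩
    rw [← hμ₁, ← hμ₂ A hA]
    apply le_antisymm <;> apply le_of_forall_one_lt_le_mul <;> intro c hc
    · obtain ⟨L, hL, hLc⟩ := hroot c hc
      refine (measure_le_mul_of_locally (fun u₀ => ?_) hA).trans
        (mul_le_mul_left (ENNReal.coe_le_coe.2 hLc) _)
      obtain ⟨W, hW, h'⟩ := h L hL u₀
      exact ⟨W, hW, fun A hAW hA => (h' A hAW hA).1⟩
    · obtain ⟨L, hL, hLc⟩ := hroot c hc
      refine (measure_le_mul_of_locally (fun u₀ => ?_) hA).trans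
        (mul_le_mul_left (ENNReal.coe_le_coe.2 hLc) _)
      obtain ⟨W, hW, h'⟩ := h L hL u₀
      exact ⟨W, hW, fun A hAW hA => (h' A hAW hA).2⟩
  intro L hL u₀
  have hLr : (1 : ℝ) < L := by exact_mod_cast hL
  obtain ⟨W₁, hW₁, hlip, hlip'⟩ := exists_nhds_lipschitz_graphMap he hφ u₀ hL
  have hW₂ : ∀ᶠ u in 𝓝 u₀, J u < L * J u₀ ∧ J u₀ < L * J u := by
    refine (hJ.tendsto u₀).eventually_lt_const (by nlinarith [hJpos u₀]) |>.and ?_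
    exact ((hJ.const_mul (L : ℝ) |>.tendsto u₀)).eventually_const_lt
      (by nlinarith [hJpos u₀])
  refine ⟨W₁ ∩ {u | J u < L * J u₀ ∧ J u₀ < L * J u}, inter_mem hW₁ hW₂, fun A hAW hA => ?_⟩
  set T := linGraph (ℝ ∙ e)ᗮ e (fderiv ℝ φ u₀)
  have hT : μHE[n] (T '' A) = ENNReal.ofReal (J u₀) * volume A := by
    have := T.toLinearMap.euclideanHausdorffMeasure_image_eq_normDet_mul_volume A
    rw [normDet_linGraph he] at this
    exact this
  have hprojT : ∀ u, (ℝ ∙ e)ᗮ.orthogonalProjectionOnto (T u) = u := fun u => by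
    rw [linGraph_apply]; exact orthogonalProjectionOnto_add_smul u _
  have hAW₁ : A ⊆ W₁ := fun u hu => (hAW hu).1
  have hGA : (G ∘ (ℝ ∙ e)ᗮ.orthogonalProjectionOnto) '' (T '' A) = G '' A := by
    rw [Set.image_image]
    exact Set.image_congr fun u _ => by simp [hprojT]
  have hTA : (T ∘ (ℝ ∙ e)ᗮ.orthogonalProjectionOnto) '' (G '' A) = T '' A := by
    rw [Set.image_image]
    exact Set.image_congr fun u _ => by
      rw [Function.comp_apply, leftInverse_graphMap e φ u]
  have h1 := euclideanHausdorffMeasure_image_le_of_lipschitzOnWith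
    (hlip.mono (Set.image_mono hAW₁)) n
  have h2 := euclideanHausdorffMeasure_image_le_of_lipschitzOnWith
    (hlip'.mono (Set.image_mono hAW₁)) n
  rw [hGA, hT] at h1
  rw [hTA, hT] at h2
  have hcL : ENNReal.ofReal (L : ℝ) = L := ENNReal.ofReal_coe_nnreal
  have hlow : ENNReal.ofReal (J u₀) * volume A ≤ L * μ₂ A := by
    rw [hμ₂ A hA, ← lintegral_const_mul' _ _ ENNReal.coe_ne_top, ← setLIntegral_const]
    refine setLIntegral_mono' hA fun u hu => ?_
    rw [← hcL, ← ENNReal.ofReal_mul (by positivity)]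
    exact ENNReal.ofReal_le_ofReal (hAW hu).2.2.le
  have hup : μ₂ A ≤ L * (ENNReal.ofReal (J u₀) * volume A) := by
    rw [hμ₂ A hA, ← mul_assoc, ← setLIntegral_const]
    refine setLIntegral_mono' hA fun u hu => ?_
    rw [← hcL, ← ENNReal.ofReal_mul (by positivity)]
    exact ENNReal.ofReal_le_ofReal (hAW hu).2.1.le
  rw [hμ₁]
  push_cast
  constructor
  · calc _ ≤ _ := h1
      _ ≤ (L : ℝ≥0∞) ^ n * (L * μ₂ A) := by gcongr
      _ = _ := by ring
  · calc _ ≤ _ := hup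
      _ ≤ L * ((L : ℝ≥0∞) ^ n * μHE[n] (G '' A)) := by gcongr
      _ = _ := by ring

theorem restrict_euclideanHausdorffMeasure_graph {e : E} (he : ‖e‖ = 1) {φ : (ℝ ∙ e)ᗮ → ℝ}
    (hφ : ContDiff ℝ 1 φ) {S : Set E} (hS : MeasurableSet S)
    (hSr : S ⊆ Set.range (graphMap e φ)) :
    μHE[Module.finrank ℝ (ℝ ∙ e)ᗮ].restrict S =
      ((volume.withDensity fun u => ENNReal.ofReal √(1 + ‖fderiv ℝ φ u‖ ^ 2)).map
        (graphMap e φ)).restrict S := by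
  have hG : MeasurableEmbedding (graphMap e φ) := measurableEmbedding_graphMap hφ.continuous
  ext A hA
  rw [Measure.restrict_apply hA, Measure.restrict_apply hA,
    Measure.map_apply hG.measurable (hA.inter hS),
    withDensity_apply _ (hG.measurable (hA.inter hS)),
    ← euclideanHausdorffMeasure_graphMap_image he hφ (hG.measurable (hA.inter hS)),
    Set.image_preimage_eq_of_subset (Set.inter_subset_right.trans hSr)]

/-- Integration against the surface measure of a graph. -/
theorem lintegral_restrict_range_graphMap {e : E} (he : ‖e‖ = 1) {φ : (ℝ ∙ e)ᗮ → ℝ}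
    (hφ : ContDiff ℝ 1 φ) {S : Set E} (hS : MeasurableSet S)
    (hSr : S ⊆ Set.range (graphMap e φ)) {F : E → ℝ≥0∞} (hF : Measurable F) :
    ∫⁻ y in S, F y ∂μHE[Module.finrank ℝ (ℝ ∙ e)ᗮ] =
      ∫⁻ u, S.indicator F (graphMap e φ u) * ENNReal.ofReal √(1 + ‖fderiv ℝ φ u‖ ^ 2) := by
  have hG : MeasurableEmbedding (graphMap e φ) := measurableEmbedding_graphMap hφ.continuous
  have hJ : Measurable fun u : (ℝ ∙ e)ᗮ => ENNReal.ofReal √(1 + ‖fderiv ℝ φ u‖ ^ 2) :=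
    (ENNReal.continuous_ofReal.comp (Real.continuous_sqrt.comp
      (continuous_const.add ((hφ.continuous_fderiv (by simp)).norm.pow 2)))).measurable
  rw [restrict_euclideanHausdorffMeasure_graph he hφ hS hSr, ← lintegral_indicator hS,
    lintegral_map (hF.indicator hS) hG.measurable,
    lintegral_withDensity_eq_lintegral_mul _ hJ
      (g := fun u => S.indicator F (graphMap e φ u)) ((hF.indicator hS).comp hG.measurable)]
  simp [mul_comm]

/-- Fubini's theorem with respect to a hyperplane and its unit normal. -/
theorem lintegral_eq_lintegral_hyperplane {e : E} (he : ‖e‖ = 1) {F : E → ℝ≥0∞}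
    (hF : Measurable F) :
    ∫⁻ x, F x = ∫⁻ u : (ℝ ∙ e)ᗮ, ∫⁻ s : ℝ, F (u + s • e) := by
  have h1 := ((ℝ ∙ e).measurePreserving_measurableEquivProd (0 : E)).symm
  rw [InnerProductSpace.euclideanHausdorffMeasure_eq_volume] at h1
  have h2 := (LinearIsometryEquiv.toSpanUnitSingleton e he).measurePreserving
  rw [← h1.lintegral_comp hF, Measure.volume_eq_prod, lintegral_prod_symm]
  · refine lintegral_congr fun u => ?_
    rw [← h2.lintegral_comp]
    · simp [add_comm]
    · fun_prop
  · exact (hF.comp (MeasurableEquiv.measurable _)).aemeasurable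

end Graph

end DiffuseTransport

end
noncomputable section

namespace DiffuseTransport

variable {d : ℕ}

/-! ### Charts and the outward normal -/

/-- The local defining function of a boundary chart. -/
def chartFun (e : Space d) (φ : Space d → ℝ) (y : Space d) : ℝ :=
  ⟪y, e⟫_ℝ - φ (y - ⟪y, e⟫_ℝ • e)

section ChartFun

variable {e : Space d} {φ : Space d → ℝ}

theorem contDiff_chartFun (hφ : ContDiff ℝ 1 φ) : ContDiff ℝ 1 (chartFun e φ) := by
  unfold chartFun
  exact (contDiff_id.inner ℝ contDiff_const).sub (hφ.comp
    (contDiff_id.sub ((contDiff_id.inner ℝ contDiff_const).smul contDiff_const)))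

theorem fderiv_chartFun (hφ : ContDiff ℝ 1 φ) (x w : Space d) :
    fderiv ℝ (chartFun e φ) x w =
      ⟪w, e⟫_ℝ - fderiv ℝ φ (x - ⟪x, e⟫_ℝ • e) (w - ⟪w, e⟫_ℝ • e) := by
  have hl : HasFDerivAt (fun y : Space d => ⟪y, e⟫_ℝ) ((innerSL ℝ e : Space d →L[ℝ] ℝ)) x := by
    have := (innerSL ℝ e : Space d →L[ℝ] ℝ).hasFDerivAt (x := x)
    refine this.congr_of_eventuallyEq (Eventually.of_forall fun y => ?_)
    simp [real_inner_comm]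
  have hd : DifferentiableAt ℝ φ (x - ⟪x, e⟫_ℝ • e) := hφ.differentiable (by simp) _
  have h := hl.sub (hd.hasFDerivAt.comp x ((hasFDerivAt_id x).sub (hl.smul_const e)))
  have h' : HasFDerivAt (chartFun e φ) _ x := h
  rw [h'.fderiv]
  simp [real_inner_comm]

theorem inner_gradient_chartFun (hφ : ContDiff ℝ 1 φ) (x w : Space d) :
    ⟪w, gradient (chartFun e φ) x⟫_ℝ =
      ⟪w, e⟫_ℝ - fderiv ℝ φ (x - ⟪x, e⟫_ℝ • e) (w - ⟪w, e⟫_ℝ • e) := by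
  rw [← fderiv_chartFun hφ, real_inner_comm]
  simp [gradient]

/-- The derivative in the direction `e` is `1`, since `φ` sees only the horizontal part. -/
theorem gradient_chartFun_ne_zero (he : ‖e‖ = 1) (hφ : ContDiff ℝ 1 φ) (x : Space d) :
    gradient (chartFun e φ) x ≠ 0 := by
  intro h
  have := inner_gradient_chartFun (e := e) hφ x e
  simp [h, he] at this

theorem continuous_gradient_chartFun (hφ : ContDiff ℝ 1 φ) :
    Continuous (gradient (chartFun e φ)) := by
  unfold gradient
  exact (LinearIsometryEquiv.continuous _).comp
    ((contDiff_chartFun hφ).continuous_fderiv (by simp))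

end ChartFun

variable {Ω : Set (Space d)}

namespace IsBoundaryChart

variable {x₀ e : Space d} {φ : Space d → ℝ} {r : ℝ}

theorem mem_iff (h : IsBoundaryChart Ω x₀ e φ r) {x : Space d} (hx : x ∈ Metric.ball x₀ r) :
    x ∈ Ω ↔ chartFun e φ x < 0 := by
  rw [h.below x hx, chartFun, sub_neg]

/-- `IsOutwardNormal` asks for a chart centred at the point itself, so a chart has to be moved along
the boundary. -/
theorem recenter (h : IsBoundaryChart Ω x₀ e φ r) {x : Space d} (hx : x ∈ Metric.ball x₀ r) :
    IsBoundaryChart Ω x e φ (r - dist x x₀) where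
  unit := h.unit
  smooth := h.smooth
  pos := sub_pos.2 hx
  below y hy := h.below y (Metric.ball_subset_ball' (by linarith) hy)

theorem chartFun_eq_zero (h : IsBoundaryChart Ω x₀ e φ r) (hΩ : IsOpen Ω) {x : Space d}
    (hx : x ∈ Metric.ball x₀ r) (hf : x ∈ frontier Ω) : chartFun e φ x = 0 := by
  have hc : Continuous (chartFun e φ) := (contDiff_chartFun h.smooth).continuous
  have h1 : ¬ chartFun e φ x < 0 := fun hlt => by
    rw [hΩ.frontier_eq] at hf
    exact hf.2 ((h.mem_iff hx).2 hlt)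
  refine le_antisymm (not_lt.1 fun hpos => ?_) (not_lt.1 h1)
  have hnhds : {y | 0 < chartFun e φ y} ∩ Metric.ball x₀ r ∈ 𝓝 x :=
    inter_mem ((isOpen_lt continuous_const hc).mem_nhds hpos) (Metric.isOpen_ball.mem_nhds hx)
  obtain ⟨y, hy, hyΩ⟩ := mem_closure_iff_nhds.1 (frontier_subset_closure hf) _ hnhds
  exact absurd ((h.mem_iff hy.2).1 hyΩ) (not_lt.2 (le_of_lt hy.1))

theorem isOutwardNormal (h : IsBoundaryChart Ω x₀ e φ r) {x : Space d}
    (hx : x ∈ Metric.ball x₀ r) (hf : x ∈ frontier Ω) :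
    IsOutwardNormal Ω x (‖gradient (chartFun e φ) x‖⁻¹ • gradient (chartFun e φ) x) := by
  have h0 := norm_pos_iff.2 (gradient_chartFun_ne_zero h.unit h.smooth x)
  refine ⟨hf, e, φ, _, h.recenter hx, ?_, _, inv_pos.2 h0, rfl⟩
  rw [norm_smul, norm_inv, norm_norm, inv_mul_cancel₀ h0.ne']

end IsBoundaryChart

/-- The defining function vanishes at `x` and its derivative along `w` is a positive multiple of
`⟪w, ν⟫`, so the sign of the latter decides on which side the ray starts. This description no longer
refers to a chart. -/
theorem IsOutwardNormal.eventually {x ν w : Space d} (h : IsOutwardNormal Ω x ν) (hΩ : IsOpen Ω) :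
    (⟪w, ν⟫_ℝ < 0 → ∀ᶠ s : ℝ in 𝓝[>] 0, x + s • w ∈ Ω) ∧
    (0 < ⟪w, ν⟫_ℝ → ∀ᶠ s : ℝ in 𝓝[>] 0, x + s • w ∉ Ω) := by
  obtain ⟨hf, e, φ, r, hch, -, c, hc, rfl⟩ := h
  have hx : x ∈ Metric.ball x r := Metric.mem_ball_self hch.pos
  have h0 := hch.chartFun_eq_zero hΩ hx hf
  have hline : HasDerivAt (fun s : ℝ => x + s • w) w 0 := by
    simpa using ((hasDerivAt_id (0 : ℝ)).smul_const w).const_add x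
  have hdiff : HasFDerivAt (chartFun e φ) (fderiv ℝ (chartFun e φ) x) (x + (0 : ℝ) • w) := by
    rw [zero_smul, add_zero]
    exact ((contDiff_chartFun hch.smooth).differentiable (by simp) x).hasFDerivAt
  have hder : HasDerivAt (fun s : ℝ => chartFun e φ (x + s • w))
      ⟪w, gradient (chartFun e φ) x⟫_ℝ 0 := by
    have h1 : ⟪w, gradient (chartFun e φ) x⟫_ℝ = fderiv ℝ (chartFun e φ) x w := by
      rw [real_inner_comm]; simp [gradient]
    rw [h1]
    exact hdiff.comp_hasDerivAt (0 : ℝ) hline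
  have ht := hder.tendsto_slope_zero_right
  simp only [zero_add, zero_smul, add_zero, h0, sub_zero, smul_eq_mul] at ht
  have hball : ∀ᶠ s : ℝ in 𝓝[>] 0, x + s • w ∈ Metric.ball x r :=
    (hline.continuousAt.mono_left nhdsWithin_le_nhds) (Metric.isOpen_ball.mem_nhds (by simpa using hch.pos))
  change (⟪w, c • gradient (chartFun e φ) x⟫_ℝ < 0 → _) ∧
    (0 < ⟪w, c • gradient (chartFun e φ) x⟫_ℝ → _)
  rw [real_inner_smul_right]
  constructor
  · intro hlt
    filter_upwards [ht.eventually_lt_const (neg_of_mul_neg_right hlt hc.le), hball,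
      self_mem_nhdsWithin] with s h1 h2 h3
    exact (hch.mem_iff h2).2 (neg_of_mul_neg_right h1 (inv_nonneg.2 (le_of_lt h3)))
  · intro hlt
    filter_upwards [ht.eventually_const_lt (pos_of_mul_pos_right hlt hc.le), hball,
      self_mem_nhdsWithin] with s h1 h2 h3
    rw [hch.mem_iff h2, not_lt]
    exact (pos_of_mul_pos_right h1 (inv_nonneg.2 (le_of_lt h3))).le

/-- For two distinct unit normals, the direction `ν' - ν` would enter `Ω` according to `ν` and leave
it according to `ν'`. Consequently the chosen normal can be computed in any chart. -/
theorem IsOutwardNormal.unique {x ν ν' : Space d} (hΩ : IsOpen Ω) (h : IsOutwardNormal Ω x ν)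
    (h' : IsOutwardNormal Ω x ν') : ν = ν' := by
  by_contra hne
  have hν : ‖ν‖ = 1 := by obtain ⟨-, e, φ, r, -, h1, -⟩ := h; exact h1
  have hν' : ‖ν'‖ = 1 := by obtain ⟨-, e, φ, r, -, h1, -⟩ := h'; exact h1
  have hlt : ⟪ν, ν'⟫_ℝ < 1 := (inner_lt_one_iff_real_of_norm_eq_one hν hν').2 hne
  have h1 : ⟪ν' - ν, ν⟫_ℝ < 0 := by
    rw [inner_sub_left, real_inner_self_eq_norm_sq, hν, real_inner_comm]; linarith
  have h2 : 0 < ⟪ν' - ν, ν'⟫_ℝ := by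
    rw [inner_sub_left, real_inner_self_eq_norm_sq, hν']; linarith
  obtain ⟨s, hs, hs'⟩ := (((h.eventually hΩ).1 h1).and ((h'.eventually hΩ).2 h2)).exists
  exact hs' hs

theorem normal_eq_of_isOutwardNormal {x ν : Space d} (hΩ : IsOpen Ω) (h : IsOutwardNormal Ω x ν) :
    normal Ω x = ν := by
  have hex : ∃ ν, IsOutwardNormal Ω x ν := ⟨ν, h⟩
  rw [normal, dif_pos hex]
  exact hex.choose_spec.unique hΩ h

theorem normal_eq_zero {x : Space d} (hx : x ∉ frontier Ω) : normal Ω x = 0 := by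
  rw [normal, dif_neg]
  rintro ⟨ν, h⟩
  exact hx h.1

theorem IsBoundaryChart.normal_eq {x₀ e : Space d} {φ : Space d → ℝ} {r : ℝ}
    (h : IsBoundaryChart Ω x₀ e φ r) (hΩ : IsOpen Ω) {x : Space d}
    (hx : x ∈ Metric.ball x₀ r) (hf : x ∈ frontier Ω) :
    normal Ω x = ‖gradient (chartFun e φ) x‖⁻¹ • gradient (chartFun e φ) x :=
  normal_eq_of_isOutwardNormal hΩ (h.isOutwardNormal hx hf)

theorem isOutwardNormal_normal (hΩ : IsOpen Ω) (hb : HasC1Boundary Ω) {x : Space d}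
    (hx : x ∈ frontier Ω) : IsOutwardNormal Ω x (normal Ω x) := by
  obtain ⟨e, φ, r, h⟩ := hb x hx
  have h1 := h.isOutwardNormal (Metric.mem_ball_self h.pos) hx
  rwa [normal_eq_of_isOutwardNormal hΩ h1]

theorem continuousOn_normal (hΩ : IsOpen Ω) (hb : HasC1Boundary Ω) :
    ContinuousOn (normal Ω) (frontier Ω) := by
  intro x hx
  obtain ⟨e, φ, r, h⟩ := hb x hx
  have hc := continuous_gradient_chartFun (e := e) h.smooth
  have hc' : ContinuousAt (fun x => ‖gradient (chartFun e φ) x‖⁻¹ • gradient (chartFun e φ) x) x :=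
    (hc.continuousAt.norm.inv₀
      (norm_ne_zero_iff.2 (gradient_chartFun_ne_zero h.unit h.smooth x))).smul hc.continuousAt
  refine hc'.continuousWithinAt.congr_of_eventuallyEq ?_
    (h.normal_eq hΩ (Metric.mem_ball_self h.pos) hx)
  filter_upwards [self_mem_nhdsWithin,
    mem_nhdsWithin_of_mem_nhds (Metric.ball_mem_nhds x h.pos)] with y hy hyb
  exact h.normal_eq hΩ hyb hy

theorem measurable_normal (hΩ : IsOpen Ω) (hb : HasC1Boundary Ω) : Measurable (normal Ω) := by
  classical
  have : normal Ω = (frontier Ω).piecewise (normal Ω) (fun _ => 0) := by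
    ext1 x
    by_cases hx : x ∈ frontier Ω
    · simp [hx]
    · simp [hx, normal_eq_zero hx]
  rw [this]
  exact (continuousOn_normal hΩ hb).measurable_piecewise continuousOn_const
    isClosed_frontier.measurableSet

/-! ### Travel times -/

theorem backTime_nonneg (x v : Space d) : 0 ≤ backTime Ω x v :=
  Real.sInf_nonneg fun _ hs => hs.1.le

theorem bddBelow_backTime (x v : Space d) : BddBelow {s : ℝ | 0 < s ∧ x - s • v ∉ Ω} :=
  ⟨0, fun _ hs => hs.1.le⟩

theorem sub_smul_mem_of_lt_backTime {x v : Space d} {s : ℝ} (hs : 0 < s)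
    (hlt : s < backTime Ω x v) : x - s • v ∈ Ω := by
  by_contra hmem
  exact notMem_of_lt_csInf hlt (bddBelow_backTime x v) ⟨hs, hmem⟩

/-- The infimum of the empty set of reals is `0`, so a positive travel time excludes the default
value. -/
theorem nonempty_of_backTime_pos {x v : Space d} (h : 0 < backTime Ω x v) :
    {s : ℝ | 0 < s ∧ x - s • v ∉ Ω}.Nonempty := by
  by_contra hne
  rw [Set.not_nonempty_iff_eq_empty] at hne
  rw [backTime, hne, Real.sInf_empty] at h
  exact lt_irrefl _ h

theorem backTime_mul_norm_le (hb : Bornology.IsBounded Ω) (x v : Space d) :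
    backTime Ω x v * ‖v‖ ≤ Metric.diam Ω := by
  rcases (backTime_nonneg (Ω := Ω) x v).eq_or_lt with h0 | hpos
  · rw [← h0, zero_mul]; exact Metric.diam_nonneg
  set T := backTime Ω x v
  -- The ends of the chord need not lie in `Ω`; the chord is shortened by `ε` at both ends before
  -- comparison with the diameter.
  have key : ∀ ε : ℝ, 0 < ε → ε < T / 2 → (T - 2 * ε) * ‖v‖ ≤ Metric.diam Ω := by
    intro ε hε hεT
    have h1 : x - ε • v ∈ Ω := sub_smul_mem_of_lt_backTime hε (by linarith)
    have h2 : x - (T - ε) • v ∈ Ω := sub_smul_mem_of_lt_backTime (by linarith) (by linarith)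
    have h3 := Metric.dist_le_diam_of_mem hb h1 h2
    have h4 : x - ε • v - (x - (T - ε) • v) = (T - 2 * ε) • v := by module
    rwa [dist_eq_norm, h4, norm_smul, Real.norm_of_nonneg (by linarith)] at h3
  have ht : Tendsto (fun ε : ℝ => (T - 2 * ε) * ‖v‖) (𝓝[>] 0) (𝓝 ((T - 2 * 0) * ‖v‖)) :=
    (Continuous.tendsto (by fun_prop) 0).mono_left nhdsWithin_le_nhds
  rw [mul_zero, sub_zero] at ht
  refine le_of_tendsto ht ?_
  filter_upwards [self_mem_nhdsWithin,
    mem_nhdsWithin_of_mem_nhds (gt_mem_nhds (half_pos hpos))] with ε h1 h2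
  exact key ε h1 h2

theorem nonempty_of_ne_zero (hb : Bornology.IsBounded Ω) (x : Space d) {v : Space d} (hv : v ≠ 0) :
    {s : ℝ | 0 < s ∧ x - s • v ∉ Ω}.Nonempty := by
  by_contra hne
  rw [Set.not_nonempty_iff_eq_empty] at hne
  have hall : ∀ s : ℝ, 0 < s → x - s • v ∈ Ω := fun s hs => by
    by_contra hmem
    have : s ∈ {s : ℝ | 0 < s ∧ x - s • v ∉ Ω} := ⟨hs, hmem⟩
    rw [hne] at this
    exact this
  have hv' : 0 < ‖v‖ := norm_pos_iff.2 hv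
  set s : ℝ := (Metric.diam Ω + 1) / ‖v‖
  have hs : 0 < s := div_pos (by linarith [Metric.diam_nonneg (s := Ω)]) hv'
  have h3 := Metric.dist_le_diam_of_mem hb (hall s hs) (hall (s + s) (by linarith))
  have h4 : x - s • v - (x - (s + s) • v) = s • v := by module
  rw [dist_eq_norm, h4, norm_smul, Real.norm_of_nonneg hs.le, div_mul_cancel₀ _ hv'.ne'] at h3
  linarith

theorem backTime_sub_smul {x v : Space d} {s : ℝ} (hs : 0 < s) (hlt : s < backTime Ω x v) :
    backTime Ω (x - s • v) v = backTime Ω x v - s := by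
  have hne := nonempty_of_backTime_pos (hs.trans hlt)
  have hset : ∀ σ : ℝ, x - s • v - σ • v = x - (s + σ) • v := fun σ => by module
  apply le_antisymm
  · rw [le_sub_iff_add_le]
    refine le_csInf hne fun σ hσ => ?_
    have hle : backTime Ω x v ≤ σ := csInf_le (bddBelow_backTime x v) hσ
    rw [← le_sub_iff_add_le]
    refine csInf_le (bddBelow_backTime _ v) ⟨by linarith, ?_⟩
    rw [hset, add_sub_cancel]
    exact hσ.2
  · obtain ⟨σ, hσ⟩ := hne
    have hle : backTime Ω x v ≤ σ := csInf_le (bddBelow_backTime x v) hσ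
    refine le_csInf ⟨σ - s, by linarith, ?_⟩ fun σ hσ => ?_
    · rw [hset, add_sub_cancel]; exact hσ.2
    · rw [sub_le_iff_le_add']
      refine csInf_le (bddBelow_backTime x v) ⟨by linarith [hσ.1], ?_⟩
      rw [← hset]; exact hσ.2

theorem backTime_eq_of_notMem {x v : Space d} {s : ℝ} (hs : 0 < s) (hx : x - s • v ∉ Ω)
    (h : ∀ σ : ℝ, 0 < σ → σ < s → x - σ • v ∈ Ω) : backTime Ω x v = s :=
  le_antisymm (csInf_le (bddBelow_backTime x v) ⟨hs, hx⟩)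
    (le_csInf ⟨s, hs, hx⟩ fun σ hσ => not_lt.1 fun hlt => hσ.2 (h σ hσ.1 hlt))

/-- The backward travel time from a point reached after flying for time `s` from a point outside
of `Ω`. -/
theorem backTime_add_smul {x v : Space d} {s : ℝ} (hx : x ∉ Ω) (hs : 0 < s)
    (hlt : s < backTime Ω x (-v)) : backTime Ω (x + s • v) v = s := by
  refine backTime_eq_of_notMem hs (by simpa using hx) fun σ h1 h2 => ?_
  have h3 := sub_smul_mem_of_lt_backTime (Ω := Ω) (x := x) (v := -v) (s := s - σ)
    (by linarith) (by linarith)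
  have h4 : x + s • v - σ • v = x - (s - σ) • -v := by module
  rwa [h4]

theorem sub_backTime_smul_notMem (hΩ : IsOpen Ω) {x v : Space d} (h : 0 < backTime Ω x v) :
    x - backTime Ω x v • v ∉ Ω := by
  intro hmem
  have hc : Continuous fun s : ℝ => x - s • v := by fun_prop
  have hopen := (hΩ.preimage hc).mem_nhds hmem
  obtain ⟨ε, hε, hball⟩ := Metric.mem_nhds_iff.1 hopen
  have : backTime Ω x v + ε ≤ backTime Ω x v := by
    refine le_csInf (nonempty_of_backTime_pos h) fun σ hσ => ?_
    by_contra hlt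
    have hle : backTime Ω x v ≤ σ := csInf_le (bddBelow_backTime x v) hσ
    exact hσ.2 (hball (by rw [Metric.mem_ball, Real.dist_eq, abs_lt]; constructor <;> linarith))
  linarith

theorem sub_backTime_smul_mem_frontier (hΩ : IsOpen Ω) {x v : Space d}
    (h : 0 < backTime Ω x v) : x - backTime Ω x v • v ∈ frontier Ω := by
  rw [hΩ.frontier_eq]
  refine ⟨?_, sub_backTime_smul_notMem hΩ h⟩
  have hc : Continuous fun s : ℝ => x - s • v := by fun_prop
  refine mem_closure_of_tendsto (b := 𝓝[<] (backTime Ω x v))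
    ((hc.tendsto _).mono_left nhdsWithin_le_nhds) ?_
  filter_upwards [self_mem_nhdsWithin, mem_nhdsWithin_of_mem_nhds (lt_mem_nhds h)] with s h1 h2
  exact sub_smul_mem_of_lt_backTime h2 h1

theorem backTime_pos_of_eventually (hb : Bornology.IsBounded Ω) {x v : Space d} (hv : v ≠ 0)
    (h : ∀ᶠ s : ℝ in 𝓝[>] 0, x - s • v ∈ Ω) : 0 < backTime Ω x v := by
  obtain ⟨ε, hε, hsub⟩ := mem_nhdsGT_iff_exists_Ioo_subset.1 h
  refine lt_of_lt_of_le hε (le_csInf (nonempty_of_ne_zero hb x hv) fun σ hσ => ?_)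
  by_contra hlt
  exact hσ.2 (hsub ⟨hσ.1, not_le.1 hlt⟩)

theorem backTime_pos_of_mem (hΩ : IsOpen Ω) (hb : Bornology.IsBounded Ω) {x v : Space d}
    (hv : v ≠ 0) (hx : x ∈ Ω) : 0 < backTime Ω x v := by
  refine backTime_pos_of_eventually hb hv (eventually_nhdsWithin_of_eventually_nhds ?_)
  have hc : Continuous fun s : ℝ => x - s • v := by fun_prop
  exact (hΩ.preimage hc).mem_nhds (by simpa using hx)

theorem backTime_pos_of_inner_pos (hΩ : IsOpen Ω) (hb : Bornology.IsBounded Ω)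
    (hC : HasC1Boundary Ω) {y v : Space d} (h : 0 < ⟪v, normal Ω y⟫_ℝ) : 0 < backTime Ω y v := by
  have hy : y ∈ frontier Ω := by
    by_contra hy
    rw [normal_eq_zero hy, inner_zero_right] at h
    exact lt_irrefl _ h
  have hv : v ≠ 0 := by rintro rfl; simp at h
  refine backTime_pos_of_eventually hb hv ?_
  have h1 : ⟪-v, normal Ω y⟫_ℝ < 0 := by rw [inner_neg_left]; linarith
  filter_upwards [((isOutwardNormal_normal hΩ hC hy).eventually hΩ).1 h1] with s hs
  simpa [sub_eq_add_neg] using hs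

/-- A strictly outgoing velocity at the entry point would put the beginning of the flight outside
`Ω`. -/
theorem inner_normal_sub_backTime_nonpos (hΩ : IsOpen Ω) (hC : HasC1Boundary Ω)
    {x v : Space d} (h : 0 < backTime Ω x v) :
    ⟪v, normal Ω (x - backTime Ω x v • v)⟫_ℝ ≤ 0 := by
  by_contra hpos
  have hn := isOutwardNormal_normal hΩ hC (sub_backTime_smul_mem_frontier hΩ h)
  have h1 := (hn.eventually hΩ).2 (not_le.1 hpos)
  have h2 : ∀ᶠ s : ℝ in 𝓝[>] 0, s < backTime Ω x v := mem_nhdsWithin_of_mem_nhds (gt_mem_nhds h)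
  obtain ⟨s, hs, hs2, hs3⟩ := (h1.and (h2.and self_mem_nhdsWithin)).exists
  apply hs
  have h4 : x - backTime Ω x v • v + s • v = x - (backTime Ω x v - s) • v := by module
  rw [h4]
  have hs3' : 0 < s := hs3
  exact sub_smul_mem_of_lt_backTime (by linarith) (by linarith)

/-- For zero velocity the set of times is empty or all of `(0, ∞)`; the infimum is `0` in both
cases, in the first by convention. -/
theorem backTime_zero (x : Space d) : backTime Ω x 0 = 0 := by
  by_cases hx : x ∈ Ω
  · simp [backTime, hx]
  · simp only [backTime, smul_zero, sub_zero, hx, not_false_eq_true, and_true]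
    exact csInf_Ioi

/-- For a compact interval of times, the condition that the corresponding segment stays in the open
set `Ω` is open in `(x, v)`. The superlevel sets are built from countably many such conditions. -/
theorem measurable_backTime (hΩ : IsOpen Ω) (hb : Bornology.IsBounded Ω) :
    Measurable fun p : Space d × Space d => backTime Ω p.1 p.2 := by
  have hU : ∀ a b : ℝ, IsOpen {p : Space d × Space d | ∀ s ∈ Set.Icc a b, p.1 - s • p.2 ∈ Ω} := by
    intro a b
    have hc : IsOpen {q : ℝ × (Space d × Space d) | q.2.1 - q.1 • q.2.2 ∈ Ω} :=
      hΩ.preimage (by fun_prop)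
    rw [isOpen_iff_eventually]
    intro p hp
    refine isCompact_Icc.eventually_forall_of_forall_eventually fun s hs => ?_
    exact (continuous_swap.tendsto (p, s)).eventually (hc.eventually_mem (x := (s, p)) (hp s hs))
  refine measurable_of_Ioi fun c => ?_
  rcases lt_or_ge c 0 with hc | hc
  · convert MeasurableSet.univ
    ext p
    simpa using hc.trans_le (backTime_nonneg p.1 p.2)
  -- A rational `q > c` replaces the strict inequality. The intervals begin at `1 / (k + 1)` because
  -- time `0` is not tested: `x` may lie outside `Ω`. Zero velocity is removed because its travel
  -- time is `0` even when the line never leaves `Ω`.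
  have hset : (fun p : Space d × Space d => backTime Ω p.1 p.2) ⁻¹' Set.Ioi c =
      {p | p.2 ≠ 0} ∩ ⋃ q : ℚ, ⋃ (_ : c < q), ⋂ k : ℕ,
        {p : Space d × Space d | ∀ s ∈ Set.Icc (1 / ((k : ℝ) + 1)) (q : ℝ), p.1 - s • p.2 ∈ Ω} := by
    ext p
    simp only [Set.mem_preimage, Set.mem_Ioi, Set.mem_inter_iff, Set.mem_iUnion, Set.mem_iInter,
      Set.mem_ofPred_eq, exists_prop]
    constructor
    · intro h
      refine ⟨fun h0 => ?_, ?_⟩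
      · rw [h0, backTime_zero] at h
        linarith
      · obtain ⟨q, hq1, hq2⟩ := exists_rat_btwn h
        exact ⟨q, hq1, fun k s hs => sub_smul_mem_of_lt_backTime
          (lt_of_lt_of_le (by positivity) hs.1) (hs.2.trans_lt hq2)⟩
    · rintro ⟨hv, q, hq, h⟩
      refine hq.trans_le (le_csInf (nonempty_of_ne_zero hb _ hv) fun σ hσ => ?_)
      by_contra hlt
      obtain ⟨k, hk⟩ := exists_nat_one_div_lt hσ.1
      exact hσ.2 (h k σ ⟨hk.le, (not_le.1 hlt).le⟩)
  rw [hset]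
  refine MeasurableSet.inter ?_ (.iUnion fun q => .iUnion fun _ => .iInter fun k =>
    (hU _ _).measurableSet)
  exact (measurableSet_eq_fun measurable_snd measurable_const).compl

theorem measurable_backTime_comp (hΩ : IsOpen Ω) (hb : Bornology.IsBounded Ω) {α : Type*}
    [MeasurableSpace α] {f g : α → Space d} (hf : Measurable f) (hg : Measurable g) :
    Measurable fun a => backTime Ω (f a) (g a) :=
  Measurable.comp (g := fun p : Space d × Space d => backTime Ω p.1 p.2)
    (f := fun a => (f a, g a)) (measurable_backTime hΩ hb) (hf.prodMk hg)

end DiffuseTransport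

end
noncomputable section

namespace DiffuseTransport

variable {d : ℕ}

/-! ### Integration along characteristics, for a fixed velocity -/

section Shear

variable {e : Space d} {φ : Space d → ℝ}

/-- The ambient graph map of a chart. -/
def chartGraph (e : Space d) (φ : Space d → ℝ) (x : Space d) : Space d :=
  (x - ⟪x, e⟫_ℝ • e) + φ (x - ⟪x, e⟫_ℝ • e) • e

/-- The map that follows the graph of a chart horizontally and the direction `-v` vertically. -/
def chartFlow (e : Space d) (φ : Space d → ℝ) (v x : Space d) : Space d :=
  chartGraph e φ x - ⟪x, e⟫_ℝ • v

theorem inner_hyperplane (u : (ℝ ∙ e)ᗮ) : ⟪(u : Space d), e⟫_ℝ = 0 := by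
  rw [real_inner_comm]
  exact Submodule.mem_orthogonal_singleton_iff_inner_right.1 u.2

theorem inner_hyperplane_add (he : ‖e‖ = 1) (u : (ℝ ∙ e)ᗮ) (s : ℝ) :
    ⟪(u : Space d) + s • e, e⟫_ℝ = s := by
  rw [inner_add_left, inner_hyperplane, real_inner_smul_left, real_inner_self_eq_norm_sq, he]
  ring

theorem sub_inner_hyperplane_add (he : ‖e‖ = 1) (u : (ℝ ∙ e)ᗮ) (s : ℝ) :
    ((u : Space d) + s • e) - ⟪(u : Space d) + s • e, e⟫_ℝ • e = u := by
  rw [inner_hyperplane_add he, add_sub_cancel_right]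

theorem chartGraph_add (he : ‖e‖ = 1) (u : (ℝ ∙ e)ᗮ) (s : ℝ) :
    chartGraph e φ (u + s • e) = graphMap e (fun w => φ w) u := by
  rw [chartGraph, sub_inner_hyperplane_add he, graphMap]

theorem chartGraph_of_chartFun_eq_zero {y : Space d} (h : chartFun e φ y = 0) :
    chartGraph e φ y = y := by
  rw [chartFun, sub_eq_zero] at h
  rw [chartGraph, ← h, sub_add_cancel]

theorem sub_inner_smul_idem (he : ‖e‖ = 1) (y : Space d) (s : ℝ) :
    (y - ⟪y, e⟫_ℝ • e + s • e) - ⟪y - ⟪y, e⟫_ℝ • e + s • e, e⟫_ℝ • e = y - ⟪y, e⟫_ℝ • e ∧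
      ⟪y - ⟪y, e⟫_ℝ • e + s • e, e⟫_ℝ = s := by
  have : ⟪y - ⟪y, e⟫_ℝ • e + s • e, e⟫_ℝ = s := by
    rw [inner_add_left, inner_sub_left, real_inner_smul_left, real_inner_smul_left,
      real_inner_self_eq_norm_sq, he]
    ring
  exact ⟨by rw [this, add_sub_cancel_right], this⟩

theorem gradient_chartFun_congr (hφ : ContDiff ℝ 1 φ) {x y : Space d}
    (h : x - ⟪x, e⟫_ℝ • e = y - ⟪y, e⟫_ℝ • e) :
    gradient (chartFun e φ) x = gradient (chartFun e φ) y := by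
  apply ext_inner_left ℝ
  intro w
  rw [inner_gradient_chartFun hφ, inner_gradient_chartFun hφ, h]

theorem gradient_chartFun_chartGraph (he : ‖e‖ = 1) (hφ : ContDiff ℝ 1 φ) (x : Space d) :
    gradient (chartFun e φ) (chartGraph e φ x) = gradient (chartFun e φ) x :=
  gradient_chartFun_congr hφ (sub_inner_smul_idem he x _).1

/-- The gradient is `e - b`, with `b` the horizontal gradient of `φ`. Its norm is the area density
of the graph, so in flux integrals it cancels the normalization of the normal. -/
theorem norm_gradient_chartFun (he : ‖e‖ = 1) (hφ : ContDiff ℝ 1 φ) (u : (ℝ ∙ e)ᗮ) (s : ℝ) :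
    ‖gradient (chartFun e φ) (u + s • e)‖ =
      √(1 + ‖fderiv ℝ (fun w : (ℝ ∙ e)ᗮ => φ w) u‖ ^ 2) := by
  set a := fderiv ℝ (fun w : (ℝ ∙ e)ᗮ => φ w) u
  have ha : ∀ w : (ℝ ∙ e)ᗮ, a w = fderiv ℝ φ u w := fun w => by
    have h1 : HasFDerivAt (fun w : (ℝ ∙ e)ᗮ => φ w)
        ((fderiv ℝ φ u).comp (ℝ ∙ e)ᗮ.subtypeL) u :=
      (hφ.differentiable (by simp) (u : Space d)).hasFDerivAt.comp u
        (ℝ ∙ e)ᗮ.subtypeL.hasFDerivAt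
    simp only [a, h1.fderiv]
    rfl
  set b := (InnerProductSpace.toDual ℝ (ℝ ∙ e)ᗮ).symm a with hb
  have hab : ∀ w, a w = ⟪(b : Space d), w⟫_ℝ := fun w => by
    have : a w = ⟪b, w⟫_ℝ := by simp [hb]
    rw [this]; rfl
  have hnb : ‖(b : Space d)‖ = ‖a‖ := by
    have : ‖b‖ = ‖a‖ := by simp [hb]
    rw [← this]; rfl
  have hgrad : gradient (chartFun e φ) (u + s • e) = e - b := by
    apply ext_inner_left ℝ
    intro w
    rw [inner_gradient_chartFun hφ, sub_inner_hyperplane_add he]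
    have hw : w - ⟪w, e⟫_ℝ • e ∈ (ℝ ∙ e)ᗮ := by
      rw [Submodule.mem_orthogonal_singleton_iff_inner_right, real_inner_comm, inner_sub_left,
        real_inner_smul_left, real_inner_self_eq_norm_sq, he]
      ring
    have h2 := ha ⟨_, hw⟩
    rw [hab] at h2
    rw [← h2, inner_sub_right, inner_sub_right, real_inner_smul_right, inner_hyperplane, mul_zero,
      sub_zero, real_inner_comm w]
  rw [hgrad, ← Real.sqrt_sq (norm_nonneg _), norm_sub_sq_real, he, hnb, real_inner_comm,
    inner_hyperplane]
  congr 1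
  ring

/-- The derivative of `chartFlow`. -/
def chartFlowDeriv (e : Space d) (φ : Space d → ℝ) (v x : Space d) : Space d →L[ℝ] Space d :=
  let P : Space d →L[ℝ] Space d :=
    ContinuousLinearMap.id ℝ _ - (innerSL ℝ e : Space d →L[ℝ] ℝ).smulRight e
  P + ((fderiv ℝ φ (x - ⟪x, e⟫_ℝ • e)).comp P).smulRight e -
    (innerSL ℝ e : Space d →L[ℝ] ℝ).smulRight v

theorem hasFDerivAt_chartFlow (hφ : ContDiff ℝ 1 φ) (v x : Space d) :
    HasFDerivAt (chartFlow e φ v) (chartFlowDeriv e φ v x) x := by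
  have hl : HasFDerivAt (fun y : Space d => ⟪y, e⟫_ℝ) ((innerSL ℝ e : Space d →L[ℝ] ℝ)) x := by
    have := (innerSL ℝ e : Space d →L[ℝ] ℝ).hasFDerivAt (x := x)
    refine this.congr_of_eventuallyEq (Eventually.of_forall fun y => ?_)
    simp [real_inner_comm]
  have hP := (hasFDerivAt_id x).sub (hl.smul_const e)
  have hd : DifferentiableAt ℝ φ (x - ⟪x, e⟫_ℝ • e) := hφ.differentiable (by simp) _
  exact (hP.add ((hd.hasFDerivAt.comp x hP).smul_const e)).sub (hl.smul_const v)

/-- The derivative factors into two transvections. The one along `e` has determinant `1` because its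
functional kills `e`; the other, with functional `⟪·, e⟫`, carries the whole dependence on `v`. -/
theorem det_chartFlowDeriv (he : ‖e‖ = 1) (hφ : ContDiff ℝ 1 φ) (v x : Space d) :
    (chartFlowDeriv e φ v x).det = -⟪v, gradient (chartFun e φ) x⟫_ℝ := by
  set a : Space d →ₗ[ℝ] ℝ := ((fderiv ℝ φ (x - ⟪x, e⟫_ℝ • e)).comp
    (ContinuousLinearMap.id ℝ _ - (innerSL ℝ e : Space d →L[ℝ] ℝ).smulRight e)).toLinearMap
  have ha : ∀ h, a h = fderiv ℝ φ (x - ⟪x, e⟫_ℝ • e) (h - ⟪h, e⟫_ℝ • e) := fun h => by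
    simp [a, real_inner_comm]
  have hae : a e = 0 := by
    rw [ha, real_inner_self_eq_norm_sq, he]
    simp
  set b : Space d →ₗ[ℝ] ℝ := (innerSL ℝ e : Space d →L[ℝ] ℝ).toLinearMap
  have hb : ∀ h, b h = ⟪h, e⟫_ℝ := fun h => by simp [b, real_inner_comm]
  have hcomp : (chartFlowDeriv e φ v x).toLinearMap =
      LinearMap.transvection a e ∘ₗ LinearMap.transvection b (-v - e + a v • e) := by
    ext1 h
    have h1 : (chartFlowDeriv e φ v x).toLinearMap h = (h - b h • e) + a h • e - b h • v := by
      simp [chartFlowDeriv, a, b]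
    rw [h1, LinearMap.comp_apply]
    simp only [LinearMap.transvection.apply, map_add, map_smul, map_sub, map_neg, hae]
    module
  rw [ContinuousLinearMap.det, hcomp, LinearMap.det_comp, LinearMap.transvection.det,
    LinearMap.transvection.det, hae, inner_gradient_chartFun hφ, ← ha, hb]
  rw [inner_add_left, inner_sub_left, inner_neg_left, real_inner_smul_left,
    real_inner_self_eq_norm_sq, he]
  ring

theorem continuous_chartGraph (hφ : ContDiff ℝ 1 φ) : Continuous (chartGraph e φ) := by
  have := hφ.continuous
  unfold chartGraph
  fun_prop

end Shear

theorem finrank_hyperplane {e : Space d} (he : ‖e‖ = 1) :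
    Module.finrank ℝ (ℝ ∙ e)ᗮ = d - 1 := by
  have h := (ℝ ∙ e).finrank_add_finrank_orthogonal
  rw [finrank_span_singleton (by rintro rfl; simp at he), finrank_euclideanSpace_fin] at h
  omega

/-! ### Exit through a piece of the boundary contained in one chart -/

variable {Ω : Set (Space d)}

/-- The points from which one leaves `Ω` through `S`, in the direction `v`. -/
def exitSet (Ω : Set (Space d)) (v : Space d) (S : Set (Space d)) : Set (Space d) :=
  {x | x ∈ Ω ∧ x + backTime Ω x (-v) • v ∈ S}

theorem measurable_exitPoint (hΩ : IsOpen Ω) (hb : Bornology.IsBounded Ω) (v : Space d) :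
    Measurable fun x => x + backTime Ω x (-v) • v := by
  have h : Measurable fun x => backTime Ω x (-v) :=
    measurable_backTime_comp hΩ hb measurable_id measurable_const
  exact measurable_id.add (h.smul_const v)

theorem measurableSet_exitSet (hΩ : IsOpen Ω) (hb : Bornology.IsBounded Ω) (v : Space d)
    {S : Set (Space d)} (hS : MeasurableSet S) : MeasurableSet (exitSet Ω v S) :=
  hΩ.measurableSet.inter (measurable_exitPoint hΩ hb v hS)

/-- The coordinates, in a chart, of the points that leave `Ω` transversally through `S`. -/
def chartExit (Ω : Set (Space d)) (e : Space d) (φ : Space d → ℝ) (v : Space d)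
    (S : Set (Space d)) : Set (Space d) :=
  {x | chartGraph e φ x ∈ S ∧ 0 < ⟪v, gradient (chartFun e φ) x⟫_ℝ ∧ 0 < ⟪x, e⟫_ℝ ∧
    ⟪x, e⟫_ℝ < backTime Ω (chartGraph e φ x) v}

section Piece

variable {x₀ e v : Space d} {φ : Space d → ℝ} {r : ℝ} {S : Set (Space d)}

theorem measurableSet_chartExit (hΩ : IsOpen Ω) (hb : Bornology.IsBounded Ω)
    (hφ : ContDiff ℝ 1 φ) (hS : MeasurableSet S) : MeasurableSet (chartExit Ω e φ v S) := by
  have hG := (continuous_chartGraph (e := e) hφ).measurable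
  have hg := (continuous_gradient_chartFun (e := e) hφ).measurable
  have hT : Measurable fun x => backTime Ω (chartGraph e φ x) v :=
    measurable_backTime_comp hΩ hb hG measurable_const
  have hl : Measurable fun x : Space d => ⟪x, e⟫_ℝ := by fun_prop
  have hvg : Measurable fun x => ⟪v, gradient (chartFun e φ) x⟫_ℝ := by fun_prop
  have hset : chartExit Ω e φ v S = chartGraph e φ ⁻¹' S ∩
      ({x | 0 < ⟪v, gradient (chartFun e φ) x⟫_ℝ} ∩ ({x | 0 < ⟪x, e⟫_ℝ} ∩
        {x | ⟪x, e⟫_ℝ < backTime Ω (chartGraph e φ x) v})) := rfl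
  rw [hset]
  exact (hG hS).inter ((measurableSet_lt measurable_const hvg).inter
    ((measurableSet_lt measurable_const hl).inter (measurableSet_lt hl hT)))

/-- The height coordinate in the chart is the time left before exit: the point is reached backwards
from a boundary point before the chord ends. -/
theorem exitPoint_chartFlow (hΩ : IsOpen Ω) (hSf : S ⊆ frontier Ω) {x : Space d}
    (hx : x ∈ chartExit Ω e φ v S) :
    chartFlow e φ v x ∈ Ω ∧ backTime Ω (chartFlow e φ v x) (-v) = ⟪x, e⟫_ℝ := by
  obtain ⟨h1, -, h3, h4⟩ := hx
  refine ⟨sub_smul_mem_of_lt_backTime h3 h4, ?_⟩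
  have h5 : chartGraph e φ x ∉ Ω := by
    have := hSf h1
    rw [hΩ.frontier_eq] at this
    exact this.2
  have h6 := backTime_add_smul (v := -v) h5 h3 (by rwa [neg_neg])
  rwa [smul_neg, ← sub_eq_add_neg] at h6

/-- The image point determines its exit time, hence the height, and its exit point, hence the
horizontal part. -/
theorem injOn_chartFlow (he : ‖e‖ = 1) (hΩ : IsOpen Ω) (hSf : S ⊆ frontier Ω) :
    Set.InjOn (chartFlow e φ v) (chartExit Ω e φ v S) := by
  intro x hx y hy hxy
  have h1 := (exitPoint_chartFlow hΩ hSf hx).2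
  have h2 := (exitPoint_chartFlow hΩ hSf hy).2
  rw [← hxy, h1] at h2
  rw [chartFlow, chartFlow, h2, sub_left_inj] at hxy
  have e1 := (sub_inner_smul_idem he x (φ (x - ⟪x, e⟫_ℝ • e))).1
  have e2 := (sub_inner_smul_idem he y (φ (y - ⟪y, e⟫_ℝ • e))).1
  change chartGraph e φ x - ⟪chartGraph e φ x, e⟫_ℝ • e = _ at e1
  change chartGraph e φ y - ⟪chartGraph e φ y, e⟫_ℝ • e = _ at e2
  rw [hxy, e2, h2] at e1
  exact (sub_left_inj.1 e1).symm

/-- Every point that exits through `S` has chart coordinates, whether or not it exits transversally;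
only the sign condition of `chartExit` is left open. -/
theorem mem_image_chartFlow (hΩ : IsOpen Ω) (hb : Bornology.IsBounded Ω) (hv : v ≠ 0)
    (h : IsBoundaryChart Ω x₀ e φ r) (hSf : S ⊆ frontier Ω) (hSb : S ⊆ Metric.ball x₀ r)
    {x : Space d} (hx : x ∈ exitSet Ω v S) : ∃ z, chartFlow e φ v z = x ∧
      chartGraph e φ z = x + backTime Ω x (-v) • v ∧ ⟪z, e⟫_ℝ = backTime Ω x (-v) ∧
      0 < backTime Ω x (-v) ∧ backTime Ω x (-v) < backTime Ω (x + backTime Ω x (-v) • v) v := by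
  set s := backTime Ω x (-v) with hs
  set y := x + s • v with hy
  have hs0 : 0 < s := backTime_pos_of_mem hΩ hb (neg_ne_zero.2 hv) hx.1
  have hy0 := chartGraph_of_chartFun_eq_zero (h.chartFun_eq_zero hΩ (hSb hx.2) (hSf hx.2))
  have hid := sub_inner_smul_idem h.unit y s
  have hG : chartGraph e φ (y - ⟪y, e⟫_ℝ • e + s • e) = y := by
    rw [chartGraph, hid.1]; exact hy0
  refine ⟨y - ⟪y, e⟫_ℝ • e + s • e, ?_, hG, hid.2, hs0, ?_⟩
  · rw [chartFlow, hG, hid.2, hy, add_sub_cancel_right]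
  · have hle : s ≤ backTime Ω y v := by
      refine le_csInf (nonempty_of_ne_zero hb y hv) fun σ hσ => ?_
      by_contra hlt
      have h1 := sub_smul_mem_of_lt_backTime (Ω := Ω) (x := x) (v := -v) (s := s - σ)
        (by linarith) (by linarith [hσ.1])
      have h2 : x - (s - σ) • -v = y - σ • v := by rw [hy]; module
      rw [h2] at h1
      exact hσ.2 h1
    -- Equality would make `x` the entry point of its own chord, which is not in `Ω`.
    refine lt_of_le_of_ne hle fun heq => ?_
    have h3 := sub_backTime_smul_notMem hΩ (heq ▸ hs0)
    rw [← heq, hy, add_sub_cancel_right] at h3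
    exact h3 hx.1

/-- The points missed by the transversal coordinates exit tangentially. They lie in the image under
`chartFlow` of the zero set of its Jacobian, which is null by Sard's theorem. -/
theorem exitSet_ae_eq_image (hΩ : IsOpen Ω) (hb : Bornology.IsBounded Ω) (hC : HasC1Boundary Ω)
    (hv : v ≠ 0) (h : IsBoundaryChart Ω x₀ e φ r) (hSf : S ⊆ frontier Ω)
    (hSb : S ⊆ Metric.ball x₀ r) :
    exitSet Ω v S =ᵐ[volume] chartFlow e φ v '' chartExit Ω e φ v S := by
  have hsub : chartFlow e φ v '' chartExit Ω e φ v S ⊆ exitSet Ω v S := by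
    rintro _ ⟨z, hz, rfl⟩
    obtain ⟨h1, h2⟩ := exitPoint_chartFlow hΩ hSf hz
    refine ⟨h1, ?_⟩
    rw [h2, chartFlow, sub_add_cancel]
    exact hz.1
  have hnull : volume (exitSet Ω v S \ chartFlow e φ v '' chartExit Ω e φ v S) = 0 := by
    refine measure_mono_null ?_ (addHaar_image_eq_zero_of_det_fderivWithin_eq_zero volume
      (f := chartFlow e φ v) (s := {x | ⟪v, gradient (chartFun e φ) x⟫_ℝ = 0})
      (f' := chartFlowDeriv e φ v)
      (fun x _ => (hasFDerivAt_chartFlow h.smooth v x).hasFDerivWithinAt)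
      (fun x hx => by rw [det_chartFlowDeriv h.unit h.smooth, hx, neg_zero]))
    rintro x ⟨hx, hx'⟩
    obtain ⟨z, h1, h2, h3, h4, h5⟩ := mem_image_chartFlow hΩ hb hv h hSf hSb hx
    refine ⟨z, ?_, h1⟩
    -- Seen from the direction `-v` the exit point is an entry point, so the velocity is not
    -- incoming there; the only alternative to transversal exit is a vanishing Jacobian.
    have hn := inner_normal_sub_backTime_nonpos hΩ hC h4
    rw [smul_neg, sub_neg_eq_add, inner_neg_left, h.normal_eq hΩ (hSb hx.2) (hSf hx.2), ← h2,
      gradient_chartFun_chartGraph h.unit h.smooth, real_inner_smul_right] at hn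
    have hpos := norm_pos_iff.2 (gradient_chartFun_ne_zero h.unit h.smooth z)
    have hge : 0 ≤ ⟪v, gradient (chartFun e φ) z⟫_ℝ :=
      nonneg_of_mul_nonneg_right (by linarith) (inv_pos.2 hpos)
    refine (hge.eq_or_lt.resolve_right fun hlt => hx' ⟨z, ⟨?_, hlt, ?_, ?_⟩, h1⟩).symm
    · rw [h2]; exact hx.2
    · rw [h3]; exact h4
    · rw [h2, h3]; exact h5
  refine (ae_le_set.2 hnull).antisymm ?_
  exact hsub.eventuallyLE

theorem contDiff_restrict_hyperplane (e : Space d) (hφ : ContDiff ℝ 1 φ) :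
    ContDiff ℝ 1 fun w : (ℝ ∙ e)ᗮ => φ w :=
  hφ.comp (ℝ ∙ e)ᗮ.subtypeL.contDiff

theorem subset_range_graphMap (hΩ : IsOpen Ω) (h : IsBoundaryChart Ω x₀ e φ r)
    (hSf : S ⊆ frontier Ω) (hSb : S ⊆ Metric.ball x₀ r) :
    S ⊆ Set.range (graphMap e fun w : (ℝ ∙ e)ᗮ => φ w) := fun y hy => by
  have hy0 := chartGraph_of_chartFun_eq_zero (h.chartFun_eq_zero hΩ (hSb hy) (hSf hy))
  refine ⟨⟨y - ⟪y, e⟫_ℝ • e, ?_⟩, hy0⟩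
  rw [Submodule.mem_orthogonal_singleton_iff_inner_right, real_inner_comm]
  simpa using (sub_inner_smul_idem h.unit y 0).2

/-- Change of variables by `chartFlow`, followed by Fubini over horizontal part and height. The
Jacobian is `v · ∇ = ‖∇‖ (v · n)` and `‖∇‖` is the area density, so exactly the flux `v · n` with
respect to the surface measure remains. Incoming and tangential directions contribute zero through
`ENNReal.ofReal`. -/
theorem lintegral_exitSet_piece (hΩ : IsOpen Ω) (hb : Bornology.IsBounded Ω)
    (hC : HasC1Boundary Ω) (hv : v ≠ 0) (h : IsBoundaryChart Ω x₀ e φ r) (hS : MeasurableSet S)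
    (hSf : S ⊆ frontier Ω) (hSb : S ⊆ Metric.ball x₀ r) {g : Space d → ℝ≥0∞}
    (hg : Measurable g) :
    ∫⁻ x in exitSet Ω v S, g x =
      ∫⁻ y in S, ENNReal.ofReal ⟪v, normal Ω y⟫_ℝ *
        (∫⁻ s in Set.Ioo 0 (backTime Ω y v), g (y - s • v)) ∂μHE[d - 1] := by
  have hφK := contDiff_restrict_hyperplane e h.smooth
  have hn := measurable_normal hΩ hC
  have hT : Measurable fun y => backTime Ω y v :=
    measurable_backTime_comp hΩ hb measurable_id measurable_const
  have hind : Measurable fun q : Space d × ℝ =>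
      (Set.Ioo 0 (backTime Ω q.1 v)).indicator (fun s => g (q.1 - s • v)) q.2 := by
    have hset : MeasurableSet {q : Space d × ℝ | q.2 ∈ Set.Ioo 0 (backTime Ω q.1 v)} :=
      (measurableSet_lt measurable_const measurable_snd).inter
        (measurableSet_lt measurable_snd (hT.comp measurable_fst))
    have hgm : Measurable fun q : Space d × ℝ => g (q.1 - q.2 • v) := hg.comp (by fun_prop)
    exact hgm.indicator hset
  have hinner : ∀ y, ∫⁻ s in Set.Ioo 0 (backTime Ω y v), g (y - s • v) =
      ∫⁻ s, (Set.Ioo 0 (backTime Ω y v)).indicator (fun s => g (y - s • v)) s := fun y =>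
    (lintegral_indicator measurableSet_Ioo _).symm
  have hF : Measurable fun y => ENNReal.ofReal ⟪v, normal Ω y⟫_ℝ *
      ∫⁻ s in Set.Ioo 0 (backTime Ω y v), g (y - s • v) := by
    simp_rw [hinner]
    exact (ENNReal.measurable_ofReal.comp (by fun_prop)).mul hind.lintegral_prod_right'
  have hSr := subset_range_graphMap hΩ h hSf hSb
  have hW := measurableSet_chartExit (e := e) (v := v) hΩ hb h.smooth hS
  rw [setLIntegral_congr (exitSet_ae_eq_image hΩ hb hC hv h hSf hSb),
    lintegral_image_eq_lintegral_abs_det_fderiv_mul volume hW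
      (fun x _ => (hasFDerivAt_chartFlow h.smooth v x).hasFDerivWithinAt)
      (injOn_chartFlow h.unit hΩ hSf), ← finrank_hyperplane h.unit,
    lintegral_restrict_range_graphMap h.unit hφK hS hSr hF, ← lintegral_indicator hW,
    lintegral_eq_lintegral_hyperplane h.unit]
  · refine lintegral_congr fun u => ?_
    set y := graphMap e (fun w : (ℝ ∙ e)ᗮ => φ w) u with hy
    have hGs : ∀ s : ℝ, chartGraph e φ (u + s • e) = y := chartGraph_add h.unit u
    have hgr : ∀ s : ℝ, gradient (chartFun e φ) (u + s • e) = gradient (chartFun e φ) y :=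
      fun s => by rw [← hGs s, gradient_chartFun_chartGraph h.unit h.smooth]
    have hnorm := norm_gradient_chartFun h.unit h.smooth u 0
    rw [hgr] at hnorm
    have hpos := norm_pos_iff.2 (gradient_chartFun_ne_zero h.unit h.smooth y)
    rw [← hnorm]
    by_cases hyS : y ∈ S
    swap
    · rw [Set.indicator_of_notMem hyS, zero_mul, ← lintegral_zero]
      refine lintegral_congr fun s => Set.indicator_of_notMem (fun hs => hyS ?_) _
      have := hs.1
      rwa [hGs] at this
    rw [Set.indicator_of_mem hyS, h.normal_eq hΩ (hSb hyS) (hSf hyS), real_inner_smul_right,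
      mul_right_comm, ← ENNReal.ofReal_mul' hpos.le, mul_right_comm, inv_mul_cancel₀ hpos.ne',
      one_mul]
    rcases le_or_gt ⟪v, gradient (chartFun e φ) y⟫_ℝ 0 with hneg | hlt
    · rw [ENNReal.ofReal_of_nonpos hneg, zero_mul, ← lintegral_zero]
      refine lintegral_congr fun s => Set.indicator_of_notMem (fun hs => ?_) _
      have := hs.2.1
      rw [hgr] at this
      linarith
    · rw [hinner, ← lintegral_const_mul' _ _ ENNReal.ofReal_ne_top]
      refine lintegral_congr fun s => ?_
      by_cases hs : s ∈ Set.Ioo 0 (backTime Ω y v)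
      · rw [Set.indicator_of_mem hs, Set.indicator_of_mem, det_chartFlowDeriv h.unit h.smooth,
          hgr, abs_neg, abs_of_pos hlt, chartFlow, hGs, inner_hyperplane_add h.unit]
        refine ⟨by rwa [hGs], by rwa [hgr], ?_, ?_⟩
        · rw [inner_hyperplane_add h.unit]; exact hs.1
        · rw [hGs, inner_hyperplane_add h.unit]; exact hs.2
      · rw [Set.indicator_of_notMem hs, mul_zero, Set.indicator_of_notMem]
        intro hmem
        obtain ⟨-, -, h3, h4⟩ := hmem
        rw [hGs, inner_hyperplane_add h.unit] at h4
        rw [inner_hyperplane_add h.unit] at h3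
        exact hs ⟨h3, h4⟩
  · refine Measurable.indicator (Measurable.mul ?_ (hg.comp ?_)) hW
    · simp_rw [det_chartFlowDeriv h.unit h.smooth]
      have := (continuous_gradient_chartFun (e := e) h.smooth).measurable
      exact ENNReal.measurable_ofReal.comp (by fun_prop)
    · have := (continuous_chartGraph (e := e) h.smooth).measurable
      unfold chartFlow
      fun_prop

end Piece

end DiffuseTransport

end
noncomputable section

namespace DiffuseTransport

variable {d : ℕ} {Ω : Set (Space d)}

/-! ### The surface measure and the transport of measures along characteristics -/

/-- Disjoint pieces let the chart formulas be summed. The empty piece is allowed as an alternative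
because the frontier itself may be empty. -/
theorem exists_chart_partition (hC : HasC1Boundary Ω) : ∃ S : ℕ → Set (Space d),
    (∀ i, MeasurableSet (S i)) ∧ Pairwise (Function.onFun Disjoint S) ∧ ⋃ i, S i = frontier Ω ∧
      ∀ i, S i = ∅ ∨ ∃ x₀ e φ r, IsBoundaryChart Ω x₀ e φ r ∧ S i ⊆ Metric.ball x₀ r := by
  choose! e φ r h using hC
  obtain ⟨t, hts, htc, hcov⟩ := TopologicalSpace.countable_cover_nhdsWithin
    (s := frontier Ω) (f := fun x => Metric.ball x (r x))
    (fun x hx => mem_nhdsWithin_of_mem_nhds (Metric.ball_mem_nhds x (h x hx).pos))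
  rcases t.eq_empty_or_nonempty with rfl | hne
  · refine ⟨fun _ => ∅, fun _ => .empty, fun _ _ _ => by simp [Function.onFun], ?_,
      fun _ => Or.inl rfl⟩
    simpa [eq_comm] using hcov
  obtain ⟨g, rfl⟩ := htc.exists_eq_range hne
  set B : ℕ → Set (Space d) := disjointed fun i => frontier Ω ∩ Metric.ball (g i) (r (g i))
  have hB : ∀ i, B i ⊆ frontier Ω ∩ Metric.ball (g i) (r (g i)) := disjointed_subset _
  refine ⟨B, fun i => MeasurableSet.disjointed (fun i =>
    isClosed_frontier.measurableSet.inter Metric.isOpen_ball.measurableSet) i,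
    disjoint_disjointed _, ?_, fun i => Or.inr ⟨g i, _, _, _, h (g i) (hts ⟨i, rfl⟩),
      (hB i).trans Set.inter_subset_right⟩⟩
  simp only [B]
  rw [iUnion_disjointed, ← Set.inter_iUnion, Set.inter_eq_left]
  simpa using hcov

/-- On each piece the surface measure is an image of a measure with density on a hyperplane. This is
what makes Tonelli's theorem available for the flux measures. -/
theorem sFinite_surfaceMeasure (hΩ : IsOpen Ω) (hC : HasC1Boundary Ω) :
    SFinite (surfaceMeasure Ω) := by
  obtain ⟨S, hSm, hSd, hSU, hS⟩ := exists_chart_partition hC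
  have hsub : ∀ i, S i ⊆ frontier Ω := fun i => hSU ▸ Set.subset_iUnion S i
  rw [surfaceMeasure, ← hSU, Measure.restrict_iUnion hSd hSm]
  have : ∀ i, SFinite ((μHE[d - 1] : Measure (Space d)).restrict (S i)) := fun i => by
    rcases hS i with h0 | ⟨x₀, e, φ, r, h, hb⟩
    · rw [h0, Measure.restrict_empty]; infer_instance
    · rw [← finrank_hyperplane h.unit, restrict_euclideanHausdorffMeasure_graph h.unit
        (contDiff_restrict_hyperplane e h.smooth) (hSm i)
        (subset_range_graphMap hΩ h (hsub i) hb)]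
      infer_instance
  infer_instance

/-- Integration over `Ω` along the lines of direction `v`, parametrized by their exit points. -/
theorem lintegral_eq_lintegral_exit (hΩ : IsOpen Ω) (hb : Bornology.IsBounded Ω)
    (hC : HasC1Boundary Ω) {v : Space d} (hv : v ≠ 0) {g : Space d → ℝ≥0∞} (hg : Measurable g) :
    ∫⁻ x in Ω, g x = ∫⁻ y, ENNReal.ofReal ⟪v, normal Ω y⟫_ℝ *
      (∫⁻ s in Set.Ioo 0 (backTime Ω y v), g (y - s • v)) ∂(surfaceMeasure Ω) := by
  obtain ⟨S, hSm, hSd, hSU, hS⟩ := exists_chart_partition hC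
  have hsub : ∀ i, S i ⊆ frontier Ω := fun i => hSU ▸ Set.subset_iUnion S i
  have hΩU : Ω = ⋃ i, exitSet Ω v (S i) := by
    ext x
    simp only [exitSet, Set.mem_iUnion, Set.mem_ofPred_eq, exists_and_left]
    refine ⟨fun hx => ⟨hx, ?_⟩, fun hx => hx.1⟩
    have := sub_backTime_smul_mem_frontier hΩ (backTime_pos_of_mem hΩ hb (neg_ne_zero.2 hv) hx)
    rw [← hSU, smul_neg, sub_neg_eq_add] at this
    simpa using this
  have hdisj : Pairwise (Function.onFun Disjoint fun i => exitSet Ω v (S i)) := by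
    intro i j hij
    rw [Function.onFun, Set.disjoint_left]
    intro x hx hx'
    exact Set.disjoint_left.1 (hSd hij) hx.2 hx'.2
  conv_lhs => rw [hΩU]
  rw [surfaceMeasure, ← hSU, lintegral_iUnion (fun i => measurableSet_exitSet hΩ hb v (hSm i)) hdisj,
    lintegral_iUnion hSm hSd]
  refine tsum_congr fun i => ?_
  rcases hS i with h0 | ⟨x₀, e, φ, r, h, hb'⟩
  · simp [h0, exitSet]
  · exact lintegral_exitSet_piece hΩ hb hC hv h (hSm i) (hsub i) hb' hg

theorem notMem_of_inner_normal_ne_zero (hΩ : IsOpen Ω) {y v : Space d}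
    (h : ⟪v, normal Ω y⟫_ℝ ≠ 0) : y ∉ Ω := by
  intro hy
  apply h
  rw [normal_eq_zero, inner_zero_right]
  rw [hΩ.frontier_eq]
  exact fun h => h.2 hy

/-- Spreads a boundary value uniformly along a chord of duration `T`. -/
theorem lintegral_Ioo_const (T : ℝ) (hT : 0 < T) (c : ℝ≥0∞) :
    ∫⁻ _ in Set.Ioo 0 T, c * (ENNReal.ofReal T)⁻¹ = c := by
  rw [setLIntegral_const, Real.volume_Ioo, sub_zero, mul_assoc,
    ENNReal.inv_mul_cancel (by simpa using hT) ENNReal.ofReal_ne_top, mul_one]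

/-- Following a characteristic from its exit point back to its entry point preserves the flux. -/
theorem lintegral_entry (hΩ : IsOpen Ω) (hb : Bornology.IsBounded Ω) (hC : HasC1Boundary Ω)
    {v : Space d} (hv : v ≠ 0) {h : Space d → ℝ≥0∞} (hh : Measurable h) :
    ∫⁻ y, ENNReal.ofReal ⟪v, normal Ω y⟫_ℝ * h (y - backTime Ω y v • v) ∂(surfaceMeasure Ω) =
      ∫⁻ z, ENNReal.ofReal ⟪-v, normal Ω z⟫_ℝ * h z ∂(surfaceMeasure Ω) := by
  have hT : ∀ w : Space d, Measurable fun x => backTime Ω x w := fun w =>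
    measurable_backTime_comp hΩ hb measurable_id measurable_const
  -- The value of `h` at the entry point, divided by the duration of the whole chord. The integral
  -- of `g` over `Ω` is evaluated twice, with the lines parametrized by their exit points for `v`
  -- and for `-v`; each chord contributes `h(entry)` times the flux at the corresponding end.
  set g : Space d → ℝ≥0∞ := fun x => h (x - backTime Ω x v • v) *
    (ENNReal.ofReal (backTime Ω x v + backTime Ω x (-v)))⁻¹
  have hg : Measurable g :=
    (hh.comp (measurable_id.sub ((hT v).smul_const v))).mul
      (ENNReal.measurable_ofReal.comp ((hT v).add (hT (-v)))).inv
  have h1 := lintegral_eq_lintegral_exit hΩ hb hC hv hg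
  rw [lintegral_eq_lintegral_exit hΩ hb hC (neg_ne_zero.2 hv) hg] at h1
  convert h1.symm using 1
  · refine lintegral_congr fun y => ?_
    rcases le_or_gt ⟪v, normal Ω y⟫_ℝ 0 with hle | hlt
    · rw [ENNReal.ofReal_of_nonpos hle, zero_mul, zero_mul]
    congr 1
    have hpos := backTime_pos_of_inner_pos hΩ hb hC hlt
    have hy := notMem_of_inner_normal_ne_zero hΩ hlt.ne'
    rw [← lintegral_Ioo_const _ hpos (h (y - backTime Ω y v • v))]
    refine setLIntegral_congr_fun measurableSet_Ioo fun s hs => ?_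
    have e1 := backTime_sub_smul hs.1 hs.2
    have e2 := backTime_add_smul (v := -v) hy hs.1 (by rw [neg_neg]; exact hs.2)
    rw [smul_neg, ← sub_eq_add_neg] at e2
    simp only [g]
    rw [e1, e2, sub_add_cancel]
    congr 2
    module
  · refine lintegral_congr fun z => ?_
    rcases le_or_gt ⟪-v, normal Ω z⟫_ℝ 0 with hle | hlt
    · rw [ENNReal.ofReal_of_nonpos hle, zero_mul, zero_mul]
    congr 1
    have hpos := backTime_pos_of_inner_pos hΩ hb hC hlt
    have hz := notMem_of_inner_normal_ne_zero hΩ hlt.ne'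
    rw [← lintegral_Ioo_const _ hpos (h z)]
    refine setLIntegral_congr_fun measurableSet_Ioo fun s hs => ?_
    have e1 := backTime_sub_smul hs.1 hs.2
    have e2 := backTime_add_smul (v := v) hz hs.1 hs.2
    rw [smul_neg, sub_neg_eq_add] at e1
    simp only [g]
    rw [smul_neg, sub_neg_eq_add, e1, e2, add_sub_cancel, add_sub_cancel_right]

/-! ### Flux measures on phase space and exit coordinates -/

variable {m : Measure (Space d)}

theorem measurableSet_outgoing (hΩ : IsOpen Ω) (hC : HasC1Boundary Ω) :
    MeasurableSet (outgoing Ω m) := by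
  have := measurable_normal hΩ hC
  have h : Measurable fun p : Space d × Space d => ⟪p.2, normal Ω p.1⟫_ℝ := by fun_prop
  have hset : outgoing Ω m = (Prod.fst ⁻¹' frontier Ω) ∩ ((Prod.snd ⁻¹' m.support) ∩
    {p | 0 < ⟪p.2, normal Ω p.1⟫_ℝ}) := rfl
  rw [hset]
  exact (measurable_fst isClosed_frontier.measurableSet).inter
    ((measurable_snd Measure.isClosed_support.measurableSet).inter
      (measurableSet_lt measurable_const h))

theorem measurableSet_incoming (hΩ : IsOpen Ω) (hC : HasC1Boundary Ω) :
    MeasurableSet (incoming Ω m) := by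
  have := measurable_normal hΩ hC
  have h : Measurable fun p : Space d × Space d => ⟪p.2, normal Ω p.1⟫_ℝ := by fun_prop
  have hset : incoming Ω m = (Prod.fst ⁻¹' frontier Ω) ∩ ((Prod.snd ⁻¹' m.support) ∩
    {p | ⟪p.2, normal Ω p.1⟫_ℝ < 0}) := rfl
  rw [hset]
  exact (measurable_fst isClosed_frontier.measurableSet).inter
    ((measurable_snd Measure.isClosed_support.measurableSet).inter
      (measurableSet_lt h measurable_const))

theorem measurable_fluxDensity (hΩ : IsOpen Ω) (hC : HasC1Boundary Ω) :
    Measurable fun p : Space d × Space d => ENNReal.ofReal |⟪p.2, normal Ω p.1⟫_ℝ| := by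
  have := measurable_normal hΩ hC
  have h : Measurable fun p : Space d × Space d => ⟪p.2, normal Ω p.1⟫_ℝ := by fun_prop
  exact ENNReal.measurable_ofReal.comp (continuous_abs.measurable.comp h)

theorem ae_mem_support (m : Measure (Space d)) : ∀ᵐ v ∂m, v ∈ m.support :=
  Measure.support_mem_ae

section Flux

variable [SFinite m]

theorem sFinite_fluxMeasure (hΩ : IsOpen Ω) (hC : HasC1Boundary Ω) :
    SFinite (fluxMeasure Ω m) := by
  have := sFinite_surfaceMeasure hΩ hC
  unfold fluxMeasure
  infer_instance

/-- The positive part of `v · n` restricts to `Γ₊` by itself: the normal vanishes off the frontier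
and almost every `v` lies in the support of `m`. -/
theorem lintegral_fluxOut (hΩ : IsOpen Ω) (hC : HasC1Boundary Ω) {F : Space d × Space d → ℝ≥0∞}
    (hF : Measurable F) : ∫⁻ p, F p ∂(fluxOut Ω m) =
      ∫⁻ v, ∫⁻ y, ENNReal.ofReal ⟪v, normal Ω y⟫_ℝ * F (y, v) ∂(surfaceMeasure Ω) ∂m := by
  have := sFinite_surfaceMeasure hΩ hC
  have hmO := measurableSet_outgoing (m := m) hΩ hC
  have hD := measurable_fluxDensity hΩ hC
  rw [fluxOut, fluxMeasure, ← lintegral_indicator hmO,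
    lintegral_withDensity_eq_lintegral_mul _ hD (hF.indicator hmO),
    lintegral_prod_symm _ (hD.mul (hF.indicator hmO)).aemeasurable]
  refine lintegral_congr_ae ?_
  filter_upwards [ae_mem_support m] with v hv
  refine lintegral_congr fun y => ?_
  rw [Pi.mul_apply]
  by_cases h : (y, v) ∈ outgoing Ω m
  · rw [Set.indicator_of_mem h]
    dsimp only
    rw [abs_of_pos h.2.2]
  · rw [Set.indicator_of_notMem h, mul_zero, ENNReal.ofReal_of_nonpos, zero_mul]
    by_contra hlt
    refine h ⟨?_, hv, not_le.1 hlt⟩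
    by_contra hy
    exact hlt (by rw [normal_eq_zero hy, inner_zero_right])

theorem lintegral_fluxIn (hΩ : IsOpen Ω) (hC : HasC1Boundary Ω) {F : Space d × Space d → ℝ≥0∞}
    (hF : Measurable F) : ∫⁻ p, F p ∂(fluxIn Ω m) =
      ∫⁻ v, ∫⁻ y, ENNReal.ofReal ⟪-v, normal Ω y⟫_ℝ * F (y, v) ∂(surfaceMeasure Ω) ∂m := by
  have := sFinite_surfaceMeasure hΩ hC
  have hmO := measurableSet_incoming (m := m) hΩ hC
  have hD := measurable_fluxDensity hΩ hC
  rw [fluxIn, fluxMeasure, ← lintegral_indicator hmO,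
    lintegral_withDensity_eq_lintegral_mul _ hD (hF.indicator hmO),
    lintegral_prod_symm _ (hD.mul (hF.indicator hmO)).aemeasurable]
  refine lintegral_congr_ae ?_
  filter_upwards [ae_mem_support m] with v hv
  refine lintegral_congr fun y => ?_
  rw [Pi.mul_apply, inner_neg_left]
  by_cases h : (y, v) ∈ incoming Ω m
  · rw [Set.indicator_of_mem h]
    dsimp only
    rw [abs_of_neg h.2.2]
  · rw [Set.indicator_of_notMem h, mul_zero, ENNReal.ofReal_of_nonpos, zero_mul]
    by_contra hlt
    refine h ⟨?_, hv, by simpa using hlt⟩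
    by_contra hy
    exact hlt (by rw [normal_eq_zero hy, inner_zero_right, neg_zero])

theorem lintegral_phaseMeasure {F : Space d × Space d → ℝ≥0∞} (hF : Measurable F) :
    ∫⁻ p, F p ∂(phaseMeasure Ω m) = ∫⁻ v, (∫⁻ x in Ω, F (x, v)) ∂m := by
  rw [phaseMeasure, Measure.restrict_eq_self_of_ae_mem (ae_mem_support m),
    lintegral_prod_symm _ hF.aemeasurable]

end Flux

theorem IsPhaseSpace.ae_ne_zero (h : IsPhaseSpace Ω m) : ∀ᵐ v ∂m, v ≠ 0 := by
  rw [ae_iff]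
  simpa using h.zero_null

/-- The part of the trajectories, parametrized by their exit points, that lies in `Ω`. -/
def flightSet (Ω : Set (Space d)) : Set ((Space d × Space d) × ℝ) :=
  {q | q.2 ∈ Set.Ioo 0 (backTime Ω q.1.1 q.1.2)}

theorem measurable_backTime_fst (hΩ : IsOpen Ω) (hb : Bornology.IsBounded Ω) :
    Measurable fun q : (Space d × Space d) × ℝ => backTime Ω q.1.1 q.1.2 :=
  measurable_backTime_comp hΩ hb (measurable_fst.comp measurable_fst)
    (measurable_snd.comp measurable_fst)

theorem measurableSet_flightSet (hΩ : IsOpen Ω) (hb : Bornology.IsBounded Ω) :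
    MeasurableSet (flightSet Ω) :=
  (measurableSet_lt measurable_const measurable_snd).inter
    (measurableSet_lt measurable_snd (measurable_backTime_fst hΩ hb))

/-- The backward flow from the exit point. -/
def flow (q : (Space d × Space d) × ℝ) : Space d × Space d := (q.1.1 - q.2 • q.1.2, q.1.2)

theorem measurable_flow : Measurable (flow (d := d)) := by
  unfold flow
  fun_prop

/-- The entry point of the trajectory that leaves at `p`. -/
def entry (Ω : Set (Space d)) (p : Space d × Space d) : Space d × Space d :=
  (p.1 - backTime Ω p.1 p.2 • p.2, p.2)

theorem measurable_entry (hΩ : IsOpen Ω) (hb : Bornology.IsBounded Ω) :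
    Measurable (entry Ω) :=
  (measurable_fst.sub ((measurable_backTime hΩ hb).smul measurable_snd)).prodMk measurable_snd

variable [SFinite m]

/-- The formula for one velocity, `lintegral_eq_lintegral_exit`, integrated over `v`. The velocity
`0`, for which it fails, is `m`-null. -/
theorem measurePreserving_flow (h : IsPhaseSpace Ω m) :
    MeasurePreserving flow (((fluxOut Ω m).prod volume).restrict (flightSet Ω))
      (phaseMeasure Ω m) := by
  refine ⟨measurable_flow, ?_⟩
  have := sFinite_fluxMeasure (m := m) h.isOpen h.boundary
  have : SFinite (fluxOut Ω m) := by unfold fluxOut; infer_instance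
  have hfl := measurableSet_flightSet h.isOpen h.isBounded
  ext A hA
  have hA' := measurable_flow hA
  have hI : Measurable ((flow ⁻¹' A ∩ flightSet Ω).indicator (1 : (Space d × Space d) × ℝ → ℝ≥0∞)) :=
    measurable_one.indicator (hA'.inter hfl)
  rw [Measure.map_apply measurable_flow hA, Measure.restrict_apply hA',
    ← lintegral_indicator_one (hA'.inter hfl), lintegral_prod _ hI.aemeasurable,
    lintegral_fluxOut h.isOpen h.boundary hI.lintegral_prod_right', ← lintegral_indicator_one hA,
    lintegral_phaseMeasure (measurable_one.indicator hA)]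
  refine lintegral_congr_ae ?_
  filter_upwards [h.ae_ne_zero] with v hv
  have hg : Measurable fun x => A.indicator (1 : Space d × Space d → ℝ≥0∞) (x, v) :=
    (measurable_one.indicator hA).comp (measurable_id.prodMk measurable_const)
  rw [lintegral_eq_lintegral_exit h.isOpen h.isBounded h.boundary hv hg]
  refine lintegral_congr fun y => ?_
  congr 1
  rw [← lintegral_indicator measurableSet_Ioo]
  refine lintegral_congr fun s => ?_
  by_cases hs : s ∈ Set.Ioo 0 (backTime Ω y v)
  · rw [Set.indicator_of_mem hs]
    by_cases hyA : (y - s • v, v) ∈ A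
    · rw [Set.indicator_of_mem hyA, Set.indicator_of_mem]
      · rfl
      · exact ⟨hyA, hs⟩
    · rw [Set.indicator_of_notMem hyA, Set.indicator_of_notMem]
      exact fun hmem => hyA hmem.1
  · rw [Set.indicator_of_notMem hs, Set.indicator_of_notMem]
    exact fun hmem => hs hmem.2

/-- `lintegral_entry` integrated over the nonzero velocities; it lets emission at `Γ₋` be read as
exit at `Γ₊`. -/
theorem measurePreserving_entry (h : IsPhaseSpace Ω m) :
    MeasurePreserving (entry Ω) (fluxOut Ω m) (fluxIn Ω m) := by
  have hent := measurable_entry h.isOpen h.isBounded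
  refine ⟨hent, ?_⟩
  ext A hA
  have hI : Measurable (A.indicator (1 : Space d × Space d → ℝ≥0∞)) := measurable_one.indicator hA
  rw [Measure.map_apply hent hA, ← lintegral_indicator_one (hent hA),
    lintegral_fluxOut h.isOpen h.boundary (measurable_one.indicator (hent hA)),
    ← lintegral_indicator_one hA, lintegral_fluxIn h.isOpen h.boundary hI]
  refine lintegral_congr_ae ?_
  filter_upwards [h.ae_ne_zero] with v hv
  rw [← lintegral_entry h.isOpen h.isBounded h.boundary hv
    (h := fun z => A.indicator (1 : Space d × Space d → ℝ≥0∞) (z, v)) (hI.comp (measurable_id.prodMk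
      measurable_const))]
  rfl

end DiffuseTransport

end
noncomputable section

namespace DiffuseTransport

variable {d : ℕ} {Ω : Set (Space d)} {m : Measure (Space d)} {κ : Space d → Space d → Space d → ℝ}
variable {𝕜 : Type*} [RCLike 𝕜]

/-! ### The boundary operator -/

theorem measurable_inner_normal (hΩ : IsOpen Ω) (hC : HasC1Boundary Ω) :
    Measurable fun p : Space d × Space d => ⟪p.2, normal Ω p.1⟫_ℝ := by
  have := measurable_normal hΩ hC
  fun_prop

theorem measurableSet_outDirections (x : Space d) :
    MeasurableSet {w | w ∈ m.support ∧ 0 < ⟪w, normal Ω x⟫_ℝ} := by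
  have h : Measurable fun w : Space d => ⟪w, normal Ω x⟫_ℝ := by fun_prop
  exact Measure.isClosed_support.measurableSet.inter (measurableSet_lt measurable_const h)

theorem measurableSet_inDirections (x : Space d) :
    MeasurableSet {w | w ∈ m.support ∧ ⟪w, normal Ω x⟫_ℝ < 0} := by
  have h : Measurable fun w : Space d => ⟪w, normal Ω x⟫_ℝ := by fun_prop
  exact Measure.isClosed_support.measurableSet.inter (measurableSet_lt h measurable_const)

theorem setLIntegral_outDirections (x : Space d) (F : Space d → ℝ≥0∞) :
    ∫⁻ w in {w | w ∈ m.support ∧ 0 < ⟪w, normal Ω x⟫_ℝ},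
      ENNReal.ofReal |⟪w, normal Ω x⟫_ℝ| * F w ∂m =
    ∫⁻ w, ENNReal.ofReal ⟪w, normal Ω x⟫_ℝ * F w ∂m := by
  rw [← lintegral_indicator (measurableSet_outDirections x)]
  refine lintegral_congr_ae ?_
  filter_upwards [ae_mem_support m] with w hw
  by_cases h : 0 < ⟪w, normal Ω x⟫_ℝ
  · rw [Set.indicator_of_mem (show w ∈ {w | w ∈ m.support ∧ 0 < ⟪w, normal Ω x⟫_ℝ} from ⟨hw, h⟩),
      abs_of_pos h]
  · rw [Set.indicator_of_notMem (fun h' => h h'.2), ENNReal.ofReal_of_nonpos (not_lt.1 h), zero_mul]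

theorem setLIntegral_inDirections (x : Space d) (F : Space d → ℝ≥0∞) :
    ∫⁻ w in {w | w ∈ m.support ∧ ⟪w, normal Ω x⟫_ℝ < 0},
      ENNReal.ofReal |⟪w, normal Ω x⟫_ℝ| * F w ∂m =
    ∫⁻ w, ENNReal.ofReal ⟪-w, normal Ω x⟫_ℝ * F w ∂m := by
  rw [← lintegral_indicator (measurableSet_inDirections x)]
  refine lintegral_congr_ae ?_
  filter_upwards [ae_mem_support m] with w hw
  rw [inner_neg_left]
  by_cases h : ⟪w, normal Ω x⟫_ℝ < 0
  · rw [Set.indicator_of_mem (show w ∈ {w | w ∈ m.support ∧ ⟪w, normal Ω x⟫_ℝ < 0} from ⟨hw, h⟩),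
      abs_of_neg h]
  · rw [Set.indicator_of_notMem (fun h' => h h'.2),
      ENNReal.ofReal_of_nonpos (by linarith [not_lt.1 h]), zero_mul]

/-- The integral of the norm of the integrand of the boundary operator. -/
def kernelLIntegral (Ω : Set (Space d)) (m : Measure (Space d))
    (κ : Space d → Space d → Space d → ℝ) (ψ : Space d × Space d → 𝕜) (p : Space d × Space d) :
    ℝ≥0∞ :=
  ∫⁻ w in {w | w ∈ m.support ∧ 0 < ⟪w, normal Ω p.1⟫_ℝ},
    ‖(κ p.1 p.2 w * |⟪w, normal Ω p.1⟫_ℝ|) • ψ (p.1, w)‖ₑ ∂m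

theorem enorm_boundaryOp_le (ψ : Space d × Space d → 𝕜) (p : Space d × Space d) :
    ‖boundaryOp Ω m κ ψ p‖ₑ ≤ kernelLIntegral Ω m κ ψ p :=
  enorm_integral_le_lintegral_enorm _

theorem kernelLIntegral_eq (hκ : IsDiffuseKernel Ω m κ) (ψ : Space d × Space d → 𝕜)
    {p : Space d × Space d} (hp : p ∈ incoming Ω m) :
    kernelLIntegral Ω m κ ψ p =
      ∫⁻ w, ENNReal.ofReal ⟪w, normal Ω p.1⟫_ℝ *
        (ENNReal.ofReal (κ p.1 p.2 w) * ‖ψ (p.1, w)‖ₑ) ∂m := by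
  rw [← setLIntegral_outDirections]
  refine setLIntegral_congr_fun (measurableSet_outDirections _) fun w hw => ?_
  have hnn := hκ.nonneg p.1 p.2 w hp ⟨hp.1, hw⟩
  rw [enorm_smul, Real.enorm_of_nonneg (mul_nonneg hnn (abs_nonneg _)),
    ENNReal.ofReal_mul hnn]
  ring

section Contraction

variable [SFinite m]

theorem lintegral_fluxOut_fst (hΩ : IsOpen Ω) (hC : HasC1Boundary Ω)
    {F : Space d × Space d → ℝ≥0∞} (hF : Measurable F) : ∫⁻ p, F p ∂(fluxOut Ω m) =
      ∫⁻ y, ∫⁻ v, ENNReal.ofReal ⟪v, normal Ω y⟫_ℝ * F (y, v) ∂m ∂(surfaceMeasure Ω) := by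
  have := sFinite_surfaceMeasure hΩ hC
  rw [lintegral_fluxOut hΩ hC hF, lintegral_lintegral_swap]
  have h := ((ENNReal.measurable_ofReal.comp (measurable_inner_normal hΩ hC)).mul hF).comp
    measurable_swap
  exact h.aemeasurable

theorem lintegral_fluxIn_fst (hΩ : IsOpen Ω) (hC : HasC1Boundary Ω)
    {F : Space d × Space d → ℝ≥0∞} (hF : Measurable F) : ∫⁻ p, F p ∂(fluxIn Ω m) =
      ∫⁻ y, ∫⁻ v, ENNReal.ofReal ⟪-v, normal Ω y⟫_ℝ * F (y, v) ∂m ∂(surfaceMeasure Ω) := by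
  have := sFinite_surfaceMeasure hΩ hC
  rw [lintegral_fluxIn hΩ hC hF, lintegral_lintegral_swap]
  have h1 : Measurable fun p : Space d × Space d => ⟪-p.2, normal Ω p.1⟫_ℝ := by
    have := measurable_normal hΩ hC
    fun_prop
  have h := ((ENNReal.measurable_ofReal.comp h1).mul hF).comp measurable_swap
  exact h.aemeasurable

/-- The boundary operator is a contraction from `L¹₊` to `L¹₋`. -/
theorem lintegral_kernelLIntegral_le (hΩ : IsOpen Ω) (hC : HasC1Boundary Ω)
    (hκ : IsDiffuseKernel Ω m κ) {ψ : Space d × Space d → 𝕜} (hψ : StronglyMeasurable ψ) :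
    ∫⁻ p, kernelLIntegral Ω m κ ψ p ∂(fluxIn Ω m) ≤ ∫⁻ p, ‖ψ p‖ₑ ∂(fluxOut Ω m) := by
  have hmn := measurable_normal hΩ hC
  have hmκ : Measurable fun q : (Space d × Space d) × Space d => κ q.1.1 q.1.2 q.2 :=
    hκ.measurable.comp (measurable_fst.fst.prodMk (measurable_fst.snd.prodMk measurable_snd))
  have hn1 : Measurable fun q : (Space d × Space d) × Space d => ⟪q.2, normal Ω q.1.1⟫_ℝ := by
    fun_prop
  have hψm : Measurable fun p => ‖ψ p‖ₑ := hψ.enorm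
  have hint : Measurable fun q : (Space d × Space d) × Space d =>
      ENNReal.ofReal ⟪q.2, normal Ω q.1.1⟫_ℝ *
        (ENNReal.ofReal (κ q.1.1 q.1.2 q.2) * ‖ψ (q.1.1, q.2)‖ₑ) :=
    (ENNReal.measurable_ofReal.comp hn1).mul ((ENNReal.measurable_ofReal.comp hmκ).mul
      (hψm.comp (measurable_fst.fst.prodMk measurable_snd)))
  have hκy : ∀ y : Space d, Measurable fun q : Space d × Space d => κ y q.1 q.2 := fun y =>
    hκ.measurable.comp (measurable_const.prodMk measurable_id)
  have hlast : Measurable fun p : Space d × Space d =>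
      ∫⁻ v, ENNReal.ofReal ⟪-v, normal Ω p.1⟫_ℝ * ENNReal.ofReal (κ p.1 v p.2) ∂m := by
    have h1 : Measurable fun q : (Space d × Space d) × Space d => ⟪-q.2, normal Ω q.1.1⟫_ℝ := by
      fun_prop
    have h2 : Measurable fun q : (Space d × Space d) × Space d => κ q.1.1 q.2 q.1.2 :=
      hκ.measurable.comp (measurable_fst.fst.prodMk (measurable_snd.prodMk measurable_fst.snd))
    exact ((ENNReal.measurable_ofReal.comp h1).mul
      (ENNReal.measurable_ofReal.comp h2)).lintegral_prod_right'
  have hae : ∀ᵐ p ∂(fluxIn Ω m), p ∈ incoming Ω m :=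
    ae_restrict_mem (measurableSet_incoming hΩ hC)
  calc ∫⁻ p, kernelLIntegral Ω m κ ψ p ∂(fluxIn Ω m)
      = ∫⁻ p, ∫⁻ w, ENNReal.ofReal ⟪w, normal Ω p.1⟫_ℝ *
        (ENNReal.ofReal (κ p.1 p.2 w) * ‖ψ (p.1, w)‖ₑ) ∂m ∂(fluxIn Ω m) := by
        refine lintegral_congr_ae ?_
        filter_upwards [hae] with p hp
        exact kernelLIntegral_eq hκ ψ hp
    _ = ∫⁻ y, ∫⁻ v, ENNReal.ofReal ⟪-v, normal Ω y⟫_ℝ *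
        (∫⁻ w, ENNReal.ofReal ⟪w, normal Ω y⟫_ℝ *
        (ENNReal.ofReal (κ y v w) * ‖ψ (y, w)‖ₑ) ∂m) ∂m ∂(surfaceMeasure Ω) :=
        lintegral_fluxIn_fst hΩ hC hint.lintegral_prod_right'
    -- Tonelli at a fixed boundary point isolates the integral of `κ` over the emitted velocities,
    -- which the normalization makes equal to `1`.
    _ = ∫⁻ y, ∫⁻ w, ENNReal.ofReal ⟪w, normal Ω y⟫_ℝ * (‖ψ (y, w)‖ₑ *
        ∫⁻ v, ENNReal.ofReal ⟪-v, normal Ω y⟫_ℝ * ENNReal.ofReal (κ y v w) ∂m) ∂m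
          ∂(surfaceMeasure Ω) := by
        refine lintegral_congr fun y => ?_
        have hny : Measurable fun w : Space d => ENNReal.ofReal ⟪w, normal Ω y⟫_ℝ :=
          ENNReal.measurable_ofReal.comp (by fun_prop)
        have hny' : Measurable fun w : Space d => ENNReal.ofReal ⟪-w, normal Ω y⟫_ℝ :=
          ENNReal.measurable_ofReal.comp (by fun_prop)
        have hψy : Measurable fun w : Space d => ‖ψ (y, w)‖ₑ :=
          hψm.comp (measurable_const.prodMk measurable_id)
        have hκ' := ENNReal.measurable_ofReal.comp (hκy y)
        simp_rw [← lintegral_const_mul' _ _ (ENNReal.ofReal_ne_top)]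
        rw [lintegral_lintegral_swap]
        · refine lintegral_congr fun w => ?_
          rw [← lintegral_const_mul' _ _ enorm_ne_top, ← lintegral_const_mul' _ _
            ENNReal.ofReal_ne_top]
          refine lintegral_congr fun v => ?_
          ring
        · exact ((hny'.comp measurable_fst).mul ((hny.comp measurable_snd).mul
            (hκ'.mul (hψy.comp measurable_snd)))).aemeasurable
    _ = ∫⁻ p, ‖ψ p‖ₑ * ∫⁻ v, ENNReal.ofReal ⟪-v, normal Ω p.1⟫_ℝ *
          ENNReal.ofReal (κ p.1 v p.2) ∂m ∂(fluxOut Ω m) :=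
        (lintegral_fluxOut_fst hΩ hC (hψm.mul hlast)).symm
    _ = ∫⁻ p, ‖ψ p‖ₑ ∂(fluxOut Ω m) := by
        refine lintegral_congr_ae ?_
        filter_upwards [hκ.normalized] with p hp
        rw [← setLIntegral_inDirections]
        have : ∀ v, ENNReal.ofReal |⟪v, normal Ω p.1⟫_ℝ| * ENNReal.ofReal (κ p.1 v p.2) =
            ENNReal.ofReal (κ p.1 v p.2 * |⟪v, normal Ω p.1⟫_ℝ|) := fun v => by
          rw [ENNReal.ofReal_mul' (abs_nonneg _), mul_comm]
        simp_rw [this]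
        rw [hp, mul_one]
    _ ≤ _ := le_rfl

end Contraction

/-! ### The boundary operator on time-dependent functions -/

/-- The measure `μ₊ ⊗ dr` on `Γ₊ × (0, ∞)`. -/
def outTime (Ω : Set (Space d)) (m : Measure (Space d)) : Measure ((Space d × Space d) × ℝ) :=
  (fluxOut Ω m).prod (volume.restrict (Set.Ioi 0))

/-- The measure `μ₋ ⊗ dr` on `Γ₋ × (0, ∞)`. -/
def inTime (Ω : Set (Space d)) (m : Measure (Space d)) : Measure ((Space d × Space d) × ℝ) :=
  (fluxIn Ω m).prod (volume.restrict (Set.Ioi 0))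

/-- The boundary operator, acting on time-dependent functions. -/
def boundaryOpTime (Ω : Set (Space d)) (m : Measure (Space d))
    (κ : Space d → Space d → Space d → ℝ) (ψ : (Space d × Space d) × ℝ → 𝕜)
    (q : (Space d × Space d) × ℝ) : 𝕜 :=
  boundaryOp Ω m κ (fun p => ψ (p, q.2)) q.1

/-- The integrand of the boundary operator on time-dependent functions. -/
def kernelIntegrand (Ω : Set (Space d)) (m : Measure (Space d))
    (κ : Space d → Space d → Space d → ℝ) (ψ : (Space d × Space d) × ℝ → 𝕜)
    (z : ((Space d × Space d) × ℝ) × Space d) : 𝕜 :=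
  {z : ((Space d × Space d) × ℝ) × Space d |
    z.2 ∈ m.support ∧ 0 < ⟪z.2, normal Ω z.1.1.1⟫_ℝ}.indicator
    (fun z => (κ z.1.1.1 z.1.1.2 z.2 * |⟪z.2, normal Ω z.1.1.1⟫_ℝ|) • ψ ((z.1.1.1, z.2), z.1.2)) z

theorem stronglyMeasurable_kernelIntegrand (h : IsPhaseSpace Ω m) (hκ : IsDiffuseKernel Ω m κ)
    {ψ : (Space d × Space d) × ℝ → 𝕜} (hψ : StronglyMeasurable ψ) :
    StronglyMeasurable (kernelIntegrand Ω m κ ψ) := by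
  have hmn := measurable_normal h.isOpen h.boundary
  have hn1 : Measurable fun z : ((Space d × Space d) × ℝ) × Space d =>
    ⟪z.2, normal Ω z.1.1.1⟫_ℝ := by fun_prop
  have hset : MeasurableSet {z : ((Space d × Space d) × ℝ) × Space d |
      z.2 ∈ m.support ∧ 0 < ⟪z.2, normal Ω z.1.1.1⟫_ℝ} :=
    (measurable_snd Measure.isClosed_support.measurableSet).inter
      (measurableSet_lt measurable_const hn1)
  have hmκ : Measurable fun z : ((Space d × Space d) × ℝ) × Space d => κ z.1.1.1 z.1.1.2 z.2 :=
    hκ.measurable.comp (measurable_fst.fst.fst.prodMk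
      (measurable_fst.fst.snd.prodMk measurable_snd))
  have hk : Measurable fun z : ((Space d × Space d) × ℝ) × Space d =>
      κ z.1.1.1 z.1.1.2 z.2 * |⟪z.2, normal Ω z.1.1.1⟫_ℝ| :=
    hmκ.mul (continuous_abs.measurable.comp hn1)
  exact (hk.stronglyMeasurable.smul (hψ.comp_measurable
    ((measurable_fst.fst.fst.prodMk measurable_snd).prodMk measurable_fst.snd))).indicator hset

theorem kernelIntegrand_section (ψ : (Space d × Space d) × ℝ → 𝕜) (q : (Space d × Space d) × ℝ) :
    (fun w => kernelIntegrand Ω m κ ψ (q, w)) =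
      {w | w ∈ m.support ∧ 0 < ⟪w, normal Ω q.1.1⟫_ℝ}.indicator
        (fun w => (κ q.1.1 q.1.2 w * |⟪w, normal Ω q.1.1⟫_ℝ|) • ψ ((q.1.1, w), q.2)) := by
  ext w
  rfl

theorem boundaryOpTime_eq_integral (ψ : (Space d × Space d) × ℝ → 𝕜) :
    boundaryOpTime Ω m κ ψ = fun q => ∫ w, kernelIntegrand Ω m κ ψ (q, w) ∂m := by
  ext q
  rw [kernelIntegrand_section, integral_indicator (measurableSet_outDirections _)]
  rfl

theorem kernelLIntegral_eq_lintegral (ψ : (Space d × Space d) × ℝ → 𝕜)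
    (q : (Space d × Space d) × ℝ) :
    kernelLIntegral Ω m κ (fun p => ψ (p, q.2)) q.1 = ∫⁻ w, ‖kernelIntegrand Ω m κ ψ (q, w)‖ₑ ∂m := by
  rw [kernelLIntegral, ← lintegral_indicator (measurableSet_outDirections _)]
  refine lintegral_congr fun w => ?_
  rw [show kernelIntegrand Ω m κ ψ (q, w) = _ from congrFun (kernelIntegrand_section ψ q) w]
  by_cases hw : w ∈ {w | w ∈ m.support ∧ 0 < ⟪w, normal Ω q.1.1⟫_ℝ}
  · rw [Set.indicator_of_mem hw, Set.indicator_of_mem hw]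
  · rw [Set.indicator_of_notMem hw, Set.indicator_of_notMem hw, enorm_zero]

section Time

variable [SFinite m]

theorem sFinite_fluxOut (h : IsPhaseSpace Ω m) : SFinite (fluxOut Ω m) := by
  have := sFinite_fluxMeasure (m := m) h.isOpen h.boundary
  unfold fluxOut
  infer_instance

theorem sFinite_fluxIn (h : IsPhaseSpace Ω m) : SFinite (fluxIn Ω m) := by
  have := sFinite_fluxMeasure (m := m) h.isOpen h.boundary
  unfold fluxIn
  infer_instance

theorem measurePreserving_prod_right_comm {α β γ : Type*} [MeasurableSpace α] [MeasurableSpace β]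
    [MeasurableSpace γ] (μ : Measure α) (ν : Measure β) (ξ : Measure γ) [SFinite μ] [SFinite ν]
    [SFinite ξ] : MeasurePreserving (fun q : (α × γ) × β => ((q.1.1, q.2), q.1.2))
      ((μ.prod ξ).prod ν) ((μ.prod ν).prod ξ) := by
  have h1 := measurePreserving_prodAssoc μ ξ ν
  have h2 := (MeasurePreserving.id μ).prod (Measure.measurePreserving_swap (μ := ξ) (ν := ν))
  have h3 := (measurePreserving_prodAssoc μ ν ξ).symm
  exact h3.comp (h2.comp h1)

/-- The boundary operator integrates over the outgoing directions at one point and one time, with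
respect to `m` and not to `μ₊`. Since `|w · n|` is positive on `Γ₊`, a `μ₊ ⊗ dr`-null set is null in
almost all of these fibres. -/
theorem ae_ae_of_ae_outTime (h : IsPhaseSpace Ω m) {Q : (Space d × Space d) × ℝ → Prop}
    (hQ : ∀ᵐ q ∂(outTime Ω m), Q q) :
    ∀ᵐ z ∂((surfaceMeasure Ω).prod (volume.restrict (Set.Ioi (0 : ℝ)))),
      ∀ᵐ w ∂(m.restrict {w | w ∈ m.support ∧ 0 < ⟪w, normal Ω z.1⟫_ℝ}), Q ((z.1, w), z.2) := by
  have := sFinite_surfaceMeasure h.isOpen h.boundary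
  have hmO := measurableSet_outgoing (m := m) h.isOpen h.boundary
  have hac : ((surfaceMeasure Ω).prod m).restrict (outgoing Ω m) ≪ fluxOut Ω m := by
    rw [fluxOut, fluxMeasure, restrict_withDensity hmO]
    refine withDensity_absolutelyContinuous'
      (measurable_fluxDensity h.isOpen h.boundary).aemeasurable ?_
    filter_upwards [ae_restrict_mem hmO] with p hp
    simpa using hp.2.2.ne'
  have h1 := (hac.prod (Measure.AbsolutelyContinuous.refl
    (volume.restrict (Set.Ioi (0 : ℝ))))).ae_le hQ
  rw [← Measure.restrict_univ (μ := volume.restrict (Set.Ioi (0 : ℝ))), Measure.prod_restrict] at h1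
  have h2 := ae_imp_of_ae_restrict h1
  have h3 := (measurePreserving_prod_right_comm (surfaceMeasure Ω) m
    (volume.restrict (Set.Ioi (0 : ℝ)))).quasiMeasurePreserving.ae h2
  have h4 := Measure.ae_ae_of_ae_prod h3
  filter_upwards [h4] with z hz
  rw [ae_restrict_iff' (measurableSet_outDirections _)]
  filter_upwards [hz] with w hw hmem
  refine hw ⟨⟨?_, hmem⟩, trivial⟩
  by_contra hy
  have := hmem.2
  rw [normal_eq_zero hy, inner_zero_right] at this
  exact lt_irrefl _ this

theorem ae_inTime_of_ae (h : IsPhaseSpace Ω m) {Q : Space d × ℝ → Prop}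
    (hQ : ∀ᵐ z ∂((surfaceMeasure Ω).prod (volume.restrict (Set.Ioi (0 : ℝ)))), Q z) :
    ∀ᵐ q ∂(inTime Ω m), Q (q.1.1, q.2) := by
  have := sFinite_surfaceMeasure h.isOpen h.boundary
  have hac : fluxIn Ω m ≪ (surfaceMeasure Ω).prod m :=
    Measure.restrict_le_self.absolutelyContinuous.trans (withDensity_absolutelyContinuous _ _)
  refine (hac.prod (Measure.AbsolutelyContinuous.refl
    (volume.restrict (Set.Ioi (0 : ℝ))))).ae_le ?_
  have h1 := (Measure.quasiMeasurePreserving_fst (μ := (surfaceMeasure Ω).prod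
    (volume.restrict (Set.Ioi (0 : ℝ)))) (ν := m)).ae hQ
  exact (measurePreserving_prod_right_comm (surfaceMeasure Ω)
    (volume.restrict (Set.Ioi (0 : ℝ))) m).quasiMeasurePreserving.ae h1

/-- Allows `H` to act on traces that are known only almost everywhere in boundary point and time. -/
theorem boundaryOpTime_congr (h : IsPhaseSpace Ω m) {ψ ψ' : (Space d × Space d) × ℝ → 𝕜}
    (hψ : ψ =ᵐ[outTime Ω m] ψ') :
    boundaryOpTime Ω m κ ψ =ᵐ[inTime Ω m] boundaryOpTime Ω m κ ψ' := by
  filter_upwards [ae_inTime_of_ae h (ae_ae_of_ae_outTime h hψ)] with q hq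
  refine integral_congr_ae ?_
  filter_upwards [hq] with w hw
  rw [hw]

theorem kernelLIntegral_congr (h : IsPhaseSpace Ω m) {ψ ψ' : (Space d × Space d) × ℝ → 𝕜}
    (hψ : ψ =ᵐ[outTime Ω m] ψ') :
    ∀ᵐ q ∂(inTime Ω m), kernelLIntegral Ω m κ (fun p => ψ (p, q.2)) q.1 =
      kernelLIntegral Ω m κ (fun p => ψ' (p, q.2)) q.1 := by
  filter_upwards [ae_inTime_of_ae h (ae_ae_of_ae_outTime h hψ)] with q hq
  refine lintegral_congr_ae ?_
  filter_upwards [hq] with w hw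
  rw [hw]

theorem stronglyMeasurable_boundaryOpTime (h : IsPhaseSpace Ω m) (hκ : IsDiffuseKernel Ω m κ)
    {ψ : (Space d × Space d) × ℝ → 𝕜} (hψ : StronglyMeasurable ψ) :
    StronglyMeasurable (boundaryOpTime Ω m κ ψ) := by
  rw [boundaryOpTime_eq_integral]
  exact (stronglyMeasurable_kernelIntegrand h hκ hψ).integral_prod_right'

theorem measurable_kernelLIntegral (h : IsPhaseSpace Ω m) (hκ : IsDiffuseKernel Ω m κ)
    {ψ : (Space d × Space d) × ℝ → 𝕜} (hψ : StronglyMeasurable ψ) :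
    Measurable fun q : (Space d × Space d) × ℝ =>
      kernelLIntegral Ω m κ (fun p => ψ (p, q.2)) q.1 := by
  simp_rw [kernelLIntegral_eq_lintegral]
  exact (stronglyMeasurable_kernelIntegrand h hκ hψ).enorm.lintegral_prod_right'

theorem aestronglyMeasurable_boundaryOpTime (h : IsPhaseSpace Ω m) (hκ : IsDiffuseKernel Ω m κ)
    {ψ : (Space d × Space d) × ℝ → 𝕜} (hψ : AEStronglyMeasurable ψ (outTime Ω m)) :
    AEStronglyMeasurable (boundaryOpTime Ω m κ ψ) (inTime Ω m) :=
  ⟨_, stronglyMeasurable_boundaryOpTime h hκ hψ.stronglyMeasurable_mk,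
    boundaryOpTime_congr h hψ.ae_eq_mk⟩

/-- `H` acts at each instant separately, so a weight depending only on time passes through the
contraction estimate. -/
theorem lintegral_kernelLIntegral_inTime_le (h : IsPhaseSpace Ω m) (hκ : IsDiffuseKernel Ω m κ)
    {ψ : (Space d × Space d) × ℝ → 𝕜} (hψ : AEStronglyMeasurable ψ (outTime Ω m))
    {J : ℝ → ℝ≥0∞} (hJ : Measurable J) :
    ∫⁻ q, J q.2 * kernelLIntegral Ω m κ (fun p => ψ (p, q.2)) q.1 ∂(inTime Ω m) ≤
      ∫⁻ q, J q.2 * ‖ψ q‖ₑ ∂(outTime Ω m) := by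
  have := sFinite_fluxOut h
  have := sFinite_fluxIn h
  set ψ' := hψ.mk ψ
  have hψ' : StronglyMeasurable ψ' := hψ.stronglyMeasurable_mk
  have e1 : ∫⁻ q, J q.2 * kernelLIntegral Ω m κ (fun p => ψ (p, q.2)) q.1 ∂(inTime Ω m) =
      ∫⁻ q, J q.2 * kernelLIntegral Ω m κ (fun p => ψ' (p, q.2)) q.1 ∂(inTime Ω m) := by
    refine lintegral_congr_ae ?_
    filter_upwards [kernelLIntegral_congr (κ := κ) h hψ.ae_eq_mk] with q hq
    rw [hq]
  have e2 : ∫⁻ q, J q.2 * ‖ψ q‖ₑ ∂(outTime Ω m) = ∫⁻ q, J q.2 * ‖ψ' q‖ₑ ∂(outTime Ω m) := by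
    refine lintegral_congr_ae ?_
    filter_upwards [hψ.ae_eq_mk] with q hq
    rw [hq]
  have hm1 : Measurable fun q : (Space d × Space d) × ℝ =>
      J q.2 * kernelLIntegral Ω m κ (fun p => ψ' (p, q.2)) q.1 :=
    (hJ.comp measurable_snd).mul (measurable_kernelLIntegral h hκ hψ')
  have hm2 : Measurable fun q => J q.2 * ‖ψ' q‖ₑ := (hJ.comp measurable_snd).mul hψ'.enorm
  rw [e1, e2, inTime, outTime, lintegral_prod_symm _ hm1.aemeasurable,
    lintegral_prod_symm _ hm2.aemeasurable]
  refine lintegral_mono fun r => ?_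
  have hr : StronglyMeasurable fun p => ψ' (p, r) := hψ'.comp_measurable measurable_prodMk_right
  have hkr : Measurable fun p => kernelLIntegral Ω m κ (fun p => ψ' (p, r)) p :=
    Measurable.comp (f := fun p => (p, r)) (g := fun q : (Space d × Space d) × ℝ =>
      kernelLIntegral Ω m κ (fun p => ψ' (p, q.2)) q.1) (measurable_kernelLIntegral h hκ hψ')
      measurable_prodMk_right
  calc ∫⁻ p, J r * kernelLIntegral Ω m κ (fun p => ψ' (p, r)) p ∂(fluxIn Ω m)
      = J r * ∫⁻ p, kernelLIntegral Ω m κ (fun p => ψ' (p, r)) p ∂(fluxIn Ω m) :=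
        lintegral_const_mul _ hkr
    _ ≤ J r * ∫⁻ p, ‖ψ' (p, r)‖ₑ ∂(fluxOut Ω m) :=
        mul_le_mul' le_rfl (lintegral_kernelLIntegral_le h.isOpen h.boundary hκ hr)
    _ = _ := (lintegral_const_mul _ hr.enorm).symm

theorem lintegral_boundaryOpTime_le (h : IsPhaseSpace Ω m) (hκ : IsDiffuseKernel Ω m κ)
    {ψ : (Space d × Space d) × ℝ → 𝕜} (hψ : AEStronglyMeasurable ψ (outTime Ω m))
    {J : ℝ → ℝ≥0∞} (hJ : Measurable J) :
    ∫⁻ q, J q.2 * ‖boundaryOpTime Ω m κ ψ q‖ₑ ∂(inTime Ω m) ≤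
      ∫⁻ q, J q.2 * ‖ψ q‖ₑ ∂(outTime Ω m) :=
  (lintegral_mono fun q => by gcongr; exact enorm_boundaryOp_le _ _).trans
    (lintegral_kernelLIntegral_inTime_le h hκ hψ hJ)

theorem integrable_boundaryOpTime (h : IsPhaseSpace Ω m) (hκ : IsDiffuseKernel Ω m κ)
    {ψ : (Space d × Space d) × ℝ → 𝕜} (hψ : Integrable ψ (outTime Ω m)) :
    Integrable (boundaryOpTime Ω m κ ψ) (inTime Ω m) := by
  refine ⟨aestronglyMeasurable_boundaryOpTime h hκ hψ.1, ?_⟩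
  have := lintegral_boundaryOpTime_le h hκ hψ.1 (J := 1) measurable_one
  simp only [Pi.one_apply, one_mul] at this
  exact this.trans_lt hψ.2

/-- The boundary operator maps into the weighted space, uniformly in time. -/
theorem lintegral_weight_boundaryOpTime_le (h : IsPhaseSpace Ω m) (hκ : IsDiffuseKernel Ω m κ)
    {s : ℕ} {C : ℝ≥0} (hC : ∀ ψ : Space d × Space d → 𝕜, Integrable ψ (fluxOut Ω m) →
      ∫⁻ p, ENNReal.ofReal (weight s p.2) * ‖boundaryOp Ω m κ ψ p‖ₑ ∂(fluxIn Ω m)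
        ≤ C * ∫⁻ p, ‖ψ p‖ₑ ∂(fluxOut Ω m))
    {ψ : (Space d × Space d) × ℝ → 𝕜} (hψ : Integrable ψ (outTime Ω m)) :
    ∫⁻ q, ENNReal.ofReal (weight s q.1.2) * ‖boundaryOpTime Ω m κ ψ q‖ₑ ∂(inTime Ω m) ≤
      C * ∫⁻ q, ‖ψ q‖ₑ ∂(outTime Ω m) := by
  have := sFinite_fluxOut h
  have := sFinite_fluxIn h
  set ψ' := hψ.1.mk ψ
  have hψ' : StronglyMeasurable ψ' := hψ.1.stronglyMeasurable_mk
  have hint : Integrable ψ' (outTime Ω m) := hψ.congr hψ.1.ae_eq_mk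
  have e1 : ∫⁻ q, ENNReal.ofReal (weight s q.1.2) * ‖boundaryOpTime Ω m κ ψ q‖ₑ ∂(inTime Ω m) =
      ∫⁻ q, ENNReal.ofReal (weight s q.1.2) * ‖boundaryOpTime Ω m κ ψ' q‖ₑ ∂(inTime Ω m) := by
    refine lintegral_congr_ae ?_
    filter_upwards [boundaryOpTime_congr (κ := κ) h hψ.1.ae_eq_mk] with q hq
    rw [hq]
  have e2 : ∫⁻ q, ‖ψ q‖ₑ ∂(outTime Ω m) = ∫⁻ q, ‖ψ' q‖ₑ ∂(outTime Ω m) := by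
    refine lintegral_congr_ae ?_
    filter_upwards [hψ.1.ae_eq_mk] with q hq
    rw [hq]
  have hw : Measurable fun q : (Space d × Space d) × ℝ => ENNReal.ofReal (weight s q.1.2) := by
    unfold weight
    fun_prop
  have hm1 : Measurable fun q => ENNReal.ofReal (weight s q.1.2) *
      ‖boundaryOpTime Ω m κ ψ' q‖ₑ :=
    hw.mul (stronglyMeasurable_boundaryOpTime h hκ hψ').enorm
  rw [e1, e2, inTime, outTime, lintegral_prod_symm _ hm1.aemeasurable,
    lintegral_prod_symm _ hψ'.enorm.aemeasurable,
    ← lintegral_const_mul' _ _ ENNReal.coe_ne_top]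
  refine lintegral_mono_ae ?_
  filter_upwards [hint.prod_left_ae] with r hr
  exact hC _ hr

/-- Almost everywhere linearity of the boundary operator. -/
theorem boundaryOpTime_add (h : IsPhaseSpace Ω m) (hκ : IsDiffuseKernel Ω m κ) (a : 𝕜)
    {ψ ψ' : (Space d × Space d) × ℝ → 𝕜} (hψ : Integrable ψ (outTime Ω m))
    (hψ' : Integrable ψ' (outTime Ω m)) :
    boundaryOpTime Ω m κ (fun q => a * ψ q + ψ' q) =ᵐ[inTime Ω m]
      fun q => a * boundaryOpTime Ω m κ ψ q + boundaryOpTime Ω m κ ψ' q := by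
  have := sFinite_fluxIn h
  -- The Bochner integral of a non-integrable function is `0`, so additivity needs integrability of
  -- the integrand at almost every point; it follows from the finiteness of the integral of
  -- `kernelLIntegral`.
  have key : ∀ {ψ : (Space d × Space d) × ℝ → 𝕜}, Integrable ψ (outTime Ω m) →
      ∀ᵐ q ∂(inTime Ω m), Integrable
        (fun w => (κ q.1.1 q.1.2 w * |⟪w, normal Ω q.1.1⟫_ℝ|) • ψ ((q.1.1, w), q.2))
        (m.restrict {w | w ∈ m.support ∧ 0 < ⟪w, normal Ω q.1.1⟫_ℝ}) := by
    intro ψ hψ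
    have hmk : StronglyMeasurable (hψ.1.mk ψ) := hψ.1.stronglyMeasurable_mk
    have hle := lintegral_kernelLIntegral_inTime_le h hκ hmk.aestronglyMeasurable (J := 1)
      measurable_one
    simp only [Pi.one_apply, one_mul] at hle
    have hfin : ∫⁻ q, ‖hψ.1.mk ψ q‖ₑ ∂(outTime Ω m) ≠ ∞ :=
      (hψ.congr hψ.1.ae_eq_mk).2.ne
    have hlt := ae_lt_top (measurable_kernelLIntegral h hκ hmk) (ne_top_of_le_ne_top hfin hle)
    filter_upwards [hlt, ae_inTime_of_ae h (ae_ae_of_ae_outTime h hψ.1.ae_eq_mk)] with q hq hcongr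
    have h1 : Integrable (fun w => kernelIntegrand Ω m κ (hψ.1.mk ψ) (q, w)) m := by
      refine ⟨((stronglyMeasurable_kernelIntegrand h hκ hmk).comp_measurable
        measurable_prodMk_left).aestronglyMeasurable, ?_⟩
      rw [kernelLIntegral_eq_lintegral] at hq
      exact hq
    rw [kernelIntegrand_section, integrable_indicator_iff (measurableSet_outDirections _)] at h1
    refine Integrable.congr h1 ?_
    filter_upwards [hcongr] with w hw
    rw [hw]
  filter_upwards [key hψ, key hψ'] with q h1 h2
  simp only [boundaryOpTime, boundaryOp]
  rw [← integral_const_mul, ← integral_add (h1.const_mul a) h2]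
  refine integral_congr_ae (Eventually.of_forall fun w => ?_)
  simp only [smul_add, mul_smul_comm]

end Time

end DiffuseTransport

end
noncomputable section

namespace DiffuseTransport

/-! ### One-sided Lebesgue points with a parameter -/

section Lebesgue

variable {α F : Type*} [MeasurableSpace α] [NormedAddCommGroup F] [NormedSpace ℝ F]

/-- Convergence along the rationals defines a measurable set of points; continuity in the increment
recovers the full limit. -/
theorem tendsto_of_tendsto_rat {g : ℝ → ℝ} (hg : ContinuousOn g (Set.Ioi 0))
    (h : Tendsto (fun q : ℚ => g q) (comap (fun q : ℚ => (q : ℝ)) (𝓝[>] 0)) (𝓝 0)) :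
    Tendsto g (𝓝[>] 0) (𝓝 0) := by
  rw [Metric.nhds_basis_closedBall.tendsto_right_iff] at h ⊢
  intro ε hε
  obtain ⟨t, ht, hsub⟩ := h ε hε
  obtain ⟨δ, hδ, hδt⟩ := mem_nhdsGT_iff_exists_Ioo_subset.1 ht
  filter_upwards [Ioo_mem_nhdsGT hδ] with x hx
  by_contra hcon
  have hopen : IsOpen (Set.Ioo 0 δ ∩ g ⁻¹' (Metric.closedBall 0 ε)ᶜ) :=
    (hg.mono Set.Ioo_subset_Ioi_self).isOpen_inter_preimage isOpen_Ioo
      Metric.isClosed_closedBall.isOpen_compl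
  obtain ⟨y, hy, q, rfl⟩ := Rat.denseRange_cast.inter_open_nonempty _ hopen ⟨x, hx, hcon⟩
  exact hy.2 (hsub (show (q : ℝ) ∈ t from hδt hy.1))

theorem hasDerivAt_tendsto_average [CompleteSpace F] {g : ℝ → F} (hg : Integrable g) {r : ℝ}
    (h : HasDerivAt (fun x => ∫ t in (0 : ℝ)..x, g t) (g r) r) :
    Tendsto (fun h : ℝ => h⁻¹ • ∫ s in (0 : ℝ)..h, g (r + s)) (𝓝[>] 0) (𝓝 (g r)) := by
  refine h.tendsto_slope_zero_right.congr fun h => ?_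
  rw [intervalIntegral.integral_interval_sub_left hg.intervalIntegrable hg.intervalIntegrable,
    intervalIntegral.integral_comp_add_left (fun x => g x), add_zero]

/-- Almost every point is a right Lebesgue point in the last variable. -/
theorem ae_tendsto_average [CompleteSpace F] (μ : Measure α) [SFinite μ] {ψ Θ : α × ℝ → F}
    (hψ : Integrable ψ (μ.prod (volume.restrict (Set.Ioi 0))))
    (hΘ : Θ =ᵐ[μ.prod (volume.restrict (Set.Ioi 0))] ψ) :
    ∀ᵐ q ∂(μ.prod (volume.restrict (Set.Ioi (0 : ℝ)))),
      Tendsto (fun h : ℝ => h⁻¹ • ∫ s in (0 : ℝ)..h, Θ (q.1, q.2 + s)) (𝓝[>] 0) (𝓝 (ψ q)) := by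
  set S : Set (α × ℝ) := Prod.snd ⁻¹' Set.Ioi 0
  have hS : MeasurableSet S := measurable_snd measurableSet_Ioi
  set g : α × ℝ → F := S.indicator (hψ.1.mk ψ)
  have hg : StronglyMeasurable g := hψ.1.stronglyMeasurable_mk.indicator hS
  have hprod : μ.prod (volume.restrict (Set.Ioi (0 : ℝ))) = (μ.prod volume).restrict S := by
    conv_lhs => rw [← Measure.restrict_univ (μ := μ), Measure.prod_restrict]
    rw [Set.univ_prod]
  have hgint : Integrable g (μ.prod volume) := by
    rw [integrable_indicator_iff hS, IntegrableOn, ← hprod]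
    exact hψ.congr hψ.1.ae_eq_mk
  have hgsec : ∀ᵐ p ∂μ, Integrable (fun r => g (p, r)) := hgint.prod_right_ae
  have hae : ∀ᵐ q ∂(μ.prod (volume.restrict (Set.Ioi (0 : ℝ)))), Θ q = g q ∧ ψ q = g q := by
    have hmem : ∀ᵐ q ∂(μ.prod (volume.restrict (Set.Ioi (0 : ℝ)))), q ∈ S := by
      rw [hprod]; exact ae_restrict_mem hS
    filter_upwards [hΘ, hψ.1.ae_eq_mk, hmem] with q h1 h2 h3
    simp only [g, Set.indicator_of_mem h3]
    exact ⟨h1.trans h2, h2⟩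
  have hae' : ∀ᵐ p ∂μ, ∀ᵐ r ∂(volume.restrict (Set.Ioi (0 : ℝ))), Θ (p, r) = g (p, r) := by
    filter_upwards [Measure.ae_ae_of_ae_prod hae] with p hp
    filter_upwards [hp] with r hr using hr.1
  set A : ℝ → α × ℝ → F := fun h q => h⁻¹ • ∫ s in (0 : ℝ)..h, g (q.1, q.2 + s)
  have hA : ∀ h, StronglyMeasurable (A h) := fun h => by
    have h1 : StronglyMeasurable fun z : (α × ℝ) × ℝ => g (z.1.1, z.1.2 + z.2) :=
      hg.comp_measurable (by fun_prop)
    have h2 : ∀ c d : ℝ, StronglyMeasurable fun q : α × ℝ =>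
        ∫ s in Set.Ioc c d, g (q.1, q.2 + s) := fun c d =>
      h1.integral_prod_right' (ν := volume.restrict (Set.Ioc c d))
    simp only [A, intervalIntegral]
    exact ((h2 0 h).sub (h2 h 0)).const_smul _
  -- The increments are restricted to rationals so that `B` is measurable. It then has full measure
  -- as soon as almost all of its sections do, and these are handled by the one-dimensional
  -- differentiation theorem.
  set B : Set (α × ℝ) := {q | Tendsto (fun h : ℚ => ‖A h q - g q‖)
    (comap (fun h : ℚ => (h : ℝ)) (𝓝[>] 0)) (𝓝 0)}
  have hB : MeasurableSet B :=
    measurableSet_tendsto (𝓝 0) fun h => ((hA h).sub hg).norm.measurable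
  have hBae : ∀ᵐ q ∂(μ.prod (volume : Measure ℝ)), q ∈ B := by
    rw [Measure.ae_prod_mem_iff_ae_ae_mem hB]
    filter_upwards [hgsec] with p hp
    filter_upwards [_root_.LocallyIntegrable.ae_hasDerivAt_integral hp.locallyIntegrable] with r hr
    have h1 := hasDerivAt_tendsto_average hp (hr 0)
    have h2 : Tendsto (fun h : ℝ => ‖A h (p, r) - g (p, r)‖) (𝓝[>] 0) (𝓝 0) :=
      tendsto_iff_norm_sub_tendsto_zero.1 h1
    exact h2.comp tendsto_comap
  have hBae' : ∀ᵐ q ∂(μ.prod (volume.restrict (Set.Ioi (0 : ℝ)))), q ∈ B := by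
    rw [hprod]; exact ae_restrict_of_ae hBae
  have hmem : ∀ᵐ q ∂(μ.prod (volume.restrict (Set.Ioi (0 : ℝ)))), q ∈ S := by
    rw [hprod]; exact ae_restrict_mem hS
  have hsec1 := (Measure.quasiMeasurePreserving_fst (μ := μ)
    (ν := volume.restrict (Set.Ioi (0 : ℝ)))).ae hgsec
  have hsec2 := (Measure.quasiMeasurePreserving_fst (μ := μ)
    (ν := volume.restrict (Set.Ioi (0 : ℝ)))).ae hae'
  filter_upwards [hBae', hmem, hae, hsec1, hsec2] with q hqB hqS hq h1 h2
  have hq0 : 0 < q.2 := hqS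
  have hcont : ContinuousOn (fun h : ℝ => ‖A h q - g q‖) (Set.Ioi 0) := by
    have h3 : Integrable fun s => g (q.1, q.2 + s) := h1.comp_add_left q.2
    have h4 : Continuous fun h : ℝ => ∫ s in (0 : ℝ)..h, g (q.1, q.2 + s) :=
      intervalIntegral.continuous_primitive (fun a b => h3.intervalIntegrable) 0
    refine (((continuousOn_inv₀.mono fun x hx => ?_).smul h4.continuousOn).sub
      continuousOn_const).norm
    exact ne_of_gt hx
  have hlim := tendsto_iff_norm_sub_tendsto_zero.2 (tendsto_of_tendsto_rat hcont hqB)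
  rw [hq.2]
  refine hlim.congr' ?_
  filter_upwards [self_mem_nhdsWithin] with h hh
  have hh0 : (0 : ℝ) < h := hh
  simp only [A]
  congr 1
  -- On almost every trajectory `Θ` agrees with `g` for almost every positive time, so their
  -- averages over `(q.2, q.2 + h)` coincide.
  rw [intervalIntegral.integral_comp_add_left (fun x => g (q.1, x)),
    intervalIntegral.integral_comp_add_left (fun x => Θ (q.1, x))]
  refine intervalIntegral.integral_congr_ae ?_
  rw [ae_restrict_iff' measurableSet_Ioi] at h2
  filter_upwards [h2] with x hx hxm
  rw [Set.uIoc_of_le (by linarith)] at hxm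
  exact (hx (show 0 < x by linarith [hxm.1])).symm

end Lebesgue

end DiffuseTransport

end
noncomputable section

namespace DiffuseTransport

variable {d : ℕ} {Ω : Set (Space d)} {m : Measure (Space d)} {κ : Space d → Space d → Space d → ℝ}
variable {𝕜 : Type*} [RCLike 𝕜]

/-! ### Free flight and re-entry -/

open Classical in
/-- The density of the particles that have not yet met the boundary. -/
def freeFlight (Ω : Set (Space d)) (f : Space d × Space d → 𝕜) (q : (Space d × Space d) × ℝ) : 𝕜 :=
  if q.2 < backTime Ω q.1.1 q.1.2 then f (flow q) else 0

/-- The entry point of the trajectory through `q.1`, and the time of entry for a particle at `q.1`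
at time `q.2`. -/
def entryTime (Ω : Set (Space d)) (q : (Space d × Space d) × ℝ) : (Space d × Space d) × ℝ :=
  (entry Ω q.1, q.2 - backTime Ω q.1.1 q.1.2)

open Classical in
/-- The density of the particles that have been emitted at the boundary with density `g`. -/
def reentry (Ω : Set (Space d)) (g : (Space d × Space d) × ℝ → 𝕜) (q : (Space d × Space d) × ℝ) :
    𝕜 :=
  if backTime Ω q.1.1 q.1.2 < q.2 then g (entryTime Ω q) else 0

/-- The trajectories that have met the boundary before the given time. -/
def reentrySet (Ω : Set (Space d)) : Set ((Space d × Space d) × ℝ) :=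
  {q | backTime Ω q.1.1 q.1.2 < q.2}

theorem freeFlight_of_lt {f : Space d × Space d → 𝕜} {q : (Space d × Space d) × ℝ}
    (h : q.2 < backTime Ω q.1.1 q.1.2) : freeFlight Ω f q = f (flow q) := if_pos h

theorem freeFlight_of_not_lt {f : Space d × Space d → 𝕜} {q : (Space d × Space d) × ℝ}
    (h : ¬ q.2 < backTime Ω q.1.1 q.1.2) : freeFlight Ω f q = 0 := if_neg h

theorem reentry_of_mem {g : (Space d × Space d) × ℝ → 𝕜} {q : (Space d × Space d) × ℝ}
    (h : q ∈ reentrySet Ω) : reentry Ω g q = g (entryTime Ω q) := if_pos h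

theorem reentry_of_notMem {g : (Space d × Space d) × ℝ → 𝕜} {q : (Space d × Space d) × ℝ}
    (h : q ∉ reentrySet Ω) : reentry Ω g q = 0 := if_neg h

theorem flow_flow (p : Space d × Space d) (s t : ℝ) : flow (flow (p, s), t) = flow (p, t + s) := by
  simp only [flow, Prod.mk.injEq, and_true]
  module

theorem backTime_flow {p : Space d × Space d} {s : ℝ} (hs : (p, s) ∈ flightSet Ω) :
    backTime Ω (flow (p, s)).1 (flow (p, s)).2 = backTime Ω p.1 p.2 - s :=
  backTime_sub_smul hs.1 hs.2

/-- Going back along the trajectory by `s` and waiting for a time `s` cancel: the density depends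
only on the exit point and the exit time. -/
theorem freeFlight_flow (f : Space d × Space d → 𝕜) {p : Space d × Space d} {s : ℝ}
    (hs : (p, s) ∈ flightSet Ω) (t : ℝ) :
    freeFlight Ω f (flow (p, s), t) = freeFlight Ω f (p, t + s) := by
  have hb := backTime_flow hs
  by_cases h : t + s < backTime Ω p.1 p.2
  · rw [freeFlight_of_lt (q := (p, t + s)) h, freeFlight_of_lt, flow_flow]
    dsimp only
    rw [hb]; linarith
  · rw [freeFlight_of_not_lt (q := (p, t + s)) h, freeFlight_of_not_lt]
    dsimp only
    rw [hb]
    intro h'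
    exact h (by linarith)

theorem entryTime_flow {p : Space d × Space d} {s : ℝ} (hs : (p, s) ∈ flightSet Ω) (t : ℝ) :
    entryTime Ω (flow (p, s), t) = entryTime Ω (p, t + s) := by
  have hb := backTime_flow hs
  simp only [entryTime, entry, hb, Prod.mk.injEq]
  refine ⟨⟨?_, rfl⟩, by ring⟩
  simp only [flow]
  module

theorem mem_reentrySet_flow {p : Space d × Space d} {s : ℝ} (hs : (p, s) ∈ flightSet Ω) (t : ℝ) :
    (flow (p, s), t) ∈ reentrySet Ω ↔ (p, t + s) ∈ reentrySet Ω := by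
  change backTime Ω (flow (p, s)).1 (flow (p, s)).2 < t ↔ backTime Ω p.1 p.2 < t + s
  rw [backTime_flow hs, sub_lt_iff_lt_add]

theorem reentry_flow (g : (Space d × Space d) × ℝ → 𝕜) {p : Space d × Space d} {s : ℝ}
    (hs : (p, s) ∈ flightSet Ω) (t : ℝ) :
    reentry Ω g (flow (p, s), t) = reentry Ω g (p, t + s) := by
  by_cases h : (p, t + s) ∈ reentrySet Ω
  · rw [reentry_of_mem h, reentry_of_mem ((mem_reentrySet_flow hs t).2 h), entryTime_flow hs]
  · rw [reentry_of_notMem h, reentry_of_notMem (mt (mem_reentrySet_flow hs t).1 h)]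

section Measurability

theorem measurable_entryTime (h : IsPhaseSpace Ω m) : Measurable (entryTime Ω) :=
  ((measurable_entry h.isOpen h.isBounded).comp measurable_fst).prodMk
    (measurable_snd.sub (measurable_backTime_fst h.isOpen h.isBounded))

theorem measurableSet_reentrySet (h : IsPhaseSpace Ω m) : MeasurableSet (reentrySet Ω) :=
  measurableSet_lt (measurable_backTime_fst h.isOpen h.isBounded) measurable_snd

theorem measurableSet_lt_backTime (h : IsPhaseSpace Ω m) (t : ℝ) :
    MeasurableSet {p : Space d × Space d | t < backTime Ω p.1 p.2} :=
  measurableSet_lt measurable_const (measurable_backTime h.isOpen h.isBounded)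

theorem measurableSet_backTime_lt (h : IsPhaseSpace Ω m) (t : ℝ) :
    MeasurableSet {p : Space d × Space d | backTime Ω p.1 p.2 < t} :=
  measurableSet_lt (measurable_backTime h.isOpen h.isBounded) measurable_const

theorem flightSet_subset : flightSet Ω ⊆ Prod.snd ⁻¹' Set.Ioi (0 : ℝ) := fun _ hq => hq.1

theorem reentrySet_subset : reentrySet Ω ⊆ Prod.snd ⁻¹' Set.Ioi (0 : ℝ) := fun q hq =>
  lt_of_le_of_lt (backTime_nonneg q.1.1 q.1.2) hq

variable [SFinite m]

theorem prod_restrict_Ioi {α : Type*} [MeasurableSpace α] (μ : Measure α) [SFinite μ] :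
    μ.prod (volume.restrict (Set.Ioi (0 : ℝ))) =
      (μ.prod volume).restrict (Prod.snd ⁻¹' Set.Ioi (0 : ℝ)) := by
  conv_lhs => rw [← Measure.restrict_univ (μ := μ), Measure.prod_restrict]
  rw [Set.univ_prod]

theorem outTime_restrict (h : IsPhaseSpace Ω m) {A : Set ((Space d × Space d) × ℝ)}
    (hA : MeasurableSet A) (hsub : A ⊆ Prod.snd ⁻¹' Set.Ioi (0 : ℝ)) :
    (outTime Ω m).restrict A = ((fluxOut Ω m).prod volume).restrict A := by
  have := sFinite_fluxOut h
  rw [outTime, prod_restrict_Ioi, Measure.restrict_restrict hA, Set.inter_eq_left.2 hsub]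

theorem measurePreserving_flow_outTime (h : IsPhaseSpace Ω m) :
    MeasurePreserving flow ((outTime Ω m).restrict (flightSet Ω)) (phaseMeasure Ω m) := by
  rw [outTime_restrict h (measurableSet_flightSet h.isOpen h.isBounded) flightSet_subset]
  exact measurePreserving_flow h

/-- A skew product: the entry map preserves flux, and along each trajectory the exit time is
translated by the duration of the chord. -/
theorem measurePreserving_entryTime (h : IsPhaseSpace Ω m) :
    MeasurePreserving (entryTime Ω) ((outTime Ω m).restrict (reentrySet Ω)) (inTime Ω m) := by
  have := sFinite_fluxOut h
  have := sFinite_fluxIn h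
  have h1 := (measurePreserving_entry h).skew_product
    (g := fun (p : Space d × Space d) (r : ℝ) => r - backTime Ω p.1 p.2) (μc := volume)
    (μd := volume) (measurable_snd.sub (measurable_backTime_fst h.isOpen h.isBounded))
    (Eventually.of_forall fun p => map_sub_right_eq_self volume _)
  have h2 := h1.restrict_preimage (s := Prod.snd ⁻¹' Set.Ioi (0 : ℝ))
    (measurable_snd measurableSet_Ioi)
  rw [outTime_restrict h (measurableSet_reentrySet h) reentrySet_subset, inTime,
    prod_restrict_Ioi]
  have hset : reentrySet Ω = (fun q : (Space d × Space d) × ℝ =>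
      (entry Ω q.1, q.2 - backTime Ω q.1.1 q.1.2)) ⁻¹' (Prod.snd ⁻¹' Set.Ioi (0 : ℝ)) := by
    ext q
    change backTime Ω q.1.1 q.1.2 < q.2 ↔ 0 < q.2 - backTime Ω q.1.1 q.1.2
    rw [sub_pos]
  rw [hset]
  exact h2

/-- Shift of the time variable. -/
theorem measurePreserving_shift (h : IsPhaseSpace Ω m) (t : ℝ) :
    MeasurePreserving (fun q : (Space d × Space d) × ℝ => (q.1, t + q.2))
      ((fluxOut Ω m).prod volume) ((fluxOut Ω m).prod volume) := by
  have := sFinite_fluxOut h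
  exact (MeasurePreserving.id _).prod (measurePreserving_add_left volume t)

/-- In exit coordinates the flow for time `t` is a translation of the time variable, which preserves
`μ₊ ⊗ ds`. Null sets are thereby controlled at every fixed `t`, not merely at almost every one. -/
theorem quasiMeasurePreserving_flow (h : IsPhaseSpace Ω m) {t : ℝ} (ht : 0 ≤ t) :
    Measure.QuasiMeasurePreserving (fun p : Space d × Space d => flow (p, t))
      ((phaseMeasure Ω m).restrict {p | t < backTime Ω p.1 p.2}) (phaseMeasure Ω m) := by
  have hmf : Measurable fun p : Space d × Space d => flow (p, t) :=
    measurable_flow.comp (measurable_id.prodMk measurable_const)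
  refine ⟨hmf, Measure.AbsolutelyContinuous.mk fun N hN hN0 => ?_⟩
  have hfl := measurableSet_flightSet h.isOpen h.isBounded
  have hA := (hmf hN).inter (measurableSet_lt_backTime h t)
  rw [Measure.map_apply hmf hN, Measure.restrict_apply (hmf hN),
    ← (measurePreserving_flow h).measure_preimage hA.nullMeasurableSet,
    Measure.restrict_apply (measurable_flow hA)]
  have hnull : ((fluxOut Ω m).prod volume) (flow ⁻¹' N ∩ flightSet Ω) = 0 := by
    rw [← Measure.restrict_apply (measurable_flow hN),
      (measurePreserving_flow h).measure_preimage hN.nullMeasurableSet, hN0]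
  have hnull' := (measurePreserving_shift h t).measure_preimage
    ((measurable_flow hN).inter hfl).nullMeasurableSet
  rw [hnull] at hnull'
  refine measure_mono_null ?_ hnull'
  rintro ⟨p, s⟩ ⟨⟨h1, h2⟩, h3⟩
  have h2' : t < backTime Ω (flow (p, s)).1 (flow (p, s)).2 := h2
  rw [backTime_flow h3] at h2'
  refine ⟨?_, ⟨?_, ?_⟩⟩
  · have h1' : flow (flow (p, s), t) ∈ N := h1
    rwa [flow_flow] at h1'
  · have := h3.1
    change 0 < t + s
    change 0 < s at this
    linarith
  · change t + s < backTime Ω p.1 p.2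
    linarith

/-- The same lift to exit coordinates: the entry time seen from a point `s` before its exit at time
`t` is the one attached to exit time `t + s`. -/
theorem quasiMeasurePreserving_entryTime (h : IsPhaseSpace Ω m) (t : ℝ) :
    Measure.QuasiMeasurePreserving (fun p : Space d × Space d => entryTime Ω (p, t))
      ((phaseMeasure Ω m).restrict {p | backTime Ω p.1 p.2 < t}) (inTime Ω m) := by
  have hmf : Measurable fun p : Space d × Space d => entryTime Ω (p, t) :=
    (measurable_entryTime h).comp (measurable_id.prodMk measurable_const)
  refine ⟨hmf, Measure.AbsolutelyContinuous.mk fun N hN hN0 => ?_⟩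
  have hre := measurableSet_reentrySet h
  have hA := (hmf hN).inter (measurableSet_backTime_lt h t)
  rw [Measure.map_apply hmf hN, Measure.restrict_apply (hmf hN),
    ← (measurePreserving_flow h).measure_preimage hA.nullMeasurableSet,
    Measure.restrict_apply (measurable_flow hA)]
  have hmp := measurePreserving_entryTime h
  rw [outTime_restrict h hre reentrySet_subset] at hmp
  have hnull : ((fluxOut Ω m).prod volume) (entryTime Ω ⁻¹' N ∩ reentrySet Ω) = 0 := by
    rw [← Measure.restrict_apply (measurable_entryTime h hN),
      hmp.measure_preimage hN.nullMeasurableSet, hN0]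
  have hnull' := (measurePreserving_shift h t).measure_preimage
    ((measurable_entryTime h hN).inter hre).nullMeasurableSet
  rw [hnull] at hnull'
  refine measure_mono_null ?_ hnull'
  rintro ⟨p, s⟩ ⟨⟨h1, h2⟩, h3⟩
  refine ⟨?_, (mem_reentrySet_flow h3 t).1 h2⟩
  have h1' : entryTime Ω (flow (p, s), t) ∈ N := h1
  rwa [entryTime_flow h3] at h1'

theorem ae_outTime_pos (h : IsPhaseSpace Ω m) : ∀ᵐ q ∂(outTime Ω m), 0 < q.2 := by
  have := sFinite_fluxOut h
  rw [outTime, prod_restrict_Ioi]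
  exact ae_restrict_mem (measurable_snd measurableSet_Ioi)

/-! Almost everywhere equality. -/

theorem freeFlight_congr_outTime (h : IsPhaseSpace Ω m) {f f' : Space d × Space d → 𝕜}
    (hf : f =ᵐ[phaseMeasure Ω m] f') : freeFlight Ω f =ᵐ[outTime Ω m] freeFlight Ω f' := by
  have h1 := ae_imp_of_ae_restrict
    ((measurePreserving_flow_outTime h).quasiMeasurePreserving.ae hf)
  filter_upwards [h1, ae_outTime_pos h] with q hq hpos
  by_cases hlt : q.2 < backTime Ω q.1.1 q.1.2
  · rw [freeFlight_of_lt hlt, freeFlight_of_lt hlt]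
    exact hq ⟨hpos, hlt⟩
  · rw [freeFlight_of_not_lt hlt, freeFlight_of_not_lt hlt]

theorem freeFlight_congr_phase (h : IsPhaseSpace Ω m) {f f' : Space d × Space d → 𝕜}
    (hf : f =ᵐ[phaseMeasure Ω m] f') {t : ℝ} (ht : 0 ≤ t) :
    (fun p => freeFlight Ω f (p, t)) =ᵐ[phaseMeasure Ω m] fun p => freeFlight Ω f' (p, t) := by
  filter_upwards [ae_imp_of_ae_restrict ((quasiMeasurePreserving_flow h ht).ae hf)] with p hp
  by_cases hlt : t < backTime Ω p.1 p.2
  · rw [freeFlight_of_lt (q := (p, t)) hlt, freeFlight_of_lt (q := (p, t)) hlt]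
    exact hp hlt
  · rw [freeFlight_of_not_lt (q := (p, t)) hlt, freeFlight_of_not_lt (q := (p, t)) hlt]

theorem reentry_congr_outTime (h : IsPhaseSpace Ω m) {g g' : (Space d × Space d) × ℝ → 𝕜}
    (hg : g =ᵐ[inTime Ω m] g') : reentry Ω g =ᵐ[outTime Ω m] reentry Ω g' := by
  filter_upwards [ae_imp_of_ae_restrict
    ((measurePreserving_entryTime h).quasiMeasurePreserving.ae hg)] with q hq
  by_cases hmem : q ∈ reentrySet Ω
  · rw [reentry_of_mem hmem, reentry_of_mem hmem]
    exact hq hmem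
  · rw [reentry_of_notMem hmem, reentry_of_notMem hmem]

theorem reentry_congr_phase (h : IsPhaseSpace Ω m) {g g' : (Space d × Space d) × ℝ → 𝕜}
    (hg : g =ᵐ[inTime Ω m] g') (t : ℝ) :
    (fun p => reentry Ω g (p, t)) =ᵐ[phaseMeasure Ω m] fun p => reentry Ω g' (p, t) := by
  filter_upwards [ae_imp_of_ae_restrict ((quasiMeasurePreserving_entryTime h t).ae hg)] with p hp
  by_cases hmem : (p, t) ∈ reentrySet Ω
  · rw [reentry_of_mem hmem, reentry_of_mem hmem]
    exact hp hmem
  · rw [reentry_of_notMem hmem, reentry_of_notMem hmem]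

/-! Measurability. -/

theorem aestronglyMeasurable_freeFlight_outTime (h : IsPhaseSpace Ω m)
    {f : Space d × Space d → 𝕜} (hf : AEStronglyMeasurable f (phaseMeasure Ω m)) :
    AEStronglyMeasurable (freeFlight Ω f) (outTime Ω m) := by
  have h1 := hf.comp_quasiMeasurePreserving
    (measurePreserving_flow_outTime h).quasiMeasurePreserving
  have h2 := (aestronglyMeasurable_indicator_iff
    (measurableSet_flightSet h.isOpen h.isBounded)).2 h1
  refine h2.congr ?_
  filter_upwards [ae_outTime_pos h] with q hpos
  by_cases hlt : q.2 < backTime Ω q.1.1 q.1.2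
  · rw [freeFlight_of_lt hlt, Set.indicator_of_mem (show q ∈ flightSet Ω from ⟨hpos, hlt⟩)]
    rfl
  · rw [freeFlight_of_not_lt hlt, Set.indicator_of_notMem fun hq => hlt hq.2]

theorem aestronglyMeasurable_freeFlight_phase (h : IsPhaseSpace Ω m)
    {f : Space d × Space d → 𝕜} (hf : AEStronglyMeasurable f (phaseMeasure Ω m)) {t : ℝ}
    (ht : 0 ≤ t) : AEStronglyMeasurable (fun p => freeFlight Ω f (p, t)) (phaseMeasure Ω m) := by
  have h1 := hf.comp_quasiMeasurePreserving (quasiMeasurePreserving_flow h ht)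
  have h2 := (aestronglyMeasurable_indicator_iff (measurableSet_lt_backTime h t)).2 h1
  refine h2.congr (Eventually.of_forall fun p => ?_)
  by_cases hlt : t < backTime Ω p.1 p.2
  · dsimp only
    rw [freeFlight_of_lt (q := (p, t)) hlt,
      Set.indicator_of_mem (show p ∈ {p : Space d × Space d | t < backTime Ω p.1 p.2} from hlt)]
    rfl
  · dsimp only
    rw [freeFlight_of_not_lt (q := (p, t)) hlt, Set.indicator_of_notMem
      (show p ∉ {p : Space d × Space d | t < backTime Ω p.1 p.2} from hlt)]

theorem aestronglyMeasurable_reentry_outTime (h : IsPhaseSpace Ω m)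
    {g : (Space d × Space d) × ℝ → 𝕜} (hg : AEStronglyMeasurable g (inTime Ω m)) :
    AEStronglyMeasurable (reentry Ω g) (outTime Ω m) := by
  have h1 := hg.comp_quasiMeasurePreserving (measurePreserving_entryTime h).quasiMeasurePreserving
  have h2 := (aestronglyMeasurable_indicator_iff (measurableSet_reentrySet h)).2 h1
  refine h2.congr (Eventually.of_forall fun q => ?_)
  by_cases hmem : q ∈ reentrySet Ω
  · rw [reentry_of_mem hmem, Set.indicator_of_mem hmem]
    rfl
  · rw [reentry_of_notMem hmem, Set.indicator_of_notMem hmem]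

theorem aestronglyMeasurable_reentry_phase (h : IsPhaseSpace Ω m)
    {g : (Space d × Space d) × ℝ → 𝕜} (hg : AEStronglyMeasurable g (inTime Ω m)) (t : ℝ) :
    AEStronglyMeasurable (fun p => reentry Ω g (p, t)) (phaseMeasure Ω m) := by
  have h1 := hg.comp_quasiMeasurePreserving (quasiMeasurePreserving_entryTime h t)
  have h2 := (aestronglyMeasurable_indicator_iff (measurableSet_backTime_lt h t)).2 h1
  refine h2.congr (Eventually.of_forall fun p => ?_)
  by_cases hmem : (p, t) ∈ reentrySet Ω
  · dsimp only
    rw [reentry_of_mem hmem,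
      Set.indicator_of_mem (show p ∈ {p : Space d × Space d | backTime Ω p.1 p.2 < t} from hmem)]
    rfl
  · dsimp only
    rw [reentry_of_notMem hmem, Set.indicator_of_notMem
      (show p ∉ {p : Space d × Space d | backTime Ω p.1 p.2 < t} from hmem)]

/-! Integrals. -/

theorem lintegral_outTime_le_phase (h : IsPhaseSpace Ω m)
    {G : (Space d × Space d) × ℝ → ℝ≥0∞} {H : Space d × Space d → ℝ≥0∞}
    (hH : AEMeasurable H (phaseMeasure Ω m)) (hGH : ∀ q ∈ flightSet Ω, G q ≤ H (flow q))
    (hG : ∀ q, ¬ q.2 < backTime Ω q.1.1 q.1.2 → G q = 0) :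
    ∫⁻ q, G q ∂(outTime Ω m) ≤ ∫⁻ p, H p ∂(phaseMeasure Ω m) := by
  have hmp := measurePreserving_flow_outTime h
  have hfl := measurableSet_flightSet h.isOpen h.isBounded
  rw [← hmp.map_eq, lintegral_map' (by rwa [hmp.map_eq]) hmp.measurable.aemeasurable,
    ← lintegral_indicator hfl]
  refine lintegral_mono_ae ?_
  filter_upwards [ae_outTime_pos h] with q hpos
  by_cases hlt : q.2 < backTime Ω q.1.1 q.1.2
  · rw [Set.indicator_of_mem (show q ∈ flightSet Ω from ⟨hpos, hlt⟩)]
    exact hGH q ⟨hpos, hlt⟩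
  · rw [hG q hlt]; simp

theorem lintegral_outTime_le_inTime (h : IsPhaseSpace Ω m)
    {G H : (Space d × Space d) × ℝ → ℝ≥0∞} (hH : AEMeasurable H (inTime Ω m))
    (hGH : ∀ q ∈ reentrySet Ω, G q ≤ H (entryTime Ω q)) (hG : ∀ q ∉ reentrySet Ω, G q = 0) :
    ∫⁻ q, G q ∂(outTime Ω m) ≤ ∫⁻ q, H q ∂(inTime Ω m) := by
  have hmp := measurePreserving_entryTime h
  rw [← hmp.map_eq, lintegral_map' (by rwa [hmp.map_eq]) hmp.measurable.aemeasurable,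
    ← lintegral_indicator (measurableSet_reentrySet h)]
  refine lintegral_mono fun q => ?_
  by_cases hmem : q ∈ reentrySet Ω
  · rw [Set.indicator_of_mem hmem]; exact hGH q hmem
  · rw [hG q hmem]; simp

/-- The mass at time `t` is bounded by the mass that leaves after time `t`. -/
theorem lintegral_phase_le_outTime (h : IsPhaseSpace Ω m) {u : (Space d × Space d) × ℝ → 𝕜}
    {t : ℝ} (ht : 0 ≤ t)
    (hm : AEStronglyMeasurable (fun p => u (p, t)) (phaseMeasure Ω m))
    (hu : ∀ q ∈ flightSet Ω, u (flow q, t) = u (q.1, t + q.2)) :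
    ∫⁻ p, ‖u (p, t)‖ₑ ∂(phaseMeasure Ω m) ≤
      ∫⁻ q, (Set.Ioi t).indicator 1 q.2 * ‖u q‖ₑ ∂(outTime Ω m) := by
  have := sFinite_fluxOut h
  have hmp := measurePreserving_flow h
  have hfl := measurableSet_flightSet h.isOpen h.isBounded
  have hpos : MeasurableSet (Prod.snd ⁻¹' Set.Ioi (0 : ℝ) : Set ((Space d × Space d) × ℝ)) :=
    measurable_snd measurableSet_Ioi
  have hemb : MeasurableEmbedding fun q : (Space d × Space d) × ℝ => (q.1, t + q.2) :=
    (MeasurableEquiv.prodCongr (MeasurableEquiv.refl (Space d × Space d))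
      (MeasurableEquiv.addLeft t)).measurableEmbedding
  have hmeas : AEMeasurable (fun p => ‖u (p, t)‖ₑ)
      (Measure.map flow (((fluxOut Ω m).prod volume).restrict (flightSet Ω))) := by
    rw [hmp.map_eq]; exact hm.enorm
  rw [← hmp.map_eq, lintegral_map' hmeas hmp.measurable.aemeasurable, ← lintegral_indicator hfl,
    outTime, prod_restrict_Ioi, ← lintegral_indicator hpos]
  -- A particle present at time `t` with time `s` left before exit leaves at time `t + s > t`.
  conv_rhs => rw [← (measurePreserving_shift h t).lintegral_comp_emb hemb]
  refine lintegral_mono fun q => ?_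
  by_cases hq : q ∈ flightSet Ω
  · have hq1 : 0 < q.2 := hq.1
    have h1 : ((q.1, t + q.2) : (Space d × Space d) × ℝ) ∈ (Prod.snd ⁻¹' Set.Ioi (0 : ℝ)) := by
      change 0 < t + q.2
      linarith
    have h2 : t + q.2 ∈ Set.Ioi t := by
      change t < t + q.2
      linarith
    rw [Set.indicator_of_mem hq, hu q hq, Set.indicator_of_mem h1]
    dsimp only
    rw [Set.indicator_of_mem h2, Pi.one_apply, one_mul]
  · rw [Set.indicator_of_notMem hq]; exact zero_le

end Measurability

end DiffuseTransport

end
noncomputable section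

namespace DiffuseTransport

variable {d : ℕ} {Ω : Set (Space d)} {m : Measure (Space d)} {κ : Space d → Space d → Space d → ℝ}
variable {𝕜 : Type*} [RCLike 𝕜]

/-! ### The outgoing densities of the Dyson–Phillips iterates -/

/-- The outgoing density, as a function of the trajectory and of time, of the particles that have met
the boundary exactly `n` times. -/
def exitDensity (Ω : Set (Space d)) (m : Measure (Space d)) (κ : Space d → Space d → Space d → ℝ)
    (f : Space d × Space d → 𝕜) : ℕ → (Space d × Space d) × ℝ → 𝕜
  | 0 => freeFlight Ω f
  | n + 1 => reentry Ω (boundaryOpTime Ω m κ (exitDensity Ω m κ f n))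

/-- The trace of the `n`-th iterate, as a function of the boundary point and of time. -/
def exitTrace (Ω : Set (Space d)) (m : Measure (Space d)) (κ : Space d → Space d → Space d → ℝ)
    (f : Space d × Space d → 𝕜) (n : ℕ) (q : (Space d × Space d) × ℝ) : 𝕜 :=
  traceOut (iterate Ω m κ f n q.2) q.1

theorem iterate_zero_eq (f : Space d × Space d → 𝕜) (t : ℝ) (p : Space d × Space d) :
    iterate Ω m κ f 0 t p = freeFlight Ω f (p, t) := by
  simp only [iterate, freeFlight, flow]

theorem iterate_succ_eq (f : Space d × Space d → 𝕜) (n : ℕ) (t : ℝ) (p : Space d × Space d) :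
    iterate Ω m κ f (n + 1) t p = reentry Ω (boundaryOpTime Ω m κ (exitTrace Ω m κ f n)) (p, t) := by
  simp only [iterate, reentry]
  rfl

/-- An exact pointwise identity. It turns the averages over short segments in the definition of the
trace into averages over short time intervals. -/
theorem iterate_flow (f : Space d × Space d → 𝕜) (n : ℕ) {p : Space d × Space d} {s : ℝ}
    (hs : (p, s) ∈ flightSet Ω) (t : ℝ) :
    iterate Ω m κ f n t (flow (p, s)) = iterate Ω m κ f n (t + s) p := by
  cases n with
  | zero => rw [iterate_zero_eq, iterate_zero_eq, freeFlight_flow f hs]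
  | succ n => rw [iterate_succ_eq, iterate_succ_eq, reentry_flow _ hs]

theorem exitDensity_flow (f : Space d × Space d → 𝕜) (n : ℕ) {q : (Space d × Space d) × ℝ}
    (hq : q ∈ flightSet Ω) (t : ℝ) :
    exitDensity Ω m κ f n (flow q, t) = exitDensity Ω m κ f n (q.1, t + q.2) := by
  cases n with
  | zero => exact freeFlight_flow f hq t
  | succ n => exact reentry_flow _ hq t

/-! ### Identification of the iterates and their traces with the transported densities -/

theorem ae_fluxOut_backTime_pos (h : IsPhaseSpace Ω m) :
    ∀ᵐ p ∂(fluxOut Ω m), 0 < backTime Ω p.1 p.2 := by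
  filter_upwards [ae_restrict_mem (measurableSet_outgoing (m := m) h.isOpen h.boundary)] with p hp
  exact backTime_pos_of_inner_pos h.isOpen h.isBounded h.boundary hp.2.2

section SFinite

variable [SFinite m]

theorem integrable_freeFlight (h : IsPhaseSpace Ω m) {f : Space d × Space d → 𝕜}
    (hf : Integrable f (phaseMeasure Ω m)) : Integrable (freeFlight Ω f) (outTime Ω m) := by
  refine ⟨aestronglyMeasurable_freeFlight_outTime h hf.1, lt_of_le_of_lt ?_ hf.2⟩
  refine lintegral_outTime_le_phase h hf.1.enorm (fun q hq => ?_) (fun q hq => ?_)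
  · rw [freeFlight_of_lt hq.2]
  · rw [freeFlight_of_not_lt hq, enorm_zero]

theorem integrable_reentry (h : IsPhaseSpace Ω m) {g : (Space d × Space d) × ℝ → 𝕜}
    (hg : Integrable g (inTime Ω m)) : Integrable (reentry Ω g) (outTime Ω m) := by
  refine ⟨aestronglyMeasurable_reentry_outTime h hg.1, lt_of_le_of_lt ?_ hg.2⟩
  refine lintegral_outTime_le_inTime h hg.1.enorm (fun q hq => ?_) (fun q hq => ?_)
  · rw [reentry_of_mem hq]
  · rw [reentry_of_notMem hq, enorm_zero]

theorem integrable_exitDensity (h : IsPhaseSpace Ω m) (hκ : IsDiffuseKernel Ω m κ)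
    {f : Space d × Space d → 𝕜} (hf : Integrable f (phaseMeasure Ω m)) (n : ℕ) :
    Integrable (exitDensity Ω m κ f n) (outTime Ω m) := by
  induction n with
  | zero => exact integrable_freeFlight h hf
  | succ n ih => exact integrable_reentry h (integrable_boundaryOpTime h hκ ih)

theorem aestronglyMeasurable_exitDensity_section (h : IsPhaseSpace Ω m)
    (hκ : IsDiffuseKernel Ω m κ) {f : Space d × Space d → 𝕜}
    (hf : Integrable f (phaseMeasure Ω m)) (n : ℕ) {t : ℝ} (ht : 0 ≤ t) :
    AEStronglyMeasurable (fun p => exitDensity Ω m κ f n (p, t)) (phaseMeasure Ω m) := by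
  cases n with
  | zero => exact aestronglyMeasurable_freeFlight_phase h hf.1 ht
  | succ n =>
    exact aestronglyMeasurable_reentry_phase h
      (aestronglyMeasurable_boundaryOpTime h hκ (integrable_exitDensity h hκ hf n).1) t

/-- Along the last part of a trajectory the segment average is the average of `r ↦ U_n(r) f` at the
exit point over `(t, t + h)`. It converges at right Lebesgue points, hence almost everywhere. -/
theorem exitTrace_ae_eq (h : IsPhaseSpace Ω m) {f : Space d × Space d → 𝕜} {n : ℕ}
    {ψ : (Space d × Space d) × ℝ → 𝕜} (hψ : Integrable ψ (outTime Ω m))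
    (hit : (fun q => iterate Ω m κ f n q.2 q.1) =ᵐ[outTime Ω m] ψ) :
    exitTrace Ω m κ f n =ᵐ[outTime Ω m] ψ := by
  have := sFinite_fluxOut h
  have hpos : ∀ᵐ q ∂(outTime Ω m), 0 < backTime Ω q.1.1 q.1.2 :=
    Measure.quasiMeasurePreserving_fst.ae (ae_fluxOut_backTime_pos h)
  filter_upwards [ae_tendsto_average (fluxOut Ω m) hψ hit, hpos] with q hq hb
  refine Tendsto.limUnder_eq (hq.congr' ?_)
  filter_upwards [Ioo_mem_nhdsGT hb] with r hr
  congr 1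
  refine intervalIntegral.integral_congr_ae (Eventually.of_forall fun s hs => ?_)
  rw [Set.uIoc_of_le hr.1.le] at hs
  exact (iterate_flow f n (p := q.1) (s := s) ⟨hs.1, hs.2.trans_lt hr.2⟩ q.2).symm

theorem iterate_ae_eq_outTime (h : IsPhaseSpace Ω m) (hκ : IsDiffuseKernel Ω m κ)
    {f : Space d × Space d → 𝕜} (hf : Integrable f (phaseMeasure Ω m)) (n : ℕ) :
    (fun q => iterate Ω m κ f n q.2 q.1) =ᵐ[outTime Ω m] exitDensity Ω m κ f n := by
  induction n with
  | zero => exact Eventually.of_forall fun q => iterate_zero_eq f q.2 q.1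
  | succ n ih =>
    have h1 := exitTrace_ae_eq h (integrable_exitDensity h hκ hf n) ih
    have h2 := reentry_congr_outTime h (boundaryOpTime_congr (κ := κ) h h1)
    exact EventuallyEq.trans (Eventually.of_forall fun q => iterate_succ_eq f n q.2 q.1) h2

/-- At every time the iterates, defined by means of traces, agree with the transported densities. -/
theorem iterate_ae_eq (h : IsPhaseSpace Ω m) (hκ : IsDiffuseKernel Ω m κ)
    {f : Space d × Space d → 𝕜} (hf : Integrable f (phaseMeasure Ω m)) (n : ℕ) (t : ℝ) :
    iterate Ω m κ f n t =ᵐ[phaseMeasure Ω m] fun p => exitDensity Ω m κ f n (p, t) := by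
  cases n with
  | zero => exact Eventually.of_forall fun p => iterate_zero_eq f t p
  | succ n =>
    have h1 := exitTrace_ae_eq h (integrable_exitDensity h hκ hf n)
      (iterate_ae_eq_outTime h hκ hf n)
    have h2 := reentry_congr_phase h (boundaryOpTime_congr (κ := κ) h h1) t
    exact EventuallyEq.trans (Eventually.of_forall fun p => iterate_succ_eq f n t p) h2

theorem freeFlight_linear (a : 𝕜) (f g : Space d × Space d → 𝕜) :
    freeFlight Ω (fun p => a * f p + g p) =
      fun q => a * freeFlight Ω f q + freeFlight Ω g q := by
  ext q
  by_cases hq : q.2 < backTime Ω q.1.1 q.1.2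
  · simp only [freeFlight_of_lt hq]
  · simp only [freeFlight_of_not_lt hq, mul_zero, add_zero]

theorem reentry_linear (a : 𝕜) (f g : (Space d × Space d) × ℝ → 𝕜) :
    reentry Ω (fun p => a * f p + g p) = fun q => a * reentry Ω f q + reentry Ω g q := by
  ext q
  by_cases hq : q ∈ reentrySet Ω
  · simp only [reentry_of_mem hq]
  · simp only [reentry_of_notMem hq, mul_zero, add_zero]

theorem exitDensity_linear (h : IsPhaseSpace Ω m) (hκ : IsDiffuseKernel Ω m κ) (a : 𝕜)
    {u f g : Space d × Space d → 𝕜} (hf : Integrable f (phaseMeasure Ω m))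
    (hg : Integrable g (phaseMeasure Ω m))
    (hu : u =ᵐ[phaseMeasure Ω m] fun p => a * f p + g p) (n : ℕ) :
    exitDensity Ω m κ u n =ᵐ[outTime Ω m]
      fun q => a * exitDensity Ω m κ f n q + exitDensity Ω m κ g n q := by
  induction n with
  | zero =>
    have h1 := freeFlight_congr_outTime h hu
    rwa [freeFlight_linear] at h1
  | succ n ih =>
    have h1 := reentry_congr_outTime h ((boundaryOpTime_congr (κ := κ) h ih).trans
      (boundaryOpTime_add h hκ a (integrable_exitDensity h hκ hf n)
        (integrable_exitDensity h hκ hg n)))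
    rwa [reentry_linear] at h1

theorem exitDensity_section_linear (h : IsPhaseSpace Ω m) (hκ : IsDiffuseKernel Ω m κ) (a : 𝕜)
    {u f g : Space d × Space d → 𝕜} (hf : Integrable f (phaseMeasure Ω m))
    (hg : Integrable g (phaseMeasure Ω m))
    (hu : u =ᵐ[phaseMeasure Ω m] fun p => a * f p + g p) (n : ℕ) {t : ℝ} (ht : 0 ≤ t) :
    (fun p => exitDensity Ω m κ u n (p, t)) =ᵐ[phaseMeasure Ω m]
      fun p => a * exitDensity Ω m κ f n (p, t) + exitDensity Ω m κ g n (p, t) := by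
  cases n with
  | zero =>
    have h1 := freeFlight_congr_phase h hu ht
    rwa [freeFlight_linear] at h1
  | succ n =>
    have h1 := reentry_congr_phase h ((boundaryOpTime_congr (κ := κ) h
      (exitDensity_linear h hκ a hf hg hu n)).trans
      (boundaryOpTime_add h hκ a (integrable_exitDensity h hκ hf n)
        (integrable_exitDensity h hκ hg n))) t
    rwa [reentry_linear] at h1

/-! ### Tail estimates -/

/-- The mass that leaves `Ω` after time `a` and before the next emission. -/
def tailMass (Ω : Set (Space d)) (m : Measure (Space d)) (κ : Space d → Space d → Space d → ℝ)
    (f : Space d × Space d → 𝕜) (n : ℕ) (a : ℝ) : ℝ≥0∞ :=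
  ∫⁻ q, (Set.Ioi a).indicator 1 q.2 * ‖exitDensity Ω m κ f n q‖ₑ ∂(outTime Ω m)

theorem lintegral_exitDensity_section_le (h : IsPhaseSpace Ω m) (hκ : IsDiffuseKernel Ω m κ)
    {f : Space d × Space d → 𝕜} (hf : Integrable f (phaseMeasure Ω m)) (n : ℕ) {t : ℝ}
    (ht : 0 ≤ t) :
    ∫⁻ p, ‖exitDensity Ω m κ f n (p, t)‖ₑ ∂(phaseMeasure Ω m) ≤ tailMass Ω m κ f n t :=
  lintegral_phase_le_outTime h ht (aestronglyMeasurable_exitDensity_section h hκ hf n ht)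
    fun _ hq => exitDensity_flow f n hq t

/-- Transport in either direction does not increase mass, and `H` is a contraction. -/
theorem lintegral_exitDensity_le (h : IsPhaseSpace Ω m) (hκ : IsDiffuseKernel Ω m κ)
    {f : Space d × Space d → 𝕜} (hf : Integrable f (phaseMeasure Ω m)) (n : ℕ) :
    ∫⁻ q, ‖exitDensity Ω m κ f n q‖ₑ ∂(outTime Ω m) ≤ ∫⁻ p, ‖f p‖ₑ ∂(phaseMeasure Ω m) := by
  induction n with
  | zero =>
    refine lintegral_outTime_le_phase h hf.1.enorm (fun q hq => ?_) (fun q hq => ?_)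
    · exact (congrArg _ (freeFlight_of_lt hq.2)).le
    · exact (congrArg _ (freeFlight_of_not_lt hq)).trans enorm_zero
  | succ n ih =>
    have hint := integrable_exitDensity h hκ hf n
    have h1 := lintegral_boundaryOpTime_le h hκ hint.1 (J := 1) measurable_one
    simp only [Pi.one_apply, one_mul] at h1
    refine le_trans ?_ (h1.trans ih)
    refine lintegral_outTime_le_inTime h (aestronglyMeasurable_boundaryOpTime h hκ hint.1).enorm
      (fun q hq => ?_) (fun q hq => ?_)
    · exact (congrArg _ (reentry_of_mem hq)).le
    · exact (congrArg _ (reentry_of_notMem hq)).trans enorm_zero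

theorem tailMass_le (h : IsPhaseSpace Ω m) (hκ : IsDiffuseKernel Ω m κ)
    {f : Space d × Space d → 𝕜} (hf : Integrable f (phaseMeasure Ω m)) (n : ℕ) (a : ℝ) :
    tailMass Ω m κ f n a ≤ ∫⁻ p, ‖f p‖ₑ ∂(phaseMeasure Ω m) := by
  refine (lintegral_mono fun q => ?_).trans (lintegral_exitDensity_le h hκ hf n)
  by_cases hq : q.2 ∈ Set.Ioi a
  · simp [hq]
  · rw [Set.indicator_of_notMem hq, zero_mul]; exact zero_le

end SFinite

/-- Only slow particles have a long time of flight. -/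
theorem one_le_mul_weight (hb : Bornology.IsBounded Ω) {x v : Space d} {τ : ℝ} (hτ : 0 < τ)
    (h : τ ≤ backTime Ω x v) (s : ℕ) : 1 ≤ (Metric.diam Ω / τ) ^ s * weight s v := by
  have hD : 0 ≤ Metric.diam Ω := Metric.diam_nonneg
  have hv : 0 < ‖v‖ := by
    refine norm_pos_iff.2 fun h0 => ?_
    subst h0
    have : backTime Ω x (0 : Space d) ≤ 0 := by
      unfold backTime
      by_cases hx : x ∈ Ω
      · simp [hx]
      · simp only [smul_zero, sub_zero, hx, not_false_eq_true, and_true]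
        exact (csInf_Ioi (a := (0 : ℝ))).le
    linarith
  have h1 : 1 ≤ Metric.diam Ω / τ * ‖v‖⁻¹ := by
    rw [← div_eq_mul_inv, div_div, one_le_div (by positivity)]
    exact (mul_le_mul_of_nonneg_right h hv.le).trans (backTime_mul_norm_le hb x v)
  calc (1 : ℝ) ≤ (Metric.diam Ω / τ * ‖v‖⁻¹) ^ s := one_le_pow₀ h1
    _ = (Metric.diam Ω / τ) ^ s * ‖v‖⁻¹ ^ s := mul_pow _ _ _
    _ ≤ _ := by
      gcongr
      exact le_max_right _ _

theorem one_le_ofReal_mul_weight (hb : Bornology.IsBounded Ω) {x v : Space d} {τ : ℝ} (hτ : 0 < τ)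
    (h : τ ≤ backTime Ω x v) (s : ℕ) :
    1 ≤ ENNReal.ofReal ((Metric.diam Ω / τ) ^ s) * ENNReal.ofReal (weight s v) := by
  have hD : 0 ≤ Metric.diam Ω := Metric.diam_nonneg
  rw [← ENNReal.ofReal_mul (by positivity), ← ENNReal.ofReal_one]
  exact ENNReal.ofReal_le_ofReal (one_le_mul_weight hb hτ h s)

theorem measurable_ofReal_weight (s : ℕ) :
    Measurable fun v : Space d => ENNReal.ofReal (weight s v) := by
  unfold weight
  fun_prop

section TailEstimates

variable [SFinite m]

/-- A particle that first meets the boundary after time `a` travels a chord of duration at least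
`a`, so the weight in `v` pays for the factor `(D / a) ^ s`. -/
theorem tailMass_zero_le (h : IsPhaseSpace Ω m) {f : Space d × Space d → 𝕜}
    (hf : Integrable f (phaseMeasure Ω m)) {a : ℝ} (ha : 0 < a) (s : ℕ) :
    tailMass Ω m κ f 0 a ≤ ENNReal.ofReal ((Metric.diam Ω / a) ^ s) *
      ∫⁻ p, ENNReal.ofReal (weight s p.2) * ‖f p‖ₑ ∂(phaseMeasure Ω m) := by
  rw [← lintegral_const_mul' _ _ ENNReal.ofReal_ne_top]
  refine lintegral_outTime_le_phase h ?_ (fun q hq => ?_) (fun q hq => ?_)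
  · exact (((measurable_ofReal_weight s).comp measurable_snd).aemeasurable.mul
      hf.1.enorm).const_mul _
  · by_cases hqa : q.2 ∈ Set.Ioi a
    · rw [Set.indicator_of_mem hqa, Pi.one_apply, ← mul_assoc,
        show exitDensity Ω m κ f 0 q = f (flow q) from freeFlight_of_lt hq.2]
      gcongr
      exact one_le_ofReal_mul_weight h.isBounded (x := q.1.1) ha (hqa.le.trans hq.2.le) s
    · rw [Set.indicator_of_notMem hqa, zero_mul]; exact zero_le
  · rw [show exitDensity Ω m κ f 0 q = 0 from freeFlight_of_not_lt hq, enorm_zero, mul_zero]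

end TailEstimates

end DiffuseTransport

end
noncomputable section

namespace DiffuseTransport

variable {d : ℕ} {Ω : Set (Space d)} {m : Measure (Space d)} {κ : Space d → Space d → Space d → ℝ}
variable {𝕜 : Type*} [RCLike 𝕜]

/-! ### Weighted norms, tail estimates for all iterates, and the operators -/

theorem lintegral_weight_eq {s : ℕ} {f : X₀ 𝕜 Ω m} (hf : MemX s f) :
    ∫⁻ p, ENNReal.ofReal (weight s p.2) * ‖f p‖ₑ ∂(phaseMeasure Ω m) =
      ENNReal.ofReal (normX s f) := by
  have hw : ∀ v : Space d, 0 ≤ weight s v := fun v => zero_le_one.trans (le_max_left _ _)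
  rw [normX, ofReal_integral_eq_lintegral_ofReal hf
    (Eventually.of_forall fun p => mul_nonneg (hw _) (norm_nonneg _))]
  refine lintegral_congr fun p => ?_
  rw [ENNReal.ofReal_mul (hw _), ofReal_norm]

theorem lintegral_enorm_le_weight (s : ℕ) (f : Space d × Space d → 𝕜) :
    ∫⁻ p, ‖f p‖ₑ ∂(phaseMeasure Ω m) ≤
      ∫⁻ p, ENNReal.ofReal (weight s p.2) * ‖f p‖ₑ ∂(phaseMeasure Ω m) := by
  refine lintegral_mono fun p => le_mul_of_one_le_left zero_le ?_
  rw [← ENNReal.ofReal_one]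
  exact ENNReal.ofReal_le_ofReal (le_max_left _ _)

theorem normX_nonneg (s : ℕ) (f : X₀ 𝕜 Ω m) : 0 ≤ normX s f :=
  integral_nonneg fun _ => mul_nonneg (zero_le_one.trans (le_max_left _ _)) (norm_nonneg _)

section TailEstimates

variable [SFinite m]

/-- A flight after the last emission that is longer than `τ` costs a power of `τ`; otherwise the
emission takes place after time `a - τ`. -/
theorem tailMass_succ_le (h : IsPhaseSpace Ω m) (hκ : IsDiffuseKernel Ω m κ)
    {f : Space d × Space d → 𝕜} (hf : Integrable f (phaseMeasure Ω m)) {s : ℕ} {C : ℝ≥0}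
    (hC : ∀ ψ : Space d × Space d → 𝕜, Integrable ψ (fluxOut Ω m) →
      ∫⁻ p, ENNReal.ofReal (weight s p.2) * ‖boundaryOp Ω m κ ψ p‖ₑ ∂(fluxIn Ω m)
        ≤ C * ∫⁻ p, ‖ψ p‖ₑ ∂(fluxOut Ω m))
    (n : ℕ) {τ : ℝ} (hτ : 0 < τ) (a : ℝ) :
    tailMass Ω m κ f (n + 1) a ≤ ENNReal.ofReal ((Metric.diam Ω / τ) ^ s) *
      (C * ∫⁻ p, ‖f p‖ₑ ∂(phaseMeasure Ω m)) + tailMass Ω m κ f n (a - τ) := by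
  have hint := integrable_exitDensity h hκ hf n
  set g := boundaryOpTime Ω m κ (exitDensity Ω m κ f n) with hg
  have hgm : AEMeasurable (fun q => ‖g q‖ₑ) (inTime Ω m) :=
    (aestronglyMeasurable_boundaryOpTime h hκ hint.1).enorm
  have hJ : Measurable ((Set.Ioi (a - τ)).indicator (1 : ℝ → ℝ≥0∞)) :=
    measurable_one.indicator measurableSet_Ioi
  have hw : AEMeasurable (fun q : (Space d × Space d) × ℝ =>
      ENNReal.ofReal (weight s q.1.2) * ‖g q‖ₑ) (inTime Ω m) :=
    ((measurable_ofReal_weight s).comp measurable_fst.snd).aemeasurable.mul hgm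
  have hj : AEMeasurable (fun q : (Space d × Space d) × ℝ =>
      (Set.Ioi (a - τ)).indicator 1 q.2 * ‖g q‖ₑ) (inTime Ω m) :=
    (hJ.comp measurable_snd).aemeasurable.mul hgm
  have h1 : tailMass Ω m κ f (n + 1) a ≤ ∫⁻ q, (ENNReal.ofReal ((Metric.diam Ω / τ) ^ s) *
      (ENNReal.ofReal (weight s q.1.2) * ‖g q‖ₑ) +
        (Set.Ioi (a - τ)).indicator 1 q.2 * ‖g q‖ₑ) ∂(inTime Ω m) := by
    refine lintegral_outTime_le_inTime h ((hw.const_mul _).add hj) (fun q hq => ?_)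
      (fun q hq => ?_)
    · rw [show exitDensity Ω m κ f (n + 1) q = g (entryTime Ω q) from reentry_of_mem hq]
      by_cases hqa : q.2 ∈ Set.Ioi a
      · rw [Set.indicator_of_mem hqa, Pi.one_apply]
        by_cases hb : τ ≤ backTime Ω q.1.1 q.1.2
        · refine le_trans ?_ le_self_add
          rw [← mul_assoc]
          gcongr
          exact one_le_ofReal_mul_weight h.isBounded hτ hb s
        · have hmem : (entryTime Ω q).2 ∈ Set.Ioi (a - τ) := by
            change a < q.2 at hqa
            change a - τ < q.2 - backTime Ω q.1.1 q.1.2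
            linarith
          rw [Set.indicator_of_mem hmem, Pi.one_apply]
          exact le_add_self
      · rw [Set.indicator_of_notMem hqa, zero_mul]; exact zero_le
    · rw [show exitDensity Ω m κ f (n + 1) q = 0 from reentry_of_notMem hq, enorm_zero, mul_zero]
  refine h1.trans ?_
  rw [lintegral_add_right' _ hj, lintegral_const_mul' _ _ ENNReal.ofReal_ne_top]
  gcongr
  · refine (lintegral_weight_boundaryOpTime_le h hκ hC hint).trans ?_
    gcongr
    exact lintegral_exitDensity_le h hκ hf n
  · exact lintegral_boundaryOpTime_le h hκ hint.1 hJ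

/-- The time `(n + 1) τ` is used up in steps of `τ`, one for each flight. The `n` flights after an
emission cost the same term, given by the gain of `H`; the initial flight is left with time `τ` and
is paid for by the weight of index `k`. -/
theorem tailMass_mul_le (h : IsPhaseSpace Ω m) (hκ : IsDiffuseKernel Ω m κ)
    {f : Space d × Space d → 𝕜} (hf : Integrable f (phaseMeasure Ω m)) {s : ℕ} {C : ℝ≥0}
    (hC : ∀ ψ : Space d × Space d → 𝕜, Integrable ψ (fluxOut Ω m) →
      ∫⁻ p, ENNReal.ofReal (weight s p.2) * ‖boundaryOp Ω m κ ψ p‖ₑ ∂(fluxIn Ω m)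
        ≤ C * ∫⁻ p, ‖ψ p‖ₑ ∂(fluxOut Ω m))
    (k n : ℕ) {τ : ℝ} (hτ : 0 < τ) :
    tailMass Ω m κ f n (((n : ℝ) + 1) * τ) ≤
      n * (ENNReal.ofReal ((Metric.diam Ω / τ) ^ s) * (C * ∫⁻ p, ‖f p‖ₑ ∂(phaseMeasure Ω m))) +
      ENNReal.ofReal ((Metric.diam Ω / τ) ^ k) *
        ∫⁻ p, ENNReal.ofReal (weight k p.2) * ‖f p‖ₑ ∂(phaseMeasure Ω m) := by
  induction n with
  | zero => simpa using tailMass_zero_le (κ := κ) h hf hτ k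
  | succ n ih =>
    refine (tailMass_succ_le h hκ hf hC n hτ _).trans ?_
    rw [show (((n + 1 : ℕ) : ℝ) + 1) * τ - τ = ((n : ℝ) + 1) * τ by push_cast; ring]
    refine (add_le_add_right ih _).trans ?_
    rw [← add_assoc]
    push_cast
    rw [add_mul, one_mul, add_comm (ENNReal.ofReal ((Metric.diam Ω / τ) ^ s) * _)]

/-! ### The operators -/

theorem integrable_exitDensity_section (h : IsPhaseSpace Ω m) (hκ : IsDiffuseKernel Ω m κ)
    {f : Space d × Space d → 𝕜} (hf : Integrable f (phaseMeasure Ω m)) (n : ℕ) {t : ℝ}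
    (ht : 0 ≤ t) : Integrable (fun p => exitDensity Ω m κ f n (p, t)) (phaseMeasure Ω m) :=
  ⟨aestronglyMeasurable_exitDensity_section h hκ hf n ht,
    ((lintegral_exitDensity_section_le h hκ hf n ht).trans (tailMass_le h hκ hf n t)).trans_lt hf.2⟩

/-- The `n`-th Dyson–Phillips iterate at time `t ≥ 0`, as a contraction of `X₀`. -/
def iterateCLM (h : IsPhaseSpace Ω m) (hκ : IsDiffuseKernel Ω m κ) (n : ℕ) {t : ℝ} (ht : 0 ≤ t) :
    X₀ 𝕜 Ω m →L[𝕜] X₀ 𝕜 Ω m :=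
  LinearMap.mkContinuous
    { toFun := fun f => (integrable_exitDensity_section h hκ (L1.integrable_coeFn f) n ht).toL1 _
      map_add' := fun f g => by
        rw [← Integrable.toL1_add, Integrable.toL1_eq_toL1_iff]
        have hu : ⇑(f + g) =ᵐ[phaseMeasure Ω m] fun p => (1 : 𝕜) * f p + g p := by
          filter_upwards [Lp.coeFn_add f g] with p hp
          rw [hp, one_mul]; rfl
        filter_upwards [exitDensity_section_linear h hκ 1 (L1.integrable_coeFn f)
          (L1.integrable_coeFn g) hu n ht] with p hp
        rw [hp, one_mul]; rfl
      map_smul' := fun c f => by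
        rw [RingHom.id_apply, ← Integrable.toL1_smul, Integrable.toL1_eq_toL1_iff]
        have h0 : Integrable (fun _ : Space d × Space d => (0 : 𝕜)) (phaseMeasure Ω m) :=
          integrable_zero _ _ _
        -- Writing `0 = -1 · 0 + 0` shows that the density issued from zero data vanishes almost
        -- everywhere.
        have hz := exitDensity_section_linear h hκ (-1 : 𝕜) h0 h0
          (u := fun _ => 0) (Eventually.of_forall fun p => by simp) n ht
        have hu : ⇑(c • f) =ᵐ[phaseMeasure Ω m] fun p => c * f p + (fun _ => (0 : 𝕜)) p := by
          filter_upwards [Lp.coeFn_smul c f] with p hp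
          rw [hp]; simp
        filter_upwards [hz, exitDensity_section_linear h hκ c (L1.integrable_coeFn f)
          h0 hu n ht] with p hp0 hp
        rw [hp, hp0]
        simp }
    1 fun f => by
      rw [one_mul, ← enorm_le_iff_norm_le]
      refine (Integrable.enorm_toL1
        (integrable_exitDensity_section h hκ (L1.integrable_coeFn f) n ht)).trans_le ?_
      conv_rhs => rw [← Integrable.toL1_coeFn f (L1.integrable_coeFn f), Integrable.enorm_toL1]
      exact (lintegral_exitDensity_section_le h hκ (L1.integrable_coeFn f) n ht).trans
        (tailMass_le h hκ (L1.integrable_coeFn f) n t)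

theorem coeFn_iterateCLM (h : IsPhaseSpace Ω m) (hκ : IsDiffuseKernel Ω m κ) (n : ℕ) {t : ℝ}
    (ht : 0 ≤ t) (f : X₀ 𝕜 Ω m) :
    iterateCLM h hκ n ht f =ᵐ[phaseMeasure Ω m] fun p => exitDensity Ω m κ f n (p, t) :=
  Integrable.coeFn_toL1 (integrable_exitDensity_section h hκ (L1.integrable_coeFn f) n ht)

theorem iterateCLM_toL1 (h : IsPhaseSpace Ω m) (hκ : IsDiffuseKernel Ω m κ) (n : ℕ) {t : ℝ}
    (ht : 0 ≤ t) {f : Space d × Space d → 𝕜} (hf : Integrable f (phaseMeasure Ω m)) :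
    iterateCLM h hκ n ht (hf.toL1 f) =ᵐ[phaseMeasure Ω m] iterate Ω m κ f n t := by
  have h0 : Integrable (fun _ : Space d × Space d => (0 : 𝕜)) (phaseMeasure Ω m) :=
    integrable_zero _ _ _
  -- The chosen representative of the class and `f` itself are both compared with `1 · f + 0`, so
  -- linearity also yields independence of the representative.
  have hu : ⇑(hf.toL1 f) =ᵐ[phaseMeasure Ω m] fun p => (1 : 𝕜) * f p + (fun _ => (0 : 𝕜)) p := by
    filter_upwards [hf.coeFn_toL1] with p hp
    rw [hp]; simp
  have hu' : f =ᵐ[phaseMeasure Ω m] fun p => (1 : 𝕜) * f p + (fun _ => (0 : 𝕜)) p :=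
    Eventually.of_forall fun p => by simp
  filter_upwards [coeFn_iterateCLM h hκ n ht (hf.toL1 f),
    exitDensity_section_linear h hκ 1 hf h0 hu n ht,
    exitDensity_section_linear h hκ 1 hf h0 hu' n ht, iterate_ae_eq h hκ hf n t] with p h1 h2 h3 h4
  rw [h1, h4]
  exact h2.trans h3.symm

theorem norm_iterateCLM_le (h : IsPhaseSpace Ω m) (hκ : IsDiffuseKernel Ω m κ) {s : ℕ} {C : ℝ≥0}
    (hC : ∀ ψ : Space d × Space d → 𝕜, Integrable ψ (fluxOut Ω m) →
      ∫⁻ p, ENNReal.ofReal (weight s p.2) * ‖boundaryOp Ω m κ ψ p‖ₑ ∂(fluxIn Ω m)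
        ≤ C * ∫⁻ p, ‖ψ p‖ₑ ∂(fluxOut Ω m))
    {k : ℕ} {f : X₀ 𝕜 Ω m} (hf : MemX k f) (n : ℕ) {t : ℝ} (ht : 0 < t) :
    ‖iterateCLM h hκ n ht.le f‖ ≤ (n * ((Metric.diam Ω * ((n + 1) / t)) ^ s * C) +
      (Metric.diam Ω * ((n + 1) / t)) ^ k) * normX k f := by
  have hD : 0 ≤ Metric.diam Ω := Metric.diam_nonneg
  have hM := normX_nonneg k f
  have hfi := L1.integrable_coeFn f
  -- The time `t` is shared equally among the `n + 1` flights.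
  have hτ : 0 < t / ((n : ℝ) + 1) := by positivity
  have hb := tailMass_mul_le h hκ hfi hC k n hτ
  rw [mul_div_cancel₀ _ (by positivity : (n : ℝ) + 1 ≠ 0),
    show Metric.diam Ω / (t / ((n : ℝ) + 1)) = Metric.diam Ω * ((n + 1) / t) by field_simp,
    lintegral_weight_eq hf] at hb
  have h1 : ‖iterateCLM h hκ n ht.le f‖ₑ ≤ ENNReal.ofReal
      ((n * ((Metric.diam Ω * ((n + 1) / t)) ^ s * C) +
        (Metric.diam Ω * ((n + 1) / t)) ^ k) * normX k f) := by
    refine (Integrable.enorm_toL1 (integrable_exitDensity_section h hκ hfi n ht.le)).trans_le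
      ((lintegral_exitDensity_section_le h hκ hfi n ht.le).trans (hb.trans ?_))
    rw [add_mul, ENNReal.ofReal_add (by positivity) (by positivity),
      ENNReal.ofReal_mul (by positivity), ENNReal.ofReal_mul (by positivity),
      ENNReal.ofReal_mul (by positivity), ENNReal.ofReal_mul (by positivity),
      ENNReal.ofReal_natCast, ENNReal.ofReal_coe_nnreal, mul_assoc, mul_assoc]
    gcongr
    rw [← lintegral_weight_eq hf]
    exact lintegral_enorm_le_weight k f
  rw [← ofReal_norm] at h1
  exact (ENNReal.ofReal_le_ofReal_iff (by positivity)).1 h1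

end TailEstimates

end DiffuseTransport

end

/-! ### The decay estimates -/

theorem proposition3p7 {d : ℕ} {𝕜 : Type*} [RCLike 𝕜]
    (Ω : Set (DiffuseTransport.Space d)) (m : Measure (DiffuseTransport.Space d)) [SigmaFinite m]
    (hΩ : DiffuseTransport.IsPhaseSpace Ω m)
    (κ : DiffuseTransport.Space d → DiffuseTransport.Space d → DiffuseTransport.Space d → ℝ)
    (hκ : DiffuseTransport.IsDiffuseKernel Ω m κ)
    (hne : (DiffuseTransport.gainSet 𝕜 Ω m κ).Nonempty)
    (hbdd : BddAbove (DiffuseTransport.gainSet 𝕜 Ω m κ)) :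
    ∃ U : ℕ → ℝ → (DiffuseTransport.X₀ 𝕜 Ω m →L[𝕜] DiffuseTransport.X₀ 𝕜 Ω m),
      DiffuseTransport.IsDysonPhillips Ω m κ U ∧
      (∀ k : ℕ, ∃ C : ℝ, 0 < C ∧
        ∀ f : DiffuseTransport.X₀ 𝕜 Ω m, DiffuseTransport.MemX k f → ∀ (n : ℕ) (t : ℝ), 0 < t →
          ‖U n t f‖ ≤ C * (((2 : ℝ) ^ n - 1) *
              (((n : ℝ) + 1) / t) ^ (DiffuseTransport.gainIndex 𝕜 Ω m κ + 1)
            + (((n : ℝ) + 1) / t) ^ k) * DiffuseTransport.normX k f) ∧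
      (∀ n : ℕ, ∃ C : ℝ, 0 < C ∧
        ∀ f : DiffuseTransport.X₀ 𝕜 Ω m,
          DiffuseTransport.MemX (DiffuseTransport.gainIndex 𝕜 Ω m κ + 1) f → ∀ t : ℝ, 0 < t →
          ‖∑ k ∈ Finset.range (n + 1), U k t f‖
            ≤ C * (t ^ (DiffuseTransport.gainIndex 𝕜 Ω m κ + 1))⁻¹ *
              DiffuseTransport.normX (DiffuseTransport.gainIndex 𝕜 Ω m κ + 1) f) := by
  classical
  -- A non-empty bounded set of natural numbers contains its supremum, so `H` does gain the weight
  -- of index `N_H + 1`.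
  obtain ⟨K, hK⟩ : DiffuseTransport.BoundedInto 𝕜 Ω m κ
      (DiffuseTransport.gainIndex 𝕜 Ω m κ + 1) := Nat.sSup_mem hne hbdd
  set s := DiffuseTransport.gainIndex 𝕜 Ω m κ + 1
  set D := Metric.diam Ω
  have hD : 0 ≤ D := Metric.diam_nonneg
  set U : ℕ → ℝ → (DiffuseTransport.X₀ 𝕜 Ω m →L[𝕜] DiffuseTransport.X₀ 𝕜 Ω m) := fun n t =>
    if ht : 0 ≤ t then DiffuseTransport.iterateCLM hΩ hκ n ht else 0
  have hU : ∀ (n : ℕ) {t : ℝ} (ht : 0 ≤ t), U n t = DiffuseTransport.iterateCLM hΩ hκ n ht :=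
    fun n t ht => dif_pos ht
  have first : ∀ k : ℕ, ∃ C : ℝ, 0 < C ∧
      ∀ f : DiffuseTransport.X₀ 𝕜 Ω m, DiffuseTransport.MemX k f → ∀ (n : ℕ) (t : ℝ), 0 < t →
        ‖U n t f‖ ≤ C * (((2 : ℝ) ^ n - 1) * (((n : ℝ) + 1) / t) ^ s
          + (((n : ℝ) + 1) / t) ^ k) * DiffuseTransport.normX k f := by
    intro k
    -- The first two terms dominate the constants of the emitted and initial flights; the `1` keeps
    -- the constant positive when they vanish.
    refine ⟨D ^ s * K + D ^ k + 1, by positivity, fun f hf n t ht => ?_⟩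
    rw [hU n ht.le]
    refine (DiffuseTransport.norm_iterateCLM_le hΩ hκ hK hf n ht).trans ?_
    refine mul_le_mul_of_nonneg_right ?_ (DiffuseTransport.normX_nonneg k f)
    have hn : (n : ℝ) ≤ 2 ^ n - 1 := by
      have : n + 1 ≤ 2 ^ n := Nat.lt_two_pow_self
      have h' : ((n + 1 : ℕ) : ℝ) ≤ ((2 ^ n : ℕ) : ℝ) := Nat.cast_le.2 this
      push_cast at h'
      linarith
    have hy : 0 ≤ ((n : ℝ) + 1) / t := by positivity
    set y := ((n : ℝ) + 1) / t
    have hn0 : (0 : ℝ) ≤ 2 ^ n - 1 := (Nat.cast_nonneg n).trans hn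
    have hK0 : 0 ≤ D ^ s * (K : ℝ) := by positivity
    have hk0 : 0 ≤ D ^ k := by positivity
    have e1 : (n : ℝ) * ((D * y) ^ s * K) ≤ (D ^ s * K + D ^ k + 1) * ((2 ^ n - 1) * y ^ s) := by
      calc (n : ℝ) * ((D * y) ^ s * K) = (D ^ s * K) * (n * y ^ s) := by rw [mul_pow]; ring
        _ ≤ _ := by
          gcongr
          linarith
    have e2 : (D * y) ^ k ≤ (D ^ s * K + D ^ k + 1) * y ^ k := by
      rw [mul_pow]
      gcongr
      linarith
    linarith
  refine ⟨U, fun n t ht f hf => ?_, first, fun n => ?_⟩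
  · rw [hU n ht]
    exact DiffuseTransport.iterateCLM_toL1 hΩ hκ n ht hf
  · obtain ⟨C, hC, hCf⟩ := first s
    -- With `k = s` both powers coincide and `(2 ^ j - 1) + 1 = 2 ^ j`.
    refine ⟨∑ j ∈ Finset.range (n + 1), C * (2 ^ j * ((j : ℝ) + 1) ^ s),
      Finset.sum_pos (fun j _ => by positivity) (Finset.nonempty_range_add_one), fun f hf t ht => ?_⟩
    refine (norm_sum_le _ _).trans ?_
    rw [Finset.sum_mul, Finset.sum_mul]
    refine Finset.sum_le_sum fun j _ => (hCf f hf j t ht).trans (le_of_eq ?_)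
    rw [div_pow]
    ring
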